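/- Let $k$ be an algebraically closed field of characteristic different from $2$. For $a_{01},a_{02},a_{03},a_{12},a_{13},a_{23}\in k$ let $T_{[a_{01},a_{02},a_{03},a_{12},a_{13},a_{23}]}\subset\mathbf P^3$ denote the tetrahedroid $$\det\begin{pmatrix}0&x_0^2&x_1^2&x_2^2&x_3^2\\ x_0^2&0&a_{01}^2&a_{02}^2&a_{03}^2\\ x_1^2&a_{01}^2&0&a_{12}^2&a_{13}^2\\ x_2^2&a_{02}^2&a_{12}^2&0&a_{23}^2\\ x_3^2&a_{03}^2&a_{13}^2&a_{23}^2&0\end{pmatrix}=0 .$$ For $\kappa\in k\setminus\{0,1\}$ let $C_\kappa\subset\mathbf P^3$ be the curve $x_1^2=x_0^2-x_2^2$, $x_3^2=x_0^2-\kappa x_2^2$. For $\kappa_1,\kappa_2\in k\setminus\{0,1\}$ put $T_{\kappa_1,\kappa_2}:=T_{[\sqrt{\kappa_2-1},\,1,\,\sqrt{\kappa_2},\,\sqrt{\kappa_1-1},\,i,\,\sqrt{\kappa_1}]}$ (for any choice of the square roots and of $i=\sqrt{-1}$), and consider $$F_{\kappa_1,\kappa_2}\colon C_{\kappa_1}\times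 C_{\kappa_2}\to\mathbf P^3,\qquad ((x_0:x_1:x_2:x_3),(y_0:y_1:y_2:y_3))\mapsto(x_2y_3:x_1y_1:x_3y_2:x_0y_0).$$ (a) For all $\kappa_1,\kappa_2\in k\setminus\{0,1\}$, $F_{\kappa_1,\kappa_2}$ is a well-defined morphism of varieties with image $T_{\kappa_1,\kappa_2}$. If $\kappa_1+\kappa_2\ne1$, it is generically $8:1$ onto $T_{\kappa_1,\kappa_2}$, i.e. its fibres over a dense open subset of $T_{\kappa_1,\kappa_2}$ have exactly eight points. (b) Let $E_1,E_2$ be elliptic curves over $k$, let $\phi\colon E_1[2]\to E_2[2]$ be an isomorphism of groups, let $A:=(E_1\times E_2)/\{(x,\phi(x))\mid x\in E_1[2]\}$, and let $K:=A/(p\sim-p)$ be the (singular) Kummer surface of $A$. Then there are $\kappa_1,\kappa_2\in k\setminus\{0,1\}$ and isomorphisms of varieties $\psi_j\colon E_j\to C_{\kappa_j}$ ($j=1,2$) such that $F_{\kappa_1,\kappa_2}\circ(\psi_1\times\psi_2)$ factors through $E_1\times E_2\to A\to K$ and a morphism $g\colon K\to\mathbf P^3$. If, moreover, $\phi$ is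 not the restriction to $E_1[2]$ of an isomorphism of elliptic curves $E_1\to E_2$, then $\kappa_1+\kappa_2\ne1$ and $g$ is an isomorphism of varieties from $K$ onto the tetrahedroid $T_{\kappa_1,\kappa_2}$. In particular, in this case the Kummer surface of $A$ is isomorphic to a tetrahedroid. -/

import Mathlib

open scoped LinearAlgebra.Projectivization Topology

universe u v

/-- A *space with functions* over `k` on the point set `X` (the classical language for varieties
over an algebraically closed field): a topology and a sheaf of `k`-algebras of `k`-valued
functions, the regular functions, such that the non-vanishing locus of a regular function is open
and its inverse is regular there.  The sheaf is recorded through its germs: `RegularAt f x` says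
that `f` is regular on a neighbourhood of `x`; the regular functions on an open set `U` are those
that are regular at every point of `U` (the values of `f` off `U` play no role). -/
structure FunctionStructure (k : Type u) [Field k] (X : Type v) where
  top : TopologicalSpace X
  RegularAt : (X → k) → X → Prop
  const : ∀ (c : k) (x : X), RegularAt (fun _ => c) x
  add : ∀ {f g : X → k} {x : X}, RegularAt f x → RegularAt g x → RegularAt (fun y => f y + g y) x
  mul : ∀ {f g : X → k} {x : X}, RegularAt f x → RegularAt g x → RegularAt (fun y => f y * g y) x
  inv : ∀ {f : X → k} {x : X}, RegularAt f x → f x ≠ 0 → RegularAt (fun y => (f y)⁻¹) x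
  congr : ∀ {f g : X → k} {x : X} {U : Set X}, IsOpen[top] U → x ∈ U → (∀ y ∈ U, f y = g y) →
    RegularAt f x → RegularAt g x
  exists_nhds : ∀ {f : X → k} {x : X}, RegularAt f x →
    ∃ U : Set X, IsOpen[top] U ∧ x ∈ U ∧ ∀ y ∈ U, RegularAt f y
  isOpen_ne_zero : ∀ {f : X → k} {U : Set X}, IsOpen[top] U → (∀ y ∈ U, RegularAt f y) →
    IsOpen[top] {y | y ∈ U ∧ f y ≠ 0}

namespace FunctionStructure

/-- Morphisms: continuous maps that pull regular functions back to regular functions. -/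
def IsMorphism {k : Type*} [Field k] {X Y : Type*} (S : FunctionStructure k X)
    (T : FunctionStructure k Y) (m : X → Y) : Prop :=
  (∀ U : Set Y, IsOpen[T.top] U → IsOpen[S.top] (m ⁻¹' U)) ∧
    ∀ (f : Y → k) (x : X), T.RegularAt f (m x) → S.RegularAt (fun y => f (m y)) x

/-- Isomorphisms: bijections that are morphisms in both directions. -/
def IsIsomorphism {k : Type*} [Field k] {X Y : Type*} (S : FunctionStructure k X)
    (T : FunctionStructure k Y) (e : X ≃ Y) : Prop :=
  IsMorphism S T e ∧ IsMorphism T S e.symm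

/-- The structure induced on `A` by an injection `i : A → X`, for instance on a closed
subvariety (with its reduced structure): regular functions are locally restrictions of
regular functions. -/
def induced {k : Type*} [Field k] {A X : Type*} (i : A → X) (S : FunctionStructure k X) :
    FunctionStructure k A where
  top := S.top.induced i
  RegularAt f a := ∃ (U : Set X) (g : X → k), IsOpen[S.top] U ∧ i a ∈ U ∧
    (∀ x ∈ U, S.RegularAt g x) ∧ ∀ b, i b ∈ U → f b = g (i b)
  const c a := ⟨Set.univ, fun _ => c, @isOpen_univ _ S.top, trivial, fun x _ => S.const c x,
    fun _ _ => rfl⟩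
  add := by
    rintro f f' a ⟨U, g, hU, ha, hg, hf⟩ ⟨U', g', hU', ha', hg', hf'⟩
    refine ⟨U ∩ U', fun x => g x + g' x, S.top.isOpen_inter _ _ hU hU', ⟨ha, ha'⟩,
      fun x hx => S.add (hg x hx.1) (hg' x hx.2), fun b hb => ?_⟩
    beta_reduce
    rw [hf b hb.1, hf' b hb.2]
  mul := by
    rintro f f' a ⟨U, g, hU, ha, hg, hf⟩ ⟨U', g', hU', ha', hg', hf'⟩
    refine ⟨U ∩ U', fun x => g x * g' x, S.top.isOpen_inter _ _ hU hU', ⟨ha, ha'⟩,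
      fun x hx => S.mul (hg x hx.1) (hg' x hx.2), fun b hb => ?_⟩
    beta_reduce
    rw [hf b hb.1, hf' b hb.2]
  inv := by
    rintro f a ⟨U, g, hU, ha, hg, hf⟩ h0
    refine ⟨{x | x ∈ U ∧ g x ≠ 0}, fun x => (g x)⁻¹, S.isOpen_ne_zero hU hg,
      ⟨ha, by rwa [← hf a ha]⟩, fun x hx => S.inv (hg x hx.1) hx.2, fun b hb => ?_⟩
    change (f b)⁻¹ = (g (i b))⁻¹
    rw [hf b hb.1]
  congr := by
    rintro f f' a V ⟨V', hV', rfl⟩ haV hff' ⟨U, g, hU, ha, hg, hf⟩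
    refine ⟨U ∩ V', g, S.top.isOpen_inter _ _ hU hV', ⟨ha, haV⟩, fun x hx => hg x hx.1,
      fun b hb => ?_⟩
    rw [← hff' b hb.2, hf b hb.1]
  exists_nhds := by
    rintro f a ⟨U, g, hU, ha, hg, hf⟩
    exact ⟨i ⁻¹' U, ⟨U, hU, rfl⟩, ha, fun b hb => ⟨U, g, hU, hb, hg, hf⟩⟩
  isOpen_ne_zero := by
    rintro f V ⟨V', hV', rfl⟩ h
    refine (@isOpen_iff_forall_mem_open _ (S.top.induced i) _).2 ?_
    rintro a ⟨haV, ha0⟩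
    obtain ⟨U, g, hU, ha, hg, hf⟩ := h a haV
    refine ⟨i ⁻¹' ({x | x ∈ U ∧ g x ≠ 0} ∩ V'), ?_,
      ⟨_, S.top.isOpen_inter _ _ (S.isOpen_ne_zero hU hg) hV', rfl⟩,
      ⟨⟨ha, by rwa [← hf a ha]⟩, haV⟩⟩
    rintro b ⟨⟨hb, hb0⟩, hbV⟩
    exact ⟨hbV, by rwa [hf b hb]⟩

/-- The quotient structure along a surjection `q : X → Y`: the quotient topology, and a function
is regular if and only if its pullback to `X` is.  For the orbit map of a finite group acting on a
projective variety this is the quotient variety. -/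
def quotient {k : Type*} [Field k] {X Y : Type*} (q : X → Y) (S : FunctionStructure k X) :
    FunctionStructure k Y where
  top := S.top.coinduced q
  RegularAt f y := ∃ U : Set Y, IsOpen[S.top] (q ⁻¹' U) ∧ y ∈ U ∧
    ∀ x, q x ∈ U → S.RegularAt (fun z => f (q z)) x
  const c y := ⟨Set.univ, @isOpen_univ _ S.top, trivial, fun x _ => S.const c x⟩
  add := by
    rintro f f' y ⟨U, hU, hy, hf⟩ ⟨U', hU', hy', hf'⟩
    exact ⟨U ∩ U', S.top.isOpen_inter _ _ hU hU', ⟨hy, hy'⟩,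
      fun x hx => S.add (hf x hx.1) (hf' x hx.2)⟩
  mul := by
    rintro f f' y ⟨U, hU, hy, hf⟩ ⟨U', hU', hy', hf'⟩
    exact ⟨U ∩ U', S.top.isOpen_inter _ _ hU hU', ⟨hy, hy'⟩,
      fun x hx => S.mul (hf x hx.1) (hf' x hx.2)⟩
  inv := by
    rintro f y ⟨U, hU, hy, hf⟩ h0
    exact ⟨{z | z ∈ U ∧ f z ≠ 0}, S.isOpen_ne_zero hU hf, ⟨hy, h0⟩,
      fun x hx => S.inv (hf x hx.1) hx.2⟩
  congr := by
    rintro f f' y V hV hyV hff' ⟨U, hU, hy, hf⟩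
    exact ⟨U ∩ V, S.top.isOpen_inter _ _ hU hV, ⟨hy, hyV⟩, fun x hx =>
      S.congr (U := q ⁻¹' V) hV hx.2 (fun z hz => hff' _ hz) (hf x hx.1)⟩
  exists_nhds := by
    rintro f y ⟨U, hU, hy, hf⟩
    exact ⟨U, hU, hy, fun z hz => ⟨U, hU, hz, hf⟩⟩
  isOpen_ne_zero := by
    intro f V hV h
    refine S.isOpen_ne_zero (U := q ⁻¹' V) hV fun x hx => ?_
    obtain ⟨U, hU, hy, hf⟩ := h (q x) hx
    exact hf x hy

/-- The algebra of functions on `X × Y` generated by the regular functions on `U ⊆ X` and those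
on `V ⊆ Y`, i.e. the functions `∑ i, f i x * g i y`. -/
def boxAlgebra {k : Type*} [Field k] {X Y : Type*} (S : FunctionStructure k X)
    (T : FunctionStructure k Y) (U : Set X) (V : Set Y) : Subalgebra k (X × Y → k) :=
  Algebra.adjoin k
    ({h | ∃ f : X → k, (∀ x ∈ U, S.RegularAt f x) ∧ h = fun p => f p.1} ∪
      {h | ∃ g : Y → k, (∀ y ∈ V, T.RegularAt g y) ∧ h = fun p => g p.2})

/-- The principal open subset of `U × V` on which `D` does not vanish. -/
def box {k : Type*} [Field k] {X Y : Type*} (U : Set X) (V : Set Y) (D : X × Y → k) :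
    Set (X × Y) :=
  {p | p.1 ∈ U ∧ p.2 ∈ V ∧ D p ≠ 0}

theorem boxAlgebra_mono {k : Type*} [Field k] {X Y : Type*} (S : FunctionStructure k X)
    (T : FunctionStructure k Y) {U U' : Set X} {V V' : Set Y} (hU : U' ⊆ U) (hV : V' ⊆ V) :
    boxAlgebra S T U V ≤ boxAlgebra S T U' V' := by
  apply Algebra.adjoin_mono
  rintro h (⟨f, hf, rfl⟩ | ⟨g, hg, rfl⟩)
  · exact Or.inl ⟨f, fun x hx => hf x (hU hx), rfl⟩
  · exact Or.inr ⟨g, fun x hx => hg x (hV hx), rfl⟩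

/-- The topology of a product variety: the sets `box U V D`, with `U`, `V` open and `D` a finite
sum of products of regular functions on `U` and on `V`, form a base. -/
@[reducible]
def prodTopology {k : Type*} [Field k] {X Y : Type*} (S : FunctionStructure k X)
    (T : FunctionStructure k Y) : TopologicalSpace (X × Y) where
  IsOpen W := ∀ p ∈ W, ∃ (U : Set X) (V : Set Y) (D : X × Y → k), IsOpen[S.top] U ∧
    IsOpen[T.top] V ∧ D ∈ boxAlgebra S T U V ∧ p ∈ box U V D ∧ box U V D ⊆ W
  isOpen_univ p _ := ⟨Set.univ, Set.univ, 1, @isOpen_univ _ S.top, @isOpen_univ _ T.top,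
    one_mem _, ⟨trivial, trivial, one_ne_zero⟩, Set.subset_univ _⟩
  isOpen_inter := by
    rintro W W' hW hW' p ⟨hp, hp'⟩
    obtain ⟨U, V, D, hU, hV, hD, hpB, hB⟩ := hW p hp
    obtain ⟨U', V', D', hU', hV', hD', hpB', hB'⟩ := hW' p hp'
    refine ⟨U ∩ U', V ∩ V', D * D', S.top.isOpen_inter _ _ hU hU',
      T.top.isOpen_inter _ _ hV hV',
      mul_mem (boxAlgebra_mono S T Set.inter_subset_left Set.inter_subset_left hD)
        (boxAlgebra_mono S T Set.inter_subset_right Set.inter_subset_right hD'),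
      ⟨⟨hpB.1, hpB'.1⟩, ⟨hpB.2.1, hpB'.2.1⟩, mul_ne_zero hpB.2.2 hpB'.2.2⟩, ?_⟩
    rintro z ⟨h1, h2, h3⟩
    have h3' : D z * D' z ≠ 0 := h3
    exact ⟨hB ⟨h1.1, h2.1, left_ne_zero_of_mul h3'⟩, hB' ⟨h1.2, h2.2, right_ne_zero_of_mul h3'⟩⟩
  isOpen_sUnion := by
    rintro s hs p ⟨W, hW, hp⟩
    obtain ⟨U, V, D, hU, hV, hD, hpB, hB⟩ := hs W hW p hp
    exact ⟨U, V, D, hU, hV, hD, hpB, hB.trans (Set.subset_sUnion_of_mem hW)⟩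

/-- The product of two varieties: the topology is `prodTopology`, and the regular functions are
locally the quotients `N / D` of two finite sums of products of regular functions. -/
def prod {k : Type*} [Field k] {X Y : Type*} (S : FunctionStructure k X)
    (T : FunctionStructure k Y) : FunctionStructure k (X × Y) where
  top := prodTopology S T
  RegularAt f p := ∃ (U : Set X) (V : Set Y) (N D : X × Y → k), IsOpen[S.top] U ∧
    IsOpen[T.top] V ∧ N ∈ boxAlgebra S T U V ∧ D ∈ boxAlgebra S T U V ∧ p ∈ box U V D ∧
    ∀ z ∈ box U V D, f z = N z / D z
  const c p := ⟨Set.univ, Set.univ, algebraMap k _ c, 1, @isOpen_univ _ S.top,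
    @isOpen_univ _ T.top, Subalgebra.algebraMap_mem _ c, one_mem _,
    ⟨trivial, trivial, one_ne_zero⟩, fun z _ => by simp⟩
  add := by
    rintro f f' p ⟨U, V, N, D, hU, hV, hN, hD, hp, hf⟩ ⟨U', V', N', D', hU', hV', hN', hD', hp', hf'⟩
    have e := boxAlgebra_mono S T (Set.inter_subset_left : U ∩ U' ⊆ U)
      (Set.inter_subset_left : V ∩ V' ⊆ V)
    have e' := boxAlgebra_mono S T (Set.inter_subset_right : U ∩ U' ⊆ U')
      (Set.inter_subset_right : V ∩ V' ⊆ V')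
    refine ⟨U ∩ U', V ∩ V', N * D' + D * N', D * D', S.top.isOpen_inter _ _ hU hU',
      T.top.isOpen_inter _ _ hV hV',
      add_mem (mul_mem (e hN) (e' hD')) (mul_mem (e hD) (e' hN')), mul_mem (e hD) (e' hD'),
      ⟨⟨hp.1, hp'.1⟩, ⟨hp.2.1, hp'.2.1⟩, mul_ne_zero hp.2.2 hp'.2.2⟩, ?_⟩
    rintro z ⟨h1, h2, h3⟩
    have h3' : D z * D' z ≠ 0 := h3
    have hl := left_ne_zero_of_mul h3'
    have hr := right_ne_zero_of_mul h3'
    beta_reduce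
    rw [hf z ⟨h1.1, h2.1, hl⟩, hf' z ⟨h1.2, h2.2, hr⟩, div_add_div _ _ hl hr]
    rfl
  mul := by
    rintro f f' p ⟨U, V, N, D, hU, hV, hN, hD, hp, hf⟩ ⟨U', V', N', D', hU', hV', hN', hD', hp', hf'⟩
    have e := boxAlgebra_mono S T (Set.inter_subset_left : U ∩ U' ⊆ U)
      (Set.inter_subset_left : V ∩ V' ⊆ V)
    have e' := boxAlgebra_mono S T (Set.inter_subset_right : U ∩ U' ⊆ U')
      (Set.inter_subset_right : V ∩ V' ⊆ V')
    refine ⟨U ∩ U', V ∩ V', N * N', D * D', S.top.isOpen_inter _ _ hU hU',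
      T.top.isOpen_inter _ _ hV hV', mul_mem (e hN) (e' hN'), mul_mem (e hD) (e' hD'),
      ⟨⟨hp.1, hp'.1⟩, ⟨hp.2.1, hp'.2.1⟩, mul_ne_zero hp.2.2 hp'.2.2⟩, ?_⟩
    rintro z ⟨h1, h2, h3⟩
    have h3' : D z * D' z ≠ 0 := h3
    beta_reduce
    rw [hf z ⟨h1.1, h2.1, left_ne_zero_of_mul h3'⟩, hf' z ⟨h1.2, h2.2, right_ne_zero_of_mul h3'⟩,
      div_mul_div_comm]
    rfl
  inv := by
    rintro f p ⟨U, V, N, D, hU, hV, hN, hD, hp, hf⟩ h0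
    have hN0 : N p ≠ 0 := by
      intro h
      exact h0 (by rw [hf p hp, h, zero_div])
    refine ⟨U, V, D * D, N * D, hU, hV, mul_mem hD hD, mul_mem hN hD,
      ⟨hp.1, hp.2.1, mul_ne_zero hN0 hp.2.2⟩, ?_⟩
    rintro z ⟨h1, h2, h3⟩
    have h3' : N z * D z ≠ 0 := h3
    have hr := right_ne_zero_of_mul h3'
    beta_reduce
    rw [hf z ⟨h1, h2, hr⟩, inv_div]
    exact (mul_div_mul_right _ _ hr).symm
  congr := by
    rintro f f' p W hW hpW hff' ⟨U, V, N, D, hU, hV, hN, hD, hp, hf⟩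
    obtain ⟨U', V', D', hU', hV', hD', hp', hB'⟩ := hW p hpW
    have e := boxAlgebra_mono S T (Set.inter_subset_left : U ∩ U' ⊆ U)
      (Set.inter_subset_left : V ∩ V' ⊆ V)
    have e' := boxAlgebra_mono S T (Set.inter_subset_right : U ∩ U' ⊆ U')
      (Set.inter_subset_right : V ∩ V' ⊆ V')
    refine ⟨U ∩ U', V ∩ V', N * D', D * D', S.top.isOpen_inter _ _ hU hU',
      T.top.isOpen_inter _ _ hV hV', mul_mem (e hN) (e' hD'), mul_mem (e hD) (e' hD'),
      ⟨⟨hp.1, hp'.1⟩, ⟨hp.2.1, hp'.2.1⟩, mul_ne_zero hp.2.2 hp'.2.2⟩, ?_⟩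
    rintro z ⟨h1, h2, h3⟩
    have h3' : D z * D' z ≠ 0 := h3
    have hr := right_ne_zero_of_mul h3'
    rw [← hff' z (hB' ⟨h1.2, h2.2, hr⟩), hf z ⟨h1.1, h2.1, left_ne_zero_of_mul h3'⟩]
    exact (mul_div_mul_right _ _ hr).symm
  exists_nhds := by
    rintro f p ⟨U, V, N, D, hU, hV, hN, hD, hp, hf⟩
    exact ⟨box U V D, fun z hz => ⟨U, V, D, hU, hV, hD, hz, subset_rfl⟩, hp,
      fun z hz => ⟨U, V, N, D, hU, hV, hN, hD, hz, hf⟩⟩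
  isOpen_ne_zero := by
    rintro f W hW h p ⟨hpW, hp0⟩
    obtain ⟨U, V, N, D, hU, hV, hN, hD, hp, hf⟩ := h p hpW
    obtain ⟨U', V', D', hU', hV', hD', hp', hB'⟩ := hW p hpW
    have e := boxAlgebra_mono S T (Set.inter_subset_left : U ∩ U' ⊆ U)
      (Set.inter_subset_left : V ∩ V' ⊆ V)
    have e' := boxAlgebra_mono S T (Set.inter_subset_right : U ∩ U' ⊆ U')
      (Set.inter_subset_right : V ∩ V' ⊆ V')
    have hN0 : N p ≠ 0 := by
      intro h
      exact hp0 (by rw [hf p hp, h, zero_div])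
    refine ⟨U ∩ U', V ∩ V', N * D * D', S.top.isOpen_inter _ _ hU hU',
      T.top.isOpen_inter _ _ hV hV', mul_mem (mul_mem (e hN) (e hD)) (e' hD'),
      ⟨⟨hp.1, hp'.1⟩, ⟨hp.2.1, hp'.2.1⟩, mul_ne_zero (mul_ne_zero hN0 hp.2.2) hp'.2.2⟩, ?_⟩
    rintro z ⟨h1, h2, h3⟩
    have h3' : N z * D z * D' z ≠ 0 := h3
    have hl := left_ne_zero_of_mul h3'
    refine ⟨hB' ⟨h1.2, h2.2, right_ne_zero_of_mul h3'⟩, ?_⟩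
    rw [hf z ⟨h1.1, h2.1, right_ne_zero_of_mul hl⟩]
    exact div_ne_zero (left_ne_zero_of_mul hl) (right_ne_zero_of_mul hl)

end FunctionStructure

/-- The Zariski topology on projective space: the sets on which a homogeneous polynomial does not
vanish form a base. -/
@[reducible]
def zariskiTopology (k : Type*) [Field k] (n : ℕ) : TopologicalSpace (ℙ k (Fin n → k)) where
  IsOpen U := ∀ x ∈ U, ∃ (d : ℕ) (P : MvPolynomial (Fin n) k), P.IsHomogeneous d ∧
    MvPolynomial.eval x.rep P ≠ 0 ∧ ∀ y : ℙ k (Fin n → k), MvPolynomial.eval y.rep P ≠ 0 → y ∈ U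
  isOpen_univ x _ := ⟨0, 1, MvPolynomial.isHomogeneous_one _ _, by simp, fun _ _ => trivial⟩
  isOpen_inter := by
    rintro U V hU hV x ⟨hxU, hxV⟩
    obtain ⟨d, P, hP, hx, h⟩ := hU x hxU
    obtain ⟨d', P', hP', hx', h'⟩ := hV x hxV
    refine ⟨d + d', P * P', hP.mul hP', by simp [hx, hx'], fun y hy => ?_⟩
    rw [map_mul] at hy
    exact ⟨h y (left_ne_zero_of_mul hy), h' y (right_ne_zero_of_mul hy)⟩
  isOpen_sUnion := by
    rintro s hs x ⟨U, hU, hx⟩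
    obtain ⟨d, P, hP, hx, h⟩ := hs U hU x hx
    exact ⟨d, P, hP, hx, fun y hy => ⟨U, hU, h y hy⟩⟩

/-- Projective space of dimension `n - 1` as a variety: the regular functions are locally the
quotients of homogeneous polynomials of equal degree. -/
def projectiveSpace (k : Type*) [Field k] (n : ℕ) : FunctionStructure k (ℙ k (Fin n → k)) where
  top := zariskiTopology k n
  RegularAt f x := ∃ (d : ℕ) (P Q : MvPolynomial (Fin n) k), P.IsHomogeneous d ∧
    Q.IsHomogeneous d ∧ MvPolynomial.eval x.rep Q ≠ 0 ∧
    ∀ y : ℙ k (Fin n → k), MvPolynomial.eval y.rep Q ≠ 0 →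
      f y = MvPolynomial.eval y.rep P / MvPolynomial.eval y.rep Q
  const c x := ⟨0, MvPolynomial.C c, 1, MvPolynomial.isHomogeneous_C _ _,
    MvPolynomial.isHomogeneous_one _ _, by simp, fun y _ => by simp⟩
  add := by
    rintro f f' x ⟨d, P, Q, hP, hQ, hx, hf⟩ ⟨d', P', Q', hP', hQ', hx', hf'⟩
    refine ⟨d + d', P * Q' + Q * P', Q * Q', (hP.mul hQ').add (hQ.mul hP'), hQ.mul hQ',
      by simp [hx, hx'], fun y hy => ?_⟩
    rw [map_mul] at hy
    have hl := left_ne_zero_of_mul hy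
    have hr := right_ne_zero_of_mul hy
    beta_reduce
    rw [hf y hl, hf' y hr, div_add_div _ _ hl hr]
    simp
  mul := by
    rintro f f' x ⟨d, P, Q, hP, hQ, hx, hf⟩ ⟨d', P', Q', hP', hQ', hx', hf'⟩
    refine ⟨d + d', P * P', Q * Q', hP.mul hP', hQ.mul hQ', by simp [hx, hx'], fun y hy => ?_⟩
    rw [map_mul] at hy
    beta_reduce
    rw [hf y (left_ne_zero_of_mul hy), hf' y (right_ne_zero_of_mul hy), div_mul_div_comm]
    simp
  inv := by
    rintro f x ⟨d, P, Q, hP, hQ, hx, hf⟩ h0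
    have hP0 : MvPolynomial.eval x.rep P ≠ 0 := by
      intro h
      exact h0 (by rw [hf x hx, h, zero_div])
    refine ⟨d + d, Q * Q, P * Q, hQ.mul hQ, hP.mul hQ, by simp [hx, hP0], fun y hy => ?_⟩
    rw [map_mul] at hy
    have hr := right_ne_zero_of_mul hy
    beta_reduce
    rw [hf y hr, inv_div, map_mul, map_mul, mul_div_mul_right _ _ hr]
  congr := by
    rintro f f' x U hU hxU hff' ⟨d, P, Q, hP, hQ, hx, hf⟩
    obtain ⟨e, R, hR, hxR, h⟩ := hU x hxU
    refine ⟨d + e, P * R, Q * R, hP.mul hR, hQ.mul hR, by simp [hx, hxR], fun y hy => ?_⟩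
    rw [map_mul] at hy
    have hr := right_ne_zero_of_mul hy
    rw [← hff' y (h y hr), hf y (left_ne_zero_of_mul hy), map_mul, map_mul,
      mul_div_mul_right _ _ hr]
  exists_nhds := by
    rintro f x ⟨d, P, Q, hP, hQ, hx, hf⟩
    exact ⟨{y | MvPolynomial.eval y.rep Q ≠ 0}, fun y hy => ⟨d, Q, hQ, hy, fun _ h => h⟩, hx,
      fun y hy => ⟨d, P, Q, hP, hQ, hy, hf⟩⟩
  isOpen_ne_zero := by
    rintro f U hU h x ⟨hxU, hx0⟩
    obtain ⟨d, P, Q, hP, hQ, hx, hf⟩ := h x hxU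
    obtain ⟨e, R, hR, hxR, h⟩ := hU x hxU
    have hP0 : MvPolynomial.eval x.rep P ≠ 0 := by
      intro h
      exact hx0 (by rw [hf x hx, h, zero_div])
    refine ⟨d + d + e, P * Q * R, (hP.mul hQ).mul hR, by simp [hx, hP0, hxR], fun y hy => ?_⟩
    rw [map_mul, map_mul] at hy
    have hl := left_ne_zero_of_mul hy
    refine ⟨h y (right_ne_zero_of_mul hy), ?_⟩
    rw [hf y (right_ne_zero_of_mul hl)]
    exact div_ne_zero (left_ne_zero_of_mul hl) (right_ne_zero_of_mul hl)

/-- A subset of projective space (below always a closed one) as a variety. -/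
def projectiveSubvariety {k : Type*} [Field k] {n : ℕ} (Z : Set (ℙ k (Fin n → k))) :
    FunctionStructure k Z :=
  (projectiveSpace k n).induced Subtype.val

/-- The map `m` is onto `Z` and has exactly `N` points in the fibres over a dense Zariski-open
subset of `Z`. -/
def IsGenericallyToOneOnto {k : Type*} [Field k] {n : ℕ} {X : Type*} (N : ℕ)
    (m : X → ℙ k (Fin n → k)) (Z : Set (ℙ k (Fin n → k))) : Prop :=
  Set.range m = Z ∧ ∃ U : Set (ℙ k (Fin n → k)), IsOpen[(projectiveSpace k n).top] U ∧
    Z ⊆ @closure _ (projectiveSpace k n).top (U ∩ Z) ∧ ∀ z ∈ U ∩ Z, (m ⁻¹' {z}).ncard = N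

namespace WeierstrassCurve

/-- The points of a Weierstrass curve in the projective plane: `(x, y) ↦ (x : y : 1)`, and the
point at infinity is `(0 : 1 : 0)`. -/
def toPlane {k : Type*} [Field k] (W : WeierstrassCurve k) :
    W.toAffine.Point → ℙ k (Fin 3 → k)
  | .zero => Projectivization.mk k ![0, 1, 0] fun h => by simpa using congrFun h 1
  | @Affine.Point.some _ _ _ x y _ =>
      Projectivization.mk k ![x, y, 1] fun h => by simpa using congrFun h 2

/-- The projective Weierstrass curve as a variety. -/
def variety {k : Type*} [Field k] (W : WeierstrassCurve k) :
    FunctionStructure k W.toAffine.Point :=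
  (projectiveSpace k 3).induced W.toPlane

end WeierstrassCurve

/-- The quotient of a commutative group by `p ∼ -p`. -/
def negSetoid (A : Type*) [AddCommGroup A] : Setoid A where
  r p q := q = p ∨ q = -p
  iseqv := by
    refine ⟨fun p => Or.inl rfl, ?_, ?_⟩
    · rintro p q (rfl | rfl) <;> simp
    · rintro p q r (rfl | rfl) (rfl | rfl) <;> simp

section Gluing

/-- The two-torsion subgroup `E[2]` of an elliptic curve. -/
abbrev TwoTorsion {k : Type*} [Field k] [DecidableEq k] (W : WeierstrassCurve k) :
    AddSubgroup W.toAffine.Point :=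
  AddSubgroup.torsionBy W.toAffine.Point 2

/-- The subgroup `{(x, φ x) | x ∈ E₁[2]}` of `E₁ × E₂`. -/
def torsionGraph {k : Type*} [Field k] [DecidableEq k] {W₁ W₂ : WeierstrassCurve k}
    (φ : TwoTorsion W₁ ≃+ TwoTorsion W₂) : AddSubgroup (W₁.toAffine.Point × W₂.toAffine.Point) :=
  ((TwoTorsion W₁).subtype.prod ((TwoTorsion W₂).subtype.comp φ.toAddMonoidHom)).range

/-- The points of the abelian surface `A = (E₁ × E₂) / {(x, φ x)}`. -/
abbrev GluedSurface {k : Type*} [Field k] [DecidableEq k] {W₁ W₂ : WeierstrassCurve k}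
    (φ : TwoTorsion W₁ ≃+ TwoTorsion W₂) : Type _ :=
  (W₁.toAffine.Point × W₂.toAffine.Point) ⧸ torsionGraph φ

/-- The abelian surface `A` as a variety. -/
def gluedSurface {k : Type*} [Field k] [DecidableEq k] {W₁ W₂ : WeierstrassCurve k}
    (φ : TwoTorsion W₁ ≃+ TwoTorsion W₂) : FunctionStructure k (GluedSurface φ) :=
  (W₁.variety.prod W₂.variety).quotient (QuotientAddGroup.mk (s := torsionGraph φ))

/-- The points of the (singular) Kummer surface `A / (p ∼ -p)`. -/
abbrev KummerSurface {k : Type*} [Field k] [DecidableEq k] {W₁ W₂ : WeierstrassCurve k}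
    (φ : TwoTorsion W₁ ≃+ TwoTorsion W₂) : Type _ :=
  Quotient (negSetoid (GluedSurface φ))

/-- The Kummer surface of `A` as a variety. -/
def kummerSurface {k : Type*} [Field k] [DecidableEq k] {W₁ W₂ : WeierstrassCurve k}
    (φ : TwoTorsion W₁ ≃+ TwoTorsion W₂) : FunctionStructure k (KummerSurface φ) :=
  (gluedSurface φ).quotient (Quotient.mk (negSetoid (GluedSurface φ)))

/-- The covering `E₁ × E₂ → A → A / (p ∼ -p)`. -/
def toKummer {k : Type*} [Field k] [DecidableEq k] {W₁ W₂ : WeierstrassCurve k}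
    (φ : TwoTorsion W₁ ≃+ TwoTorsion W₂) (p : W₁.toAffine.Point × W₂.toAffine.Point) :
    KummerSurface φ :=
  Quotient.mk (negSetoid (GluedSurface φ)) (QuotientAddGroup.mk (s := torsionGraph φ) p)

/-- `φ` is the restriction to the two-torsion of an isomorphism of elliptic curves.  (An
isomorphism of varieties that extends `φ` sends zero to zero.) -/
def IsInducedByIsomorphism {k : Type*} [Field k] [DecidableEq k] {W₁ W₂ : WeierstrassCurve k}
    (φ : TwoTorsion W₁ ≃+ TwoTorsion W₂) : Prop :=
  ∃ e : W₁.toAffine.Point ≃ W₂.toAffine.Point,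
    FunctionStructure.IsIsomorphism W₁.variety W₂.variety e ∧
      ∀ x : TwoTorsion W₁, e x = φ x

end Gluing

/-- The tetrahedroid `T_[a₀₁, a₀₂, a₀₃, a₁₂, a₁₃, a₂₃]` in projective three-space. -/
def tetrahedroid {k : Type*} [Field k] (a₀₁ a₀₂ a₀₃ a₁₂ a₁₃ a₂₃ : k) :
    Set (ℙ k (Fin 4 → k)) :=
  {x | Matrix.det !![
    0,            x.rep 0 ^ 2, x.rep 1 ^ 2, x.rep 2 ^ 2, x.rep 3 ^ 2;
    x.rep 0 ^ 2,  0,           a₀₁ ^ 2,     a₀₂ ^ 2,     a₀₃ ^ 2;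
    x.rep 1 ^ 2,  a₀₁ ^ 2,     0,           a₁₂ ^ 2,     a₁₃ ^ 2;
    x.rep 2 ^ 2,  a₀₂ ^ 2,     a₁₂ ^ 2,     0,           a₂₃ ^ 2;
    x.rep 3 ^ 2,  a₀₃ ^ 2,     a₁₃ ^ 2,     a₂₃ ^ 2,     0] = 0}

/-- The curve `x₁² = x₀² - x₂²`, `x₃² = x₀² - κ x₂²` in projective three-space. -/
def spaceCurve {k : Type*} [Field k] (κ : k) : Set (ℙ k (Fin 4 → k)) :=
  {x | x.rep 1 ^ 2 = x.rep 0 ^ 2 - x.rep 2 ^ 2 ∧ x.rep 3 ^ 2 = x.rep 0 ^ 2 - κ * x.rep 2 ^ 2}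

/-- The vector `(x₂ y₃, x₁ y₁, x₃ y₂, x₀ y₀)`. -/
def weberVector {k : Type*} [Field k] (x y : Fin 4 → k) : Fin 4 → k :=
  ![x 2 * y 3, x 1 * y 1, x 3 * y 2, x 0 * y 0]

theorem weberVector_ne_zero {k : Type*} [Field k] {κ₁ κ₂ : k} (h₁ : κ₁ ≠ 0) (h₂ : κ₂ ≠ 0)
    (x : spaceCurve κ₁) (y : spaceCurve κ₂) : weberVector x.1.rep y.1.rep ≠ 0 := by
  have key : ∀ {κ : k}, κ ≠ 0 → ∀ z : spaceCurve κ, z.1.rep 0 = 0 →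
      z.1.rep 1 ≠ 0 ∧ z.1.rep 2 ≠ 0 ∧ z.1.rep 3 ≠ 0 := by
    intro κ hκ z h0
    obtain ⟨e1, e3⟩ := z.2
    have h2 : z.1.rep 2 ≠ 0 := by
      intro h2
      refine z.1.rep_nonzero (funext fun i => ?_)
      fin_cases i
      · exact h0
      · simpa [h0, h2] using e1
      · exact h2
      · simpa [h0, h2] using e3
    refine ⟨fun h => h2 ?_, h2, fun h => h2 ?_⟩
    · simpa [h0, h] using e1
    · simpa [h0, h, hκ] using e3
  have key' : ∀ {κ : k} (z : spaceCurve κ), ¬ (z.1.rep 1 = 0 ∧ z.1.rep 2 = 0 ∧ z.1.rep 3 = 0) := by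
    rintro κ z ⟨h1, h2, h3⟩
    refine z.1.rep_nonzero (funext fun i => ?_)
    fin_cases i
    · simpa [h1, h2] using z.2.1.symm
    · exact h1
    · exact h2
    · exact h3
  intro h
  have e0 : x.1.rep 2 * y.1.rep 3 = 0 := congrFun h 0
  have e1 : x.1.rep 1 * y.1.rep 1 = 0 := congrFun h 1
  have e2 : x.1.rep 3 * y.1.rep 2 = 0 := congrFun h 2
  have e3 : x.1.rep 0 * y.1.rep 0 = 0 := congrFun h 3
  rcases mul_eq_zero.1 e3 with h0 | h0
  · obtain ⟨n1, n2, n3⟩ := key h₁ x h0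
    exact key' y ⟨(mul_eq_zero.1 e1).resolve_left n1, (mul_eq_zero.1 e2).resolve_left n3,
      (mul_eq_zero.1 e0).resolve_left n2⟩
  · obtain ⟨n1, n2, n3⟩ := key h₂ y h0
    exact key' x ⟨(mul_eq_zero.1 e1).resolve_right n1, (mul_eq_zero.1 e0).resolve_right n3,
      (mul_eq_zero.1 e2).resolve_right n2⟩

/-- The map `((x₀ : x₁ : x₂ : x₃), (y₀ : y₁ : y₂ : y₃)) ↦ (x₂ y₃ : x₁ y₁ : x₃ y₂ : x₀ y₀)` from the
product of two space curves to projective three-space. -/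
noncomputable def weberMap {k : Type*} [Field k] {κ₁ κ₂ : k} (h₁ : κ₁ ≠ 0) (h₂ : κ₂ ≠ 0)
    (p : spaceCurve κ₁ × spaceCurve κ₂) : ℙ k (Fin 4 → k) :=
  Projectivization.mk k (weberVector p.1.1.rep p.2.1.rep) (weberVector_ne_zero h₁ h₂ p.1 p.2)

/-! Let `e i` be the abscissas of the points of order two of a Weierstrass curve. The coordinates `z
0 = 2y + a₁x + a₃` and `z (i + 1) = (x - e i)² - ∏ (e i - e j)` satisfy `(z (i + 1) / z 0)² = x(2P)
- e i`. They embed the curve as an intersection of two diagonal quadrics (`toQuartic`). Adding a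
two-torsion point does not change `2P`, so it acts by sign changes
(`IsTwoTorsionFrame.quarticVec_add`); inversion reverses only `z 0` (`quarticVec_neg`). Up to a
common sign these are all the sign changes of four coordinates (`exists_translateSign_eq`).

Number the two-torsion of the second curve through `φ`, with abscissas `f i`. Permuting and
rescaling coordinates turns the quartics into space curves with `κ₁ = (e 2 - e 0) / (e 1 - e 0)` and
`κ₂ = (f 1 - f 2) / (f 1 - f 0)`. The permutations are chosen so that the Weber map multiplies
coordinates of the same index of the two quartics. It is therefore invariant under simultaneous sign
changes, that is, under translation by `(T, φ T)` and under `-1`, and so it descends to the Kummer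
surface.

For the image, put `D = x₂² y₂²`. The four products of `x₀², x₂²` with `y₀², y₂²` are `w₃²`, `w₂² +
κ₁ D`, `w₀² + κ₂ D` and `D`. They form a matrix of rank one, and `w₁²` gives a linear equation for
`D`. Eliminating `D` gives the determinant of the tetrahedroid (`mem_tetrahedroid_iff`); conversely
a solution `D` allows the matrix to be factored and square roots to be extracted
(`WeberEquation.exists_cone`).

If `κ₁ + κ₂ ≠ 1`, the linear equation determines `D` from `w`. This has two consequences. The fibres
are exactly the orbits of sign changes (`exists_sign_of_weberVector_eq`), which are generically of
size `2⁴ / 2 = 8`. Moreover all invariant forms are polynomials in `w`, so after splitting forms by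
characters, openness and regularity descend along the Weber map (`isQuotientMap_weberMap`). Hence
the bijection from the Kummer surface to the tetrahedroid is an isomorphism, also at the singular
points.

Finally `κ₁ + κ₂ = 1` means that the triples `e` and `f` have proportional differences. Rescaling `z
0` then identifies the two quartics compatibly with `φ` (`isInducedByIsomorphism_of_add_eq_one`). -/

namespace FunctionStructure

/-! ### Formal properties of morphisms, quotients and products. -/

variable {k : Type*} [Field k] {X Y Z X' Y' : Type*}

theorem IsMorphism.comp {S : FunctionStructure k X} {T : FunctionStructure k Y}
    {R : FunctionStructure k Z} {n : Y → Z} {m : X → Y} (hn : IsMorphism T R n)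
    (hm : IsMorphism S T m) : IsMorphism S R (n ∘ m) :=
  ⟨fun U hU => hm.1 _ (hn.1 U hU), fun f x hf => hm.2 (fun y => f (n y)) x (hn.2 f (m x) hf)⟩

theorem IsIsomorphism.symm {S : FunctionStructure k X} {T : FunctionStructure k Y} {e : X ≃ Y}
    (h : IsIsomorphism S T e) : IsIsomorphism T S e.symm :=
  ⟨h.2, h.1⟩

theorem IsIsomorphism.trans {S : FunctionStructure k X} {T : FunctionStructure k Y}
    {R : FunctionStructure k Z} {e : X ≃ Y} {e' : Y ≃ Z} (h : IsIsomorphism S T e)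
    (h' : IsIsomorphism T R e') : IsIsomorphism S R (e.trans e') :=
  ⟨h'.1.comp h.1, h.2.comp h'.2⟩

theorem isMorphism_quotient (q : X → Y) (S : FunctionStructure k X) :
    IsMorphism S (quotient q S) q :=
  ⟨fun _ hU => hU, fun _ x ⟨_, _, hx, h⟩ => h x hx⟩

theorem IsMorphism.of_comp_quotient {S : FunctionStructure k X} {T : FunctionStructure k Z}
    {q : X → Y} {g : Y → Z} (h : IsMorphism S T (g ∘ q)) : IsMorphism (quotient q S) T g := by
  refine ⟨fun U hU => h.1 U hU, fun f y hf => ?_⟩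
  obtain ⟨V, hV, hy, hfV⟩ := T.exists_nhds hf
  exact ⟨g ⁻¹' V, h.1 V hV, hy, fun x hx => h.2 f x (hfV _ hx)⟩

theorem IsMorphism.to_induced {S : FunctionStructure k X} {T : FunctionStructure k Z}
    {i : Y → Z} {m : X → Y} (h : IsMorphism S T (i ∘ m)) : IsMorphism S (induced i T) m := by
  refine ⟨?_, ?_⟩
  · rintro _ ⟨V, hV, rfl⟩
    exact h.1 V hV
  · rintro f x ⟨U, g, hU, hx, hg, hf⟩
    exact S.congr (h.1 U hU) hx (fun y hy => (hf (m y) hy).symm) (h.2 g x (hg _ hx))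

theorem boxAlgebra_comp {S : FunctionStructure k X} {T : FunctionStructure k Y}
    {S' : FunctionStructure k X'} {T' : FunctionStructure k Y'} {m : X → X'} {n : Y → Y'}
    (hm : IsMorphism S S' m) (hn : IsMorphism T T' n) {U : Set X'} {V : Set Y'}
    {N : X' × Y' → k} (hN : N ∈ boxAlgebra S' T' U V) :
    N ∘ Prod.map m n ∈ boxAlgebra S T (m ⁻¹' U) (n ⁻¹' V) := by
  induction hN using Algebra.adjoin_induction with
  | mem x hx =>
    apply Algebra.subset_adjoin
    rcases hx with ⟨f, hf, rfl⟩ | ⟨f, hf, rfl⟩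
    · exact Or.inl ⟨fun x => f (m x), fun x hx => hm.2 f x (hf _ hx), rfl⟩
    · exact Or.inr ⟨fun x => f (n x), fun x hx => hn.2 f x (hf _ hx), rfl⟩
  | algebraMap r => exact Subalgebra.algebraMap_mem _ r
  | add _ _ _ _ h h' => exact add_mem h h'
  | mul _ _ _ _ h h' => exact mul_mem h h'

theorem IsMorphism.prodMap {S : FunctionStructure k X} {T : FunctionStructure k Y}
    {S' : FunctionStructure k X'} {T' : FunctionStructure k Y'} {m : X → X'} {n : Y → Y'}
    (hm : IsMorphism S S' m) (hn : IsMorphism T T' n) :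
    IsMorphism (S.prod T) (S'.prod T') (Prod.map m n) := by
  refine ⟨fun W hW p hp => ?_, ?_⟩
  · obtain ⟨U, V, D, hU, hV, hD, hpB, hB⟩ := hW _ hp
    exact ⟨m ⁻¹' U, n ⁻¹' V, _, hm.1 U hU, hn.1 V hV, boxAlgebra_comp hm hn hD, hpB,
      fun z hz => hB hz⟩
  · rintro f p ⟨U, V, N, D, hU, hV, hN, hD, hp, hf⟩
    exact ⟨m ⁻¹' U, n ⁻¹' V, _, _, hm.1 U hU, hn.1 V hV, boxAlgebra_comp hm hn hN,
      boxAlgebra_comp hm hn hD, hp, fun z hz => hf _ hz⟩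

/-- A surjection along which openness and regularity can be tested. -/
structure IsQuotientMap (S : FunctionStructure k X) (T : FunctionStructure k Y) (q : X → Y) :
    Prop where
  surjective : Function.Surjective q
  isOpen : ∀ U : Set Y, IsOpen[S.top] (q ⁻¹' U) → IsOpen[T.top] U
  regularAt : ∀ (f : Y → k) (x : X), S.RegularAt (fun z => f (q z)) x → T.RegularAt f (q x)

theorem IsQuotientMap.isMorphism {S : FunctionStructure k X} {T : FunctionStructure k Y}
    {R : FunctionStructure k Z} {q : X → Y} (hq : IsQuotientMap S T q) {m : Y → Z}
    (h : IsMorphism S R (m ∘ q)) : IsMorphism T R m := by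
  refine ⟨fun U hU => hq.isOpen _ (h.1 U hU), fun f y hf => ?_⟩
  obtain ⟨x, rfl⟩ := hq.surjective y
  exact hq.regularAt _ x (h.2 f x hf)

end FunctionStructure

/-! ### Projective varieties and maps given by homogeneous forms. -/

section Forms

variable {k : Type*} [Field k] {a b n m : ℕ} {A B : Type*}

theorem MvPolynomial.eval_aeval_eq (G : Fin m → MvPolynomial (Fin n) k)
    (P : MvPolynomial (Fin m) k) (v : Fin n → k) :
    MvPolynomial.eval v (MvPolynomial.aeval G P) =
      MvPolynomial.eval (fun l => MvPolynomial.eval v (G l)) P := by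
  induction P using MvPolynomial.induction_on with
  | C c => simp
  | add p q hp hq => rw [map_add, map_add, map_add, hp, hq]
  | mul_X p l hp => rw [map_mul, map_mul, map_mul, hp, MvPolynomial.aeval_X, MvPolynomial.eval_X]

theorem MvPolynomial.IsHomogeneous.eval_smul_vec {P : MvPolynomial (Fin n) k} {d : ℕ}
    (hP : P.IsHomogeneous d) (c : k) (v : Fin n → k) :
    MvPolynomial.eval (c • v) P = c ^ d * MvPolynomial.eval v P := by
  rw [MvPolynomial.eval_eq', MvPolynomial.eval_eq', Finset.mul_sum]
  refine Finset.sum_congr rfl fun s hs => ?_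
  have h : d = ∑ i, s i := (hP.degree_eq_sum_deg_support hs).trans
    (Finset.sum_subset (Finset.subset_univ _) (by simp))
  simp only [Pi.smul_apply, smul_eq_mul, mul_pow, Finset.prod_mul_distrib, Finset.prod_pow_eq_pow_sum,
    ← h]
  ring

theorem Projectivization.exists_rep_mk (v : Fin n → k) (hv : v ≠ 0) :
    ∃ c : k, c ≠ 0 ∧ (Projectivization.mk k v hv).rep = c • v := by
  obtain ⟨c, hc⟩ := Projectivization.exists_smul_eq_mk_rep k v hv
  exact ⟨c, c.ne_zero, hc.symm⟩

theorem Projectivization.exists_rep_ne_zero (p : ℙ k (Fin n → k)) : ∃ i, p.rep i ≠ 0 := by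
  by_contra! h
  exact p.rep_nonzero (funext h)

theorem Projectivization.mk_eq_mk_of_smul {v w : Fin n → k} (hv : v ≠ 0) (hw : w ≠ 0) (c : k)
    (h : c • w = v) : Projectivization.mk k v hv = Projectivization.mk k w hw :=
  (Projectivization.mk_eq_mk_iff' k v w hv hw).2 ⟨c, h⟩

theorem Projectivization.exists_smul_of_mk_eq_mk {v w : Fin n → k} {hv : v ≠ 0} {hw : w ≠ 0}
    (h : Projectivization.mk k v hv = Projectivization.mk k w hw) : ∃ c : k, c ≠ 0 ∧ c • w = v := by
  obtain ⟨c, hc⟩ := (Projectivization.mk_eq_mk_iff k v w hv hw).1 h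
  exact ⟨c, c.ne_zero, hc⟩

theorem eval_rep_mk_ne_zero_iff {P : MvPolynomial (Fin n) k} {d : ℕ} (hP : P.IsHomogeneous d)
    (v : Fin n → k) (hv : v ≠ 0) :
    MvPolynomial.eval (Projectivization.mk k v hv).rep P ≠ 0 ↔ MvPolynomial.eval v P ≠ 0 := by
  obtain ⟨c, hc, h⟩ := Projectivization.exists_rep_mk v hv
  rw [h, hP.eval_smul_vec]
  simp [hc]

theorem eval_rep_mk_div {P Q : MvPolynomial (Fin n) k} {d : ℕ} (hP : P.IsHomogeneous d)
    (hQ : Q.IsHomogeneous d) (v : Fin n → k) (hv : v ≠ 0) :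
    MvPolynomial.eval (Projectivization.mk k v hv).rep P /
      MvPolynomial.eval (Projectivization.mk k v hv).rep Q =
      MvPolynomial.eval v P / MvPolynomial.eval v Q := by
  obtain ⟨c, hc, h⟩ := Projectivization.exists_rep_mk v hv
  rw [h, hP.eval_smul_vec, hQ.eval_smul_vec, mul_div_mul_left _ _ (pow_ne_zero _ hc)]

theorem isOpen_zariski_of_homogeneous {P : MvPolynomial (Fin n) k} {d : ℕ}
    (hP : P.IsHomogeneous d) :
    IsOpen[(projectiveSpace k n).top] {x | MvPolynomial.eval x.rep P ≠ 0} :=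
  fun _ hx => ⟨d, P, hP, hx, fun _ h => h⟩

theorem regularAt_div {P Q : MvPolynomial (Fin n) k} {d : ℕ}
    (hP : P.IsHomogeneous d) (hQ : Q.IsHomogeneous d) {x : ℙ k (Fin n → k)}
    (hx : MvPolynomial.eval x.rep Q ≠ 0) :
    (projectiveSpace k n).RegularAt
      (fun y => MvPolynomial.eval y.rep P / MvPolynomial.eval y.rep Q) x :=
  ⟨d, P, Q, hP, hQ, hx, fun _ _ => rfl⟩

namespace FunctionStructure

theorem isOpen_induced_iff {i : A → ℙ k (Fin n → k)} {s : Set A} :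
    IsOpen[(induced i (projectiveSpace k n)).top] s ↔ ∀ x ∈ s, ∃ (d : ℕ)
      (R : MvPolynomial (Fin n) k), R.IsHomogeneous d ∧ MvPolynomial.eval (i x).rep R ≠ 0 ∧
        ∀ y, MvPolynomial.eval (i y).rep R ≠ 0 → y ∈ s := by
  constructor
  · rintro ⟨V, hV, rfl⟩ x hx
    obtain ⟨d, P, hP, hx, h⟩ := hV _ hx
    exact ⟨d, P, hP, hx, fun y hy => h _ hy⟩
  · intro h
    refine ⟨{x | ∃ (d : ℕ) (R : MvPolynomial (Fin n) k), R.IsHomogeneous d ∧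
      MvPolynomial.eval x.rep R ≠ 0 ∧ ∀ y, MvPolynomial.eval (i y).rep R ≠ 0 → y ∈ s}, ?_, ?_⟩
    · rintro x ⟨d, R, hR, hx, h⟩
      exact ⟨d, R, hR, hx, fun y hy => ⟨d, R, hR, hy, h⟩⟩
    · ext x
      exact ⟨fun ⟨d, R, hR, hx, h⟩ => h x hx, h x⟩

/-- The open set on which `f` is a restriction contains some locus `R ≠ 0`. Multiplying numerator
and denominator by `R` makes one fraction valid wherever its denominator does not vanish. -/
theorem regularAt_induced_iff {i : A → ℙ k (Fin n → k)} {f : A → k} {x : A} :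
    (induced i (projectiveSpace k n)).RegularAt f x ↔ ∃ (d : ℕ) (P Q : MvPolynomial (Fin n) k),
      P.IsHomogeneous d ∧ Q.IsHomogeneous d ∧ MvPolynomial.eval (i x).rep Q ≠ 0 ∧
        ∀ y, MvPolynomial.eval (i y).rep Q ≠ 0 →
          f y = MvPolynomial.eval (i y).rep P / MvPolynomial.eval (i y).rep Q := by
  constructor
  · rintro ⟨U, g, hU, hx, hg, hf⟩
    obtain ⟨d, P, Q, hP, hQ, hxQ, hgQ⟩ := hg _ hx
    obtain ⟨e, R, hR, hxR, h⟩ := hU _ hx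
    refine ⟨d + e, P * R, Q * R, hP.mul hR, hQ.mul hR, by simp [hxQ, hxR], fun y hy => ?_⟩
    rw [map_mul] at hy
    have hr := right_ne_zero_of_mul hy
    rw [hf y (h _ hr), hgQ _ (left_ne_zero_of_mul hy), map_mul, map_mul, mul_div_mul_right _ _ hr]
  · rintro ⟨d, P, Q, hP, hQ, hxQ, h⟩
    exact ⟨_, _, isOpen_zariski_of_homogeneous hQ, hxQ, fun y hy => regularAt_div hP hQ hy, h⟩

/-- A map that is locally given by forms of equal degree is a morphism. -/
theorem isMorphism_of_forms {i : A → ℙ k (Fin n → k)} {j : B → ℙ k (Fin m → k)} {f : A → B}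
    (h : ∀ x, ∃ (d : ℕ) (G : Fin m → MvPolynomial (Fin n) k), (∀ l, (G l).IsHomogeneous d) ∧
      (fun l => MvPolynomial.eval (i x).rep (G l)) ≠ 0 ∧
      ∀ y, ∀ hy : (fun l => MvPolynomial.eval (i y).rep (G l)) ≠ 0,
        j (f y) = Projectivization.mk k _ hy) :
    IsMorphism (induced i (projectiveSpace k n)) (induced j (projectiveSpace k m)) f := by
  have ne : ∀ (G : Fin m → MvPolynomial (Fin n) k) (d : ℕ), (∀ l, (G l).IsHomogeneous d) →
      ∀ v l, MvPolynomial.eval v (G l) ≠ 0 → (fun l => MvPolynomial.eval v (G l)) ≠ 0 :=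
    fun G d _ v l h h0 => h (congrFun h0 l)
  apply IsMorphism.to_induced
  constructor
  · intro U hU
    refine isOpen_induced_iff.2 fun x hx => ?_
    obtain ⟨e, P, hP, hxP, hPU⟩ := hU _ hx
    obtain ⟨d, G, hG, hx0, hGf⟩ := h x
    rw [Function.comp_apply, hGf x hx0, eval_rep_mk_ne_zero_iff hP] at hxP
    obtain ⟨l, hl⟩ := Function.ne_iff.1 hx0
    -- The factor `G l` removes the common zeros of the forms `G`, where they do not describe `f`.
    refine ⟨_, MvPolynomial.aeval G P * G l, (hP.aeval G hG).mul (hG l), ?_, fun y hy => ?_⟩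
    · rw [map_mul, MvPolynomial.eval_aeval_eq]
      exact mul_ne_zero hxP hl
    · rw [map_mul, MvPolynomial.eval_aeval_eq] at hy
      have hy0 := ne G d hG _ l (right_ne_zero_of_mul hy)
      refine hPU _ ?_
      rw [Function.comp_apply, hGf y hy0, eval_rep_mk_ne_zero_iff hP]
      exact left_ne_zero_of_mul hy
  · rintro g x ⟨e, P, Q, hP, hQ, hxQ, hPQ⟩
    obtain ⟨d, G, hG, hx0, hGf⟩ := h x
    rw [Function.comp_apply, hGf x hx0, eval_rep_mk_ne_zero_iff hQ] at hxQ
    obtain ⟨l, hl⟩ := Function.ne_iff.1 hx0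
    refine regularAt_induced_iff.2 ⟨_, MvPolynomial.aeval G P * G l, MvPolynomial.aeval G Q * G l,
      (hP.aeval G hG).mul (hG l), (hQ.aeval G hG).mul (hG l), ?_, fun y hy => ?_⟩
    · rw [map_mul, MvPolynomial.eval_aeval_eq]
      exact mul_ne_zero hxQ hl
    · rw [map_mul, MvPolynomial.eval_aeval_eq] at hy
      have hy0 := ne G d hG _ l (right_ne_zero_of_mul hy)
      have hr := right_ne_zero_of_mul hy
      rw [map_mul, map_mul, MvPolynomial.eval_aeval_eq, MvPolynomial.eval_aeval_eq, mul_div_mul_right _ _ hr, Function.comp_apply,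
        hPQ (j (f y)), hGf y hy0, eval_rep_mk_div hP hQ]
      rw [hGf y hy0, eval_rep_mk_ne_zero_iff hQ]
      exact left_ne_zero_of_mul hy

/-- An invertible linear map that carries `Z` onto `Z'` induces an isomorphism of varieties. -/
theorem exists_isIsomorphism_of_linearEquiv {Z Z' : Set (ℙ k (Fin n → k))}
    (M : (Fin n → k) ≃ₗ[k] (Fin n → k))
    (hM : ∀ v (hv : v ≠ 0), Projectivization.mk k v hv ∈ Z ↔
      Projectivization.mk k (M v) (by simpa using hv) ∈ Z') :
    ∃ e : Z ≃ Z', IsIsomorphism (projectiveSubvariety Z) (projectiveSubvariety Z') e ∧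
      ∀ v (hv : v ≠ 0) (h : Projectivization.mk k v hv ∈ Z),
        (e ⟨_, h⟩ : ℙ k (Fin n → k)) = Projectivization.mk k (M v) (by simpa using hv) := by
  have mor : ∀ (M : (Fin n → k) ≃ₗ[k] (Fin n → k)) (Z Z' : Set (ℙ k (Fin n → k))) (f : Z → Z'),
      (∀ x, (f x : ℙ k (Fin n → k)) = Projectivization.map M.toLinearMap M.injective x) →
      IsMorphism (projectiveSubvariety Z) (projectiveSubvariety Z') f := by
    intro M Z Z' f hf
    have key : ∀ v l, MvPolynomial.eval v (∑ s, MvPolynomial.C (M (Pi.single s 1) l) *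
        MvPolynomial.X s) = M v l := by
      intro v l
      conv_rhs => rw [← Finset.univ_sum_single v]
      simp only [map_sum, map_mul, MvPolynomial.eval_C, MvPolynomial.eval_X, Finset.sum_apply]
      refine Finset.sum_congr rfl fun s _ => ?_
      rw [← mul_one (v s), ← smul_eq_mul (v s), Pi.single_smul, map_smul]
      simp [mul_comm]
    refine isMorphism_of_forms fun x => ⟨1, fun l => ∑ s, MvPolynomial.C (M (Pi.single s 1) l) *
        MvPolynomial.X s, fun l => MvPolynomial.IsHomogeneous.sum _ _ _ fun s _ =>
          MvPolynomial.isHomogeneous_C_mul_X _ _, ?_, fun y hy => ?_⟩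
    · simp only [key]
      exact fun h => x.1.rep_nonzero (by simpa using h)
    · rw [hf]
      conv_lhs => rw [← y.1.mk_rep]
      rw [Projectivization.map_mk]
      congr 1
      funext l
      exact (key _ l).symm
  have hmem : ∀ x, x ∈ Z ↔ Projectivization.map M.toLinearMap M.injective x ∈ Z' := by
    intro x
    rw [← x.mk_rep, Projectivization.map_mk]
    exact hM _ _
  have hinv : ∀ (M : (Fin n → k) ≃ₗ[k] (Fin n → k)) x, Projectivization.map M.symm.toLinearMap
      M.symm.injective (Projectivization.map M.toLinearMap M.injective x) = x := by
    intro M x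
    rw [← x.mk_rep, Projectivization.map_mk, Projectivization.map_mk]
    simp
  refine ⟨⟨fun x => ⟨_, (hmem x).1 x.2⟩, fun y => ⟨Projectivization.map M.symm.toLinearMap
      M.symm.injective y, (hmem _).2 (by simpa using (hinv M.symm y).symm ▸ y.2)⟩,
    fun x => Subtype.ext (hinv M x), fun y => Subtype.ext (hinv M.symm y)⟩,
    ⟨mor M _ _ _ fun x => rfl, mor M.symm _ _ _ fun x => rfl⟩, fun v hv h => rfl⟩

end FunctionStructure

end Forms

/-! ### Products of projective varieties and bihomogeneous forms. -/

section BiForms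

variable {k : Type*} [Field k] {a b n m n' m' : ℕ} {A B : Type*}

/-- The functions on `kᵃ × kᵇ` given by bihomogeneous polynomials of bidegree `(n, m)`. -/
def biForm (k : Type*) [Field k] (a b n m : ℕ) : Submodule k ((Fin a → k) × (Fin b → k) → k) :=
  Submodule.span k {h | ∃ (α : Fin a → ℕ) (β : Fin b → ℕ), ∑ i, α i = n ∧ ∑ j, β j = m ∧
    h = fun v => (∏ i, v.1 i ^ α i) * ∏ j, v.2 j ^ β j}

theorem biForm_mul {φ ψ : (Fin a → k) × (Fin b → k) → k} (hφ : φ ∈ biForm k a b n m)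
    (hψ : ψ ∈ biForm k a b n' m') : φ * ψ ∈ biForm k a b (n + n') (m + m') := by
  have h := Submodule.mul_mem_mul hφ hψ
  rw [biForm, biForm, Submodule.span_mul_span] at h
  refine Submodule.span_mono ?_ h
  rintro _ ⟨_, ⟨α, β, hα, hβ, rfl⟩, _, ⟨α', β', hα', hβ', rfl⟩, rfl⟩
  refine ⟨α + α', β + β', by simp [Finset.sum_add_distrib, hα, hα'],
    by simp [Finset.sum_add_distrib, hβ, hβ'], ?_⟩
  funext v
  simp only [Pi.mul_apply, Pi.add_apply, pow_add, Finset.prod_mul_distrib]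
  ring

theorem biForm_apply_smul {φ : (Fin a → k) × (Fin b → k) → k} (hφ : φ ∈ biForm k a b n m)
    (c d : k) (v : (Fin a → k) × (Fin b → k)) : φ (c • v.1, d • v.2) = c ^ n * d ^ m * φ v := by
  induction hφ using Submodule.span_induction with
  | mem _ h =>
    obtain ⟨α, β, hα, hβ, rfl⟩ := h
    simp only [Pi.smul_apply, smul_eq_mul, mul_pow, Finset.prod_mul_distrib,
      Finset.prod_pow_eq_pow_sum, hα, hβ]
    ring
  | zero => simp
  | add _ _ _ _ h h' => simp only [Pi.add_apply, h, h', mul_add]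
  | smul r _ _ h => simp only [Pi.smul_apply, smul_eq_mul, h]; ring

theorem eval_fst_mem_biForm (b : ℕ) {P : MvPolynomial (Fin a) k} (hP : P.IsHomogeneous n) :
    (fun v : (Fin a → k) × (Fin b → k) => MvPolynomial.eval v.1 P) ∈ biForm k a b n 0 := by
  have : (fun v : (Fin a → k) × (Fin b → k) => MvPolynomial.eval v.1 P) =
      ∑ s ∈ P.support, P.coeff s • fun v => (∏ i, v.1 i ^ s i) * ∏ j, v.2 j ^ (0 : Fin b → ℕ) j := by
    funext v
    simp [MvPolynomial.eval_eq']
  rw [this]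
  refine sum_mem fun s hs => Submodule.smul_mem _ _ (Submodule.subset_span ⟨s, 0, ?_, by simp, rfl⟩)
  exact (Finset.sum_subset (Finset.subset_univ _) (by simp)).symm.trans
    (hP.degree_eq_sum_deg_support hs).symm

theorem eval_snd_mem_biForm (a : ℕ) {P : MvPolynomial (Fin b) k} (hP : P.IsHomogeneous n) :
    (fun v : (Fin a → k) × (Fin b → k) => MvPolynomial.eval v.2 P) ∈ biForm k a b 0 n := by
  have : (fun v : (Fin a → k) × (Fin b → k) => MvPolynomial.eval v.2 P) =
      ∑ s ∈ P.support, P.coeff s • fun v => (∏ i, v.1 i ^ (0 : Fin a → ℕ) i) * ∏ j, v.2 j ^ s j := by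
    funext v
    simp [MvPolynomial.eval_eq']
  rw [this]
  refine sum_mem fun s hs => Submodule.smul_mem _ _ (Submodule.subset_span ⟨0, s, by simp, ?_, rfl⟩)
  exact (Finset.sum_subset (Finset.subset_univ _) (by simp)).symm.trans
    (hP.degree_eq_sum_deg_support hs).symm

theorem one_mem_biForm : (1 : (Fin a → k) × (Fin b → k) → k) ∈ biForm k a b 0 0 := by
  simpa [Pi.one_def] using eval_fst_mem_biForm (k := k) (a := a) b (P := 1)
    (MvPolynomial.isHomogeneous_one _ _)

/-- The representatives of a pair of points. -/
noncomputable def reps (i : A → ℙ k (Fin a → k)) (j : B → ℙ k (Fin b → k)) (p : A × B) :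
    (Fin a → k) × (Fin b → k) :=
  ((i p.1).rep, (j p.2).rep)

/-- A monomial in one nonzero coordinate of each factor serves to make the two degrees of a form
equal. Bidegree `(n, n)` is what forms of degree `n` in the Weber vector have. -/
theorem exists_biForm_balanced (v : (Fin a → k) × (Fin b → k)) (h₁ : v.1 ≠ 0) (h₂ : v.2 ≠ 0)
    (n m : ℕ) : ∃ (n' m' : ℕ) (R : (Fin a → k) × (Fin b → k) → k), R ∈ biForm k a b n' m' ∧
      R v ≠ 0 ∧ n + n' = m + m' := by
  obtain ⟨s, hs⟩ := Function.ne_iff.1 h₁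
  obtain ⟨t, ht⟩ := Function.ne_iff.1 h₂
  have h := biForm_mul (eval_fst_mem_biForm b (MvPolynomial.isHomogeneous_X_pow (R := k) s m))
    (eval_snd_mem_biForm a (MvPolynomial.isHomogeneous_X_pow (R := k) t n))
  rw [add_zero, zero_add] at h
  refine ⟨m, n, _, h, ?_, add_comm _ _⟩
  simp only [Pi.mul_apply, map_pow, MvPolynomial.eval_X]
  exact mul_ne_zero (pow_ne_zero _ hs) (pow_ne_zero _ ht)

namespace FunctionStructure

variable {i : A → ℙ k (Fin a → k)} {j : B → ℙ k (Fin b → k)}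

/-- The generators of the algebra are fractions of forms near the components of `p`; sums and
products keep numerator and denominator of the same bidegree. Different points `p` may need
different fractions. -/
theorem exists_biForm_of_mem_boxAlgebra {U : Set A} {V : Set B} {p : A × B} (hU : p.1 ∈ U)
    (hV : p.2 ∈ V) {N : A × B → k} (hN : N ∈ boxAlgebra (induced i (projectiveSpace k a))
      (induced j (projectiveSpace k b)) U V) :
    ∃ (n m : ℕ) (P Q : (Fin a → k) × (Fin b → k) → k), P ∈ biForm k a b n m ∧
      Q ∈ biForm k a b n m ∧ Q (reps i j p) ≠ 0 ∧
      ∀ q, Q (reps i j q) ≠ 0 → N q = P (reps i j q) / Q (reps i j q) := by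
  induction hN using Algebra.adjoin_induction with
  | mem _ hx =>
    rcases hx with ⟨f, hf, rfl⟩ | ⟨f, hf, rfl⟩
    · obtain ⟨d, P, Q, hP, hQ, hp, h⟩ := regularAt_induced_iff.1 (hf _ hU)
      exact ⟨d, 0, _, _, eval_fst_mem_biForm b hP, eval_fst_mem_biForm b hQ, hp,
        fun q hq => h _ hq⟩
    · obtain ⟨d, P, Q, hP, hQ, hp, h⟩ := regularAt_induced_iff.1 (hf _ hV)
      exact ⟨0, d, _, _, eval_snd_mem_biForm a hP, eval_snd_mem_biForm a hQ, hp,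
        fun q hq => h _ hq⟩
  | algebraMap r =>
    refine ⟨0, 0, r • 1, 1, Submodule.smul_mem _ _ one_mem_biForm, one_mem_biForm, by simp,
      fun q _ => by simp⟩
  | add _ _ _ _ h h' =>
    obtain ⟨n, m, P, Q, hP, hQ, hp, h⟩ := h
    obtain ⟨n', m', P', Q', hP', hQ', hp', h'⟩ := h'
    refine ⟨n + n', m + m', P * Q' + Q * P', Q * Q', add_mem (biForm_mul hP hQ')
      (biForm_mul hQ hP'), biForm_mul hQ hQ', mul_ne_zero hp hp', fun q hq => ?_⟩
    have hl := left_ne_zero_of_mul (show Q (reps i j q) * Q' (reps i j q) ≠ 0 from hq)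
    have hr := right_ne_zero_of_mul (show Q (reps i j q) * Q' (reps i j q) ≠ 0 from hq)
    rw [Pi.add_apply, h q hl, h' q hr, div_add_div _ _ hl hr]
    rfl
  | mul _ _ _ _ h h' =>
    obtain ⟨n, m, P, Q, hP, hQ, hp, h⟩ := h
    obtain ⟨n', m', P', Q', hP', hQ', hp', h'⟩ := h'
    refine ⟨n + n', m + m', P * P', Q * Q', biForm_mul hP hP', biForm_mul hQ hQ',
      mul_ne_zero hp hp', fun q hq => ?_⟩
    have hl := left_ne_zero_of_mul (show Q (reps i j q) * Q' (reps i j q) ≠ 0 from hq)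
    have hr := right_ne_zero_of_mul (show Q (reps i j q) * Q' (reps i j q) ≠ 0 from hq)
    rw [Pi.mul_apply, h q hl, h' q hr, div_mul_div_comm]
    rfl

theorem exists_biForm_of_isOpen {U : Set A} {V : Set B} {p : A × B} (hU : p.1 ∈ U)
    (hV : p.2 ∈ V) (hU' : IsOpen[(induced i (projectiveSpace k a)).top] U)
    (hV' : IsOpen[(induced j (projectiveSpace k b)).top] V) :
    ∃ (n m : ℕ) (R : (Fin a → k) × (Fin b → k) → k), R ∈ biForm k a b n m ∧
      R (reps i j p) ≠ 0 ∧ ∀ q, R (reps i j q) ≠ 0 → q.1 ∈ U ∧ q.2 ∈ V := by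
  obtain ⟨d, P, hP, hp, h⟩ := isOpen_induced_iff.1 hU' _ hU
  obtain ⟨e, Q, hQ, hp', h'⟩ := isOpen_induced_iff.1 hV' _ hV
  refine ⟨_, _, _, biForm_mul (eval_fst_mem_biForm b hP) (eval_snd_mem_biForm a hQ),
    mul_ne_zero hp hp', fun q hq => ⟨h _ (left_ne_zero_of_mul hq), h' _ (right_ne_zero_of_mul hq)⟩⟩

theorem isOpen_ne_zero_coord (i : A → ℙ k (Fin a → k)) (s : Fin a) :
    IsOpen[(induced i (projectiveSpace k a)).top] {x | (i x).rep s ≠ 0} :=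
  isOpen_induced_iff.2 fun x hx => ⟨1, MvPolynomial.X s, MvPolynomial.isHomogeneous_X _ _,
    by simpa using hx, fun y hy => by simpa using hy⟩

theorem regularAt_coord_div (i : A → ℙ k (Fin a → k)) (s t : Fin a) {x : A}
    (hx : (i x).rep s ≠ 0) : (induced i (projectiveSpace k a)).RegularAt
      (fun y => (i y).rep t / (i y).rep s) x :=
  regularAt_induced_iff.2 ⟨1, MvPolynomial.X t, MvPolynomial.X s, MvPolynomial.isHomogeneous_X _ _,
    MvPolynomial.isHomogeneous_X _ _, by simpa using hx, fun y _ => by simp⟩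

/-- Dehomogenization: a monomial divided by the matching powers of two coordinates is a product of
the affine coordinate functions of the two charts. -/
theorem biForm_div_mem_boxAlgebra {φ : (Fin a → k) × (Fin b → k) → k}
    (hφ : φ ∈ biForm k a b n m) (s : Fin a) (t : Fin b) :
    (fun q => φ (reps i j q) / ((i q.1).rep s ^ n * (j q.2).rep t ^ m)) ∈
      boxAlgebra (induced i (projectiveSpace k a)) (induced j (projectiveSpace k b))
        {x | (i x).rep s ≠ 0} {x | (j x).rep t ≠ 0} := by
  induction hφ using Submodule.span_induction with
  | mem _ h =>
    obtain ⟨α, β, hα, hβ, rfl⟩ := h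
    have : (fun q : A × B => (∏ l, (reps i j q).1 l ^ α l) * (∏ l, (reps i j q).2 l ^ β l) /
        ((i q.1).rep s ^ n * (j q.2).rep t ^ m)) =
        (∏ l, (fun q : A × B => (i q.1).rep l / (i q.1).rep s) ^ α l) *
          ∏ l, (fun q : A × B => (j q.2).rep l / (j q.2).rep t) ^ β l := by
      funext q
      simp only [Pi.mul_apply, Finset.prod_apply, Pi.pow_apply, div_pow, Finset.prod_div_distrib,
        Finset.prod_pow_eq_pow_sum, hα, hβ, reps]
      rw [div_mul_div_comm]
    rw [this]
    refine mul_mem (prod_mem fun l _ => pow_mem (Algebra.subset_adjoin ?_) _)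
      (prod_mem fun l _ => pow_mem (Algebra.subset_adjoin ?_) _)
    · exact Or.inl ⟨fun x => (i x).rep l / (i x).rep s, fun x hx => regularAt_coord_div i s l hx, rfl⟩
    · exact Or.inr ⟨fun x => (j x).rep l / (j x).rep t, fun x hx => regularAt_coord_div j t l hx, rfl⟩
  | zero =>
    simp only [Pi.zero_apply, zero_div]
    exact zero_mem (boxAlgebra _ _ _ _)
  | add _ _ _ _ h h' =>
    convert add_mem h h' using 1
    funext q
    simp [add_div]
  | smul r _ _ h =>
    convert Subalgebra.smul_mem _ h r using 1
    funext q
    simp [mul_div_assoc]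

/-- The Zariski topology of a product of projective varieties in terms of bihomogeneous forms. -/
theorem isOpen_prod_iff {W : Set (A × B)} :
    IsOpen[((induced i (projectiveSpace k a)).prod (induced j (projectiveSpace k b))).top] W ↔
      ∀ p ∈ W, ∃ (n : ℕ) (D : (Fin a → k) × (Fin b → k) → k), D ∈ biForm k a b n n ∧
        D (reps i j p) ≠ 0 ∧ ∀ q, D (reps i j q) ≠ 0 → q ∈ W := by
  constructor
  · intro hW p hp
    obtain ⟨U, V, D, hU, hV, hD, hpB, hB⟩ := hW p hp
    obtain ⟨n, m, P, Q, hP, hQ, hpQ, hPQ⟩ := exists_biForm_of_mem_boxAlgebra hpB.1 hpB.2.1 hD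
    obtain ⟨n', m', R, hR, hpR, hRW⟩ := exists_biForm_of_isOpen hpB.1 hpB.2.1 hU hV
    obtain ⟨n'', m'', S, hS, hpS, e⟩ := exists_biForm_balanced (reps i j p) (i p.1).rep_nonzero
      (j p.2).rep_nonzero (n + n + n') (m + m + m')
    have hpP : P (reps i j p) ≠ 0 := by
      intro h
      exact hpB.2.2 (by rw [hPQ p hpQ, h, zero_div])
    refine ⟨n + n + n' + n'', P * Q * R * S, ?_, by simp [hpP, hpQ, hpR, hpS], fun q hq => ?_⟩
    · have := biForm_mul (biForm_mul (biForm_mul hP hQ) hR) hS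
      rwa [← e] at this
    · simp only [Pi.mul_apply, mul_ne_zero_iff] at hq
      refine hB ⟨(hRW q hq.1.2).1, (hRW q hq.1.2).2, ?_⟩
      rw [hPQ q hq.1.1.2]
      exact div_ne_zero hq.1.1.1 hq.1.1.2
  · intro h p hp
    obtain ⟨n, D, hD, hpD, hDW⟩ := h p hp
    obtain ⟨s, hs⟩ := (i p.1).exists_rep_ne_zero
    obtain ⟨t, ht⟩ := (j p.2).exists_rep_ne_zero
    refine ⟨_, _, _, isOpen_ne_zero_coord i s, isOpen_ne_zero_coord j t,
      biForm_div_mem_boxAlgebra hD s t, ⟨hs, ht, div_ne_zero hpD (by simp [hs, ht])⟩, ?_⟩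
    rintro q ⟨-, -, hq⟩
    exact hDW q fun h => hq (by simp [h])

/-- The regular functions of a product of projective varieties in terms of bihomogeneous forms. -/
theorem regularAt_prod_iff {f : A × B → k} {p : A × B} :
    ((induced i (projectiveSpace k a)).prod (induced j (projectiveSpace k b))).RegularAt f p ↔
      ∃ (n : ℕ) (N D : (Fin a → k) × (Fin b → k) → k), N ∈ biForm k a b n n ∧
        D ∈ biForm k a b n n ∧ D (reps i j p) ≠ 0 ∧
        ∀ q, D (reps i j q) ≠ 0 → f q = N (reps i j q) / D (reps i j q) := by
  constructor
  · rintro ⟨U, V, N, D, hU, hV, hN, hD, hpB, hf⟩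
    obtain ⟨n, m, P, Q, hP, hQ, hpQ, hPQ⟩ := exists_biForm_of_mem_boxAlgebra hpB.1 hpB.2.1 hD
    obtain ⟨n₁, m₁, P₁, Q₁, hP₁, hQ₁, hpQ₁, hPQ₁⟩ :=
      exists_biForm_of_mem_boxAlgebra hpB.1 hpB.2.1 hN
    obtain ⟨n', m', R, hR, hpR, hRW⟩ := exists_biForm_of_isOpen hpB.1 hpB.2.1 hU hV
    obtain ⟨n'', m'', S, hS, hpS, e⟩ := exists_biForm_balanced (reps i j p) (i p.1).rep_nonzero
      (j p.2).rep_nonzero (n₁ + n + (n + n')) (m₁ + m + (m + m'))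
    have hpP : P (reps i j p) ≠ 0 := by
      intro h
      exact hpB.2.2 (by rw [hPQ p hpQ, h, zero_div])
    refine ⟨n₁ + n + (n + n') + n'', P₁ * Q * (Q * R) * S, Q₁ * P * (Q * R) * S, ?_, ?_,
      by simp [hpP, hpQ, hpR, hpS, hpQ₁], fun q hq => ?_⟩
    · have := biForm_mul (biForm_mul (biForm_mul hP₁ hQ) (biForm_mul hQ hR)) hS
      rwa [← e] at this
    · have := biForm_mul (biForm_mul (biForm_mul hQ₁ hP) (biForm_mul hQ hR)) hS
      rwa [← e] at this
    · simp only [Pi.mul_apply, mul_ne_zero_iff] at hq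
      obtain ⟨⟨⟨hQ₁, hP⟩, hQ, hR⟩, hS⟩ := hq
      rw [hf q ⟨(hRW q hR).1, (hRW q hR).2, by rw [hPQ q hQ]; exact div_ne_zero hP hQ⟩, hPQ q hQ,
        hPQ₁ q hQ₁, div_div_div_eq]
      simp only [Pi.mul_apply]
      rw [mul_div_mul_right _ _ hS, mul_div_mul_right _ _ (mul_ne_zero hQ hR)]
  · rintro ⟨n, N, D, hN, hD, hpD, hf⟩
    obtain ⟨s, hs⟩ := (i p.1).exists_rep_ne_zero
    obtain ⟨t, ht⟩ := (j p.2).exists_rep_ne_zero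
    refine ⟨_, _, _, _, isOpen_ne_zero_coord i s, isOpen_ne_zero_coord j t,
      biForm_div_mem_boxAlgebra hN s t, biForm_div_mem_boxAlgebra hD s t,
      ⟨hs, ht, div_ne_zero hpD (by simp [hs, ht])⟩, ?_⟩
    rintro q ⟨hqs, hqt, hq⟩
    rw [hf q fun h => hq (by simp [h]), div_div_div_cancel_right₀]
    exact mul_ne_zero (pow_ne_zero _ hqs) (pow_ne_zero _ hqt)

end FunctionStructure

end BiForms

/-! ### The Weber map and the equation of the tetrahedroid. -/

section Weber

variable {k : Type*} [Field k] {κ κ₁ κ₂ : k}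

/-- The affine cone over `spaceCurve κ`. -/
def OnCone (κ : k) (v : Fin 4 → k) : Prop :=
  v 1 ^ 2 = v 0 ^ 2 - v 2 ^ 2 ∧ v 3 ^ 2 = v 0 ^ 2 - κ * v 2 ^ 2

theorem OnCone.smul {v : Fin 4 → k} (h : OnCone κ v) (c : k) : OnCone κ (c • v) := by
  obtain ⟨h1, h3⟩ := h
  constructor <;> simp only [Pi.smul_apply, smul_eq_mul, mul_pow]
  · rw [h1]; ring
  · rw [h3]; ring

theorem mk_mem_spaceCurve_iff {v : Fin 4 → k} (hv : v ≠ 0) :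
    Projectivization.mk k v hv ∈ spaceCurve κ ↔ OnCone κ v := by
  obtain ⟨c, hc, h⟩ := Projectivization.exists_rep_mk v hv
  change OnCone κ _ ↔ _
  rw [h]
  refine ⟨fun h' => ?_, fun h' => h'.smul c⟩
  simpa [smul_smul, hc] using h'.smul c⁻¹

/-- The point of `spaceCurve κ` with given homogeneous coordinates. -/
def conePoint (v : Fin 4 → k) (h : OnCone κ v) (hv : v ≠ 0) : spaceCurve κ :=
  ⟨Projectivization.mk k v hv, (mk_mem_spaceCurve_iff hv).2 h⟩

theorem OnCone.coord_ne_zero {v : Fin 4 → k} (h : OnCone κ v) (hv : v ≠ 0) :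
    v 0 ^ 2 ≠ 0 ∨ v 2 ^ 2 ≠ 0 := by
  by_contra! h0
  obtain ⟨h1, h3⟩ := h
  rw [h0.1, h0.2] at h1 h3
  refine hv (funext fun i => ?_)
  fin_cases i
  · simpa using h0.1
  · simpa using h1
  · simpa using h0.2
  · simpa using h3

theorem weberVector_smul (c d : k) (x y : Fin 4 → k) :
    weberVector (c • x) (d • y) = (c * d) • weberVector x y := by
  funext i
  fin_cases i <;> simp [weberVector] <;> ring

theorem OnCone.weberVector_ne_zero (h₁ : κ₁ ≠ 0) (h₂ : κ₂ ≠ 0) {x y : Fin 4 → k}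
    (hx : OnCone κ₁ x) (hy : OnCone κ₂ y) (hx0 : x ≠ 0) (hy0 : y ≠ 0) : weberVector x y ≠ 0 := by
  have h := _root_.weberVector_ne_zero h₁ h₂ (conePoint x hx hx0) (conePoint y hy hy0)
  obtain ⟨c, hc, hcx⟩ := Projectivization.exists_rep_mk x hx0
  obtain ⟨d, hd, hdy⟩ := Projectivization.exists_rep_mk y hy0
  rw [conePoint, conePoint, hcx, hdy, weberVector_smul] at h
  exact right_ne_zero_of_smul h

theorem weberMap_conePoint (h₁ : κ₁ ≠ 0) (h₂ : κ₂ ≠ 0) {x y : Fin 4 → k}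
    (hx : OnCone κ₁ x) (hy : OnCone κ₂ y) (hx0 : x ≠ 0) (hy0 : y ≠ 0) :
    weberMap h₁ h₂ (conePoint x hx hx0, conePoint y hy hy0) =
      Projectivization.mk k _ (hx.weberVector_ne_zero h₁ h₂ hy hx0 hy0) := by
  obtain ⟨c, hc, hcx⟩ := Projectivization.exists_rep_mk x hx0
  obtain ⟨d, hd, hdy⟩ := Projectivization.exists_rep_mk y hy0
  refine Projectivization.mk_eq_mk_of_smul _ _ (c * d) ?_
  rw [← weberVector_smul, ← hcx, ← hdy]
  rfl

theorem weberVector_eval_mem_biForm {P : MvPolynomial (Fin 4) k} {d : ℕ} (hP : P.IsHomogeneous d) :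
    (fun v : (Fin 4 → k) × (Fin 4 → k) => MvPolynomial.eval (weberVector v.1 v.2) P) ∈
      biForm k 4 4 d d := by
  -- The exponent vectors record in which Weber coordinate each `x i` and each `y j` occurs.
  have : (fun v : (Fin 4 → k) × (Fin 4 → k) => MvPolynomial.eval (weberVector v.1 v.2) P) =
      ∑ s ∈ P.support, P.coeff s • fun v => (∏ i, v.1 i ^ (![s 3, s 1, s 0, s 2] : Fin 4 → ℕ) i) *
        ∏ j, v.2 j ^ (![s 3, s 1, s 2, s 0] : Fin 4 → ℕ) j := by
    funext v
    simp only [MvPolynomial.eval_eq', Finset.sum_apply, Pi.smul_apply, smul_eq_mul]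
    refine Finset.sum_congr rfl fun s _ => ?_
    congr 1
    simp only [Fin.prod_univ_four, weberVector, Matrix.cons_val]
    ring
  rw [this]
  refine sum_mem fun s hs => Submodule.smul_mem _ _ (Submodule.subset_span ?_)
  have h : d = ∑ i, s i := (hP.degree_eq_sum_deg_support hs).trans
    (Finset.sum_subset (Finset.subset_univ _) (by simp))
  rw [Fin.sum_univ_four] at h
  refine ⟨_, _, ?_, ?_, rfl⟩ <;> simp [Fin.sum_univ_four] <;> omega

theorem isMorphism_weberMap (h₁ : κ₁ ≠ 0) (h₂ : κ₂ ≠ 0) : FunctionStructure.IsMorphism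
    ((projectiveSubvariety (spaceCurve κ₁)).prod (projectiveSubvariety (spaceCurve κ₂)))
    (projectiveSpace k 4) (weberMap h₁ h₂) := by
  constructor
  · intro U hU
    refine FunctionStructure.isOpen_prod_iff.2 fun p hp => ?_
    obtain ⟨d, P, hP, hpP, hPU⟩ := hU _ hp
    exact ⟨d, _, weberVector_eval_mem_biForm hP, (eval_rep_mk_ne_zero_iff hP _ _).1 hpP,
      fun q hq => hPU _ ((eval_rep_mk_ne_zero_iff hP _ _).2 hq)⟩
  · rintro f p ⟨d, P, Q, hP, hQ, hpQ, hf⟩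
    refine FunctionStructure.regularAt_prod_iff.2 ⟨d, _, _, weberVector_eval_mem_biForm hP,
      weberVector_eval_mem_biForm hQ, (eval_rep_mk_ne_zero_iff hQ _ _).1 hpQ, fun q hq => ?_⟩
    refine (hf _ ((eval_rep_mk_ne_zero_iff hQ _ _).2 hq)).trans ?_
    exact eval_rep_mk_div hP hQ _ _

/-- The equation of the tetrahedroid, solved for the product `D = x₂² y₂²`. -/
def WeberEquation (κ₁ κ₂ : k) (w : Fin 4 → k) (D : k) : Prop :=
  (1 - κ₁ - κ₂) * D = w 0 ^ 2 + w 1 ^ 2 + w 2 ^ 2 - w 3 ^ 2 ∧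
    w 3 ^ 2 * D = (w 0 ^ 2 + κ₂ * D) * (w 2 ^ 2 + κ₁ * D)

theorem weberEquation_weberVector {x y : Fin 4 → k} (hx : OnCone κ₁ x) (hy : OnCone κ₂ y) :
    WeberEquation κ₁ κ₂ (weberVector x y) (x 2 ^ 2 * y 2 ^ 2) := by
  obtain ⟨hx1, hx3⟩ := hx
  obtain ⟨hy1, hy3⟩ := hy
  constructor <;> simp [weberVector, mul_pow, hx1, hx3, hy1, hy3] <;> ring

theorem WeberEquation.smul {w : Fin 4 → k} {D : k} (h : WeberEquation κ₁ κ₂ w D) (c : k) :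
    WeberEquation κ₁ κ₂ (c • w) (c ^ 2 * D) := by
  obtain ⟨h1, h2⟩ := h
  constructor <;> simp only [Pi.smul_apply, smul_eq_mul]
  · linear_combination c ^ 2 * h1
  · linear_combination c ^ 4 * h2

/-- Up to the factor `2`, the determinant is the quadratic relation for `D`, multiplied by `s²` and
with `s * D` replaced by `L`. -/
theorem mem_tetrahedroid_iff [IsAlgClosed k] (hk : (2 : k) ≠ 0) (h₁ : κ₁ ≠ 0) (h₂ : κ₂ ≠ 0)
    {a₀₁ a₀₃ a₁₂ i a₂₃ : k} (h₀₁ : a₀₁ ^ 2 = κ₂ - 1) (h₀₃ : a₀₃ ^ 2 = κ₂) (h₁₂ : a₁₂ ^ 2 = κ₁ - 1)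
    (hi : i ^ 2 = -1) (h₂₃ : a₂₃ ^ 2 = κ₁) {z : ℙ k (Fin 4 → k)} :
    z ∈ tetrahedroid a₀₁ 1 a₀₃ a₁₂ i a₂₃ ↔ ∃ D, WeberEquation κ₁ κ₂ z.rep D := by
  set w := z.rep
  set s := 1 - κ₁ - κ₂ with hs
  set L := w 0 ^ 2 + w 1 ^ 2 + w 2 ^ 2 - w 3 ^ 2 with hL
  have key : z ∈ tetrahedroid a₀₁ 1 a₀₃ a₁₂ i a₂₃ ↔
      s * w 3 ^ 2 * L - (s * w 0 ^ 2 + κ₂ * L) * (s * w 2 ^ 2 + κ₁ * L) = 0 := by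
    change Matrix.det _ = 0 ↔ _
    simp [h₀₁, h₀₃, h₁₂, hi, h₂₃, Matrix.det_succ_row_zero, Fin.sum_univ_succ, Fin.succAbove]
    constructor <;> intro h
    · refine (mul_eq_zero.1 (?_ : (2 : k) * _ = 0)).resolve_left hk
      linear_combination h
    · linear_combination 2 * h
  rw [key]
  constructor
  · intro h
    by_cases hs0 : s = 0
    · have hL0 : L = 0 := by
        have : κ₁ * κ₂ * L ^ 2 = 0 := by rw [hs0] at h; linear_combination -h
        simpa [h₁, h₂] using this
      have : NeZero (2 : k) := ⟨hk⟩
      obtain ⟨D, hD⟩ := exists_quadratic_eq_zero (mul_ne_zero h₁ h₂)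
        (IsAlgClosed.exists_eq_mul_self (discrim (κ₁ * κ₂)
          (κ₁ * w 0 ^ 2 + κ₂ * w 2 ^ 2 - w 3 ^ 2) (w 0 ^ 2 * w 2 ^ 2)))
      refine ⟨D, ?_, ?_⟩
      · rw [← hs, ← hL, hs0, hL0, zero_mul]
      · linear_combination -hD
    · refine ⟨L / s, by field_simp; rfl, ?_⟩
      field_simp
      linear_combination h
  · rintro ⟨D, h1, h2⟩
    rw [← hs, ← hL] at h1
    rw [← h1]
    linear_combination s ^ 2 * h2

end Weber

/-! ### Image and fibres of the Weber map. -/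

section WeberFibres

variable {k : Type*} [Field k] {κ κ₁ κ₂ : k}

theorem exists_mul_of_sq_eq_mul [IsAlgClosed k] {X Z w : k} (h : w ^ 2 = X * Z) :
    ∃ x z : k, x ^ 2 = X ∧ z ^ 2 = Z ∧ x * z = w := by
  obtain ⟨x, hx⟩ := IsAlgClosed.exists_pow_nat_eq X (n := 2) (by norm_num)
  by_cases hX : X = 0
  · obtain ⟨z, hz⟩ := IsAlgClosed.exists_pow_nat_eq Z (n := 2) (by norm_num)
    refine ⟨x, z, hx, hz, ?_⟩
    have hx0 : x = 0 := by simpa [hX] using hx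
    have hw0 : w = 0 := by simpa [hX] using h
    rw [hx0, hw0, zero_mul]
  · have hx0 : x ≠ 0 := fun h0 => hX (by rw [← hx, h0]; ring)
    refine ⟨x, w / x, hx, ?_, by field_simp⟩
    rw [div_pow, hx, h]
    field_simp

/-- A singular two by two matrix is a column times a row. -/
theorem exists_factor_of_mul_eq_mul {a b c d : k} (h : a * d = b * c) :
    ∃ x₀ x₁ y₀ y₁ : k, x₀ * y₀ = a ∧ x₁ * y₀ = b ∧ x₀ * y₁ = c ∧ x₁ * y₁ = d := by
  by_cases ha : a = 0
  · by_cases hb : b = 0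
    · exact ⟨c, d, 0, 1, by simp [ha, hb]⟩
    · refine ⟨a, b, 1, d / b, by simp, by simp, ?_, by field_simp⟩
      field_simp
      exact h
  · refine ⟨a, b, 1, c / a, by simp, by simp, by field_simp, ?_⟩
    field_simp
    exact h.symm

theorem WeberEquation.exists_cone [IsAlgClosed k] {w : Fin 4 → k} {D : k}
    (h : WeberEquation κ₁ κ₂ w D) (hw : w ≠ 0) : ∃ x y : Fin 4 → k, OnCone κ₁ x ∧ OnCone κ₂ y ∧
      x ≠ 0 ∧ y ≠ 0 ∧ weberVector x y = w := by
  obtain ⟨h1, h2⟩ := h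
  -- These are the future squares of `x₀, x₂, y₀, y₂`. The cone equations dictate the other squares,
  -- and each `w i ^ 2` becomes a product of one square from either side. The roots are then chosen
  -- so that their product is `w i` itself.
  obtain ⟨X₀, X₂, Y₀, Y₂, e₁, e₂, e₃, e₄⟩ := exists_factor_of_mul_eq_mul h2
  obtain ⟨x₀, y₀, hx₀, hy₀, hw₃⟩ := exists_mul_of_sq_eq_mul e₁.symm
  obtain ⟨x₂, y₃, hx₂, hy₃, hw₀⟩ := exists_mul_of_sq_eq_mul
    (X := X₂) (Z := Y₀ - κ₂ * Y₂) (w := w 0) (by linear_combination κ₂ * e₄ - e₂)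
  obtain ⟨x₃, y₂, hx₃, hy₂, hw₂⟩ := exists_mul_of_sq_eq_mul
    (X := X₀ - κ₁ * X₂) (Z := Y₂) (w := w 2) (by linear_combination κ₁ * e₄ - e₃)
  obtain ⟨x₁, y₁, hx₁, hy₁, hw₁⟩ := exists_mul_of_sq_eq_mul
    (X := X₀ - X₂) (Z := Y₀ - Y₂) (w := w 1) (by linear_combination -h1 - e₁ + e₂ + e₃ - e₄)
  have hww : weberVector ![x₀, x₁, x₂, x₃] ![y₀, y₁, y₂, y₃] = w := by
    funext i
    fin_cases i
    · exact hw₀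
    · exact hw₁
    · exact hw₂
    · exact hw₃
  refine ⟨![x₀, x₁, x₂, x₃], ![y₀, y₁, y₂, y₃], ⟨?_, ?_⟩, ⟨?_, ?_⟩, ?_, ?_, hww⟩
  · simp [hx₁, hx₀, hx₂]
  · simp [hx₃, hx₀, hx₂]
  · simp [hy₁, hy₀, hy₂]
  · simp [hy₃, hy₀, hy₂]
  · rintro h0
    rw [h0] at hww
    exact hw (by rw [← hww]; funext i; fin_cases i <;> simp [weberVector])
  · rintro h0
    rw [h0] at hww
    exact hw (by rw [← hww]; funext i; fin_cases i <;> simp [weberVector])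

theorem range_weberMap [IsAlgClosed k] (hk : (2 : k) ≠ 0) (h₁ : κ₁ ≠ 0) (h₂ : κ₂ ≠ 0)
    {a₀₁ a₀₃ a₁₂ i a₂₃ : k} (h₀₁ : a₀₁ ^ 2 = κ₂ - 1) (h₀₃ : a₀₃ ^ 2 = κ₂) (h₁₂ : a₁₂ ^ 2 = κ₁ - 1)
    (hi : i ^ 2 = -1) (h₂₃ : a₂₃ ^ 2 = κ₁) :
    Set.range (weberMap h₁ h₂) = tetrahedroid a₀₁ 1 a₀₃ a₁₂ i a₂₃ := by
  ext z
  rw [mem_tetrahedroid_iff hk h₁ h₂ h₀₁ h₀₃ h₁₂ hi h₂₃]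
  constructor
  · rintro ⟨⟨p, q⟩, rfl⟩
    obtain ⟨c, hc, h⟩ := Projectivization.exists_rep_mk (weberVector p.1.rep q.1.rep)
      (weberVector_ne_zero h₁ h₂ p q)
    refine ⟨c ^ 2 * (p.1.rep 2 ^ 2 * q.1.rep 2 ^ 2), ?_⟩
    rw [weberMap, h]
    exact (weberEquation_weberVector p.2 q.2).smul c
  · rintro ⟨D, hD⟩
    obtain ⟨x, y, hx, hy, hx0, hy0, h⟩ := hD.exists_cone z.rep_nonzero
    refine ⟨(conePoint x hx hx0, conePoint y hy hy0), ?_⟩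
    rw [weberMap_conePoint]
    conv_rhs => rw [← z.mk_rep]
    congr 1

/-- The change of signs by `ε` on the first factor. -/
def signL (ε : Fin 4 → ℤˣ) (x : Fin 4 → k) : Fin 4 → k := fun i => ((ε i : ℤ) : k) * x i

/-- The involution that exchanges `2` and `3`. -/
def swapIndex : Fin 4 → Fin 4 := ![0, 1, 3, 2]

/-- The change of signs by `ε` on the second factor. -/
def signR (ε : Fin 4 → ℤˣ) (y : Fin 4 → k) : Fin 4 → k := fun i => ((ε (swapIndex i) : ℤ) : k) * y i

theorem unit_cast_sq (e : ℤˣ) : ((e : ℤ) : k) ^ 2 = 1 := by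
  rcases Int.units_eq_one_or e with rfl | rfl <;> simp

theorem OnCone.signL {x : Fin 4 → k} (h : OnCone κ x) (ε : Fin 4 → ℤˣ) :
    OnCone κ (_root_.signL ε x) := by
  simpa [OnCone, _root_.signL, mul_pow, unit_cast_sq] using h

theorem OnCone.signR {x : Fin 4 → k} (h : OnCone κ x) (ε : Fin 4 → ℤˣ) :
    OnCone κ (_root_.signR ε x) :=
  h.signL _

theorem signL_signL (ε : Fin 4 → ℤˣ) (x : Fin 4 → k) : signL ε (signL ε x) = x := by
  funext i
  simp only [signL]
  linear_combination x i * unit_cast_sq (k := k) (ε i)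

theorem signL_ne_zero (ε : Fin 4 → ℤˣ) {x : Fin 4 → k} (hx : x ≠ 0) : signL ε x ≠ 0 := by
  intro h
  refine hx ?_
  rw [← signL_signL ε x, h]
  funext i
  simp [signL]

theorem signR_ne_zero (ε : Fin 4 → ℤˣ) {x : Fin 4 → k} (hx : x ≠ 0) : signR ε x ≠ 0 :=
  signL_ne_zero _ hx

theorem weberVector_sign (ε : Fin 4 → ℤˣ) (x y : Fin 4 → k) :
    weberVector (signL ε x) (signR ε y) = weberVector x y := by
  funext i
  fin_cases i <;> simp [weberVector, signL, signR, swapIndex]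
  · linear_combination x 2 * y 3 * unit_cast_sq (k := k) (ε 2)
  · linear_combination x 1 * y 1 * unit_cast_sq (k := k) (ε 1)
  · linear_combination x 3 * y 2 * unit_cast_sq (k := k) (ε 3)
  · linear_combination x 0 * y 0 * unit_cast_sq (k := k) (ε 0)

/-- Each pair agrees up to its own sign, and the product forces the signs to agree. If `x = 0` only
the sign of the second pair matters. -/
theorem exists_unit_of_sq_eq {u v x z : k} (hu : u ^ 2 = x ^ 2) (hv : v ^ 2 = z ^ 2)
    (h : u * v = x * z) : ∃ e : ℤˣ, u = ((e : ℤ) : k) * x ∧ v = ((e : ℤ) : k) * z := by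
  by_cases hx : x = 0
  · have hu0 : u = 0 := by simpa [hx] using hu
    rcases sq_eq_sq_iff_eq_or_eq_neg.1 hv with rfl | rfl
    · exact ⟨1, by simp [hx, hu0]⟩
    · exact ⟨-1, by simp [hx, hu0]⟩
  · rcases sq_eq_sq_iff_eq_or_eq_neg.1 hu with rfl | rfl
    · exact ⟨1, by simp, by simpa [hx] using h⟩
    · refine ⟨-1, by simp, ?_⟩
      have : x * (v + z) = 0 := by linear_combination -h
      simpa using eq_neg_of_add_eq_zero_left ((mul_eq_zero.1 this).resolve_left hx)

/-- A nonzero tensor of rank one determines its factors up to reciprocal scalars; only the indices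
`0` and `2` are involved. -/
theorem exists_smul_of_tensor_eq {X X' Y Y' : Fin 4 → k} {c : k} (hc : c ≠ 0) {i j : Fin 4}
    (hX : X i ≠ 0) (hY : Y j ≠ 0) (h : ∀ s ∈ ({0, 2} : Set (Fin 4)), ∀ t ∈ ({0, 2} : Set (Fin 4)),
      X' s * Y' t = c * (X s * Y t)) (hi : i ∈ ({0, 2} : Set (Fin 4)))
    (hj : j ∈ ({0, 2} : Set (Fin 4))) : ∃ l m : k, l * m = c ∧
      ∀ s ∈ ({0, 2} : Set (Fin 4)), X' s = l * X s ∧ Y' s = m * Y s := by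
  have hij := h i hi j hj
  have h0 : X' i * Y' j ≠ 0 := by rw [hij]; exact mul_ne_zero hc (mul_ne_zero hX hY)
  have hX' := left_ne_zero_of_mul h0
  have hY' := right_ne_zero_of_mul h0
  refine ⟨X' i / X i, Y' j / Y j, ?_, fun s hs => ⟨?_, ?_⟩⟩
  · rw [div_mul_div_comm, hij, mul_div_assoc, div_self (mul_ne_zero hX hY), mul_one]
  · have := h s hs j hj
    field_simp
    refine mul_right_cancel₀ (mul_ne_zero hY' hY) ?_
    refine mul_left_cancel₀ hc ?_
    linear_combination (c * X i * Y j) * this - c * X s * Y j * hij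
  · have := h i hi s hs
    field_simp
    refine mul_right_cancel₀ (mul_ne_zero hX' hX) ?_
    refine mul_left_cancel₀ hc ?_
    linear_combination (c * X i * Y j) * this - c * X i * Y s * hij

/-- The fibres of the Weber map are the orbits of the group of sign changes. -/
theorem exists_sign_of_weberVector_eq [IsAlgClosed k] (hs : κ₁ + κ₂ ≠ 1) {x y x' y' : Fin 4 → k}
    (hx : OnCone κ₁ x) (hy : OnCone κ₂ y) (hx' : OnCone κ₁ x') (hy' : OnCone κ₂ y') (hx0 : x ≠ 0)
    (hy0 : y ≠ 0) {c : k} (hc : c ≠ 0) (h : weberVector x' y' = c • weberVector x y) :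
    ∃ (ε : Fin 4 → ℤˣ) (a b : k), a ≠ 0 ∧ b ≠ 0 ∧ x' = a • signL ε x ∧ y' = b • signR ε y := by
  have hs' : 1 - κ₁ - κ₂ ≠ 0 := fun h => hs (by linear_combination -h)
  have E := weberEquation_weberVector hx hy
  have E' := weberEquation_weberVector hx' hy'
  rw [h] at E'
  have E₀ := E.smul c
  -- Here `κ₁ + κ₂ ≠ 1` enters: the Weber vector determines `D`, and with it all products of `x₀²,
  -- x₂²` with `y₀², y₂²`.
  have hD : x' 2 ^ 2 * y' 2 ^ 2 = c ^ 2 * (x 2 ^ 2 * y 2 ^ 2) :=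
    mul_left_cancel₀ hs' (E'.1.trans E₀.1.symm)
  have w0 : x' 2 * y' 3 = c * (x 2 * y 3) := congrFun h 0
  have w1 : x' 1 * y' 1 = c * (x 1 * y 1) := congrFun h 1
  have w2 : x' 3 * y' 2 = c * (x 3 * y 2) := congrFun h 2
  have w3 : x' 0 * y' 0 = c * (x 0 * y 0) := congrFun h 3
  have hX : ∃ i ∈ ({0, 2} : Set (Fin 4)), x i ^ 2 ≠ 0 := by
    rcases hx.coord_ne_zero hx0 with h | h
    exacts [⟨0, by simp, h⟩, ⟨2, by simp, h⟩]
  have hY : ∃ i ∈ ({0, 2} : Set (Fin 4)), y i ^ 2 ≠ 0 := by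
    rcases hy.coord_ne_zero hy0 with h | h
    exacts [⟨0, by simp, h⟩, ⟨2, by simp, h⟩]
  obtain ⟨i, hi, hXi⟩ := hX
  obtain ⟨j, hj, hYj⟩ := hY
  obtain ⟨l, m, hlm, H⟩ := exists_smul_of_tensor_eq (X := fun i => x i ^ 2) (X' := fun i => x' i ^ 2)
    (Y := fun i => y i ^ 2) (Y' := fun i => y' i ^ 2) (pow_ne_zero 2 hc) hXi hYj (by
      have s3 : y' 3 ^ 2 = y' 0 ^ 2 - κ₂ * y' 2 ^ 2 := hy'.2
      have t3 : x' 3 ^ 2 = x' 0 ^ 2 - κ₁ * x' 2 ^ 2 := hx'.2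
      have u3 : y 3 ^ 2 = y 0 ^ 2 - κ₂ * y 2 ^ 2 := hy.2
      have v3 : x 3 ^ 2 = x 0 ^ 2 - κ₁ * x 2 ^ 2 := hx.2
      have w0' := congrArg (· ^ 2) w0
      have w2' := congrArg (· ^ 2) w2
      have w3' := congrArg (· ^ 2) w3
      simp only [mul_pow, s3, t3, u3, v3] at w0' w2' w3'
      rintro s (rfl | rfl) t (rfl | rfl)
      · exact w3'
      · linear_combination w2' + κ₁ * hD
      · linear_combination w0' + κ₂ * hD
      · exact hD) hi hj
  -- After division by `a` and `c / a`, corresponding coordinates have equal squares and the four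
  -- paired products agree exactly, so each pair has a common sign.
  obtain ⟨a, ha⟩ := IsAlgClosed.exists_pow_nat_eq l (n := 2) (by norm_num)
  have hl0 : l ≠ 0 := by
    rintro rfl
    exact pow_ne_zero 2 hc (by rw [← hlm, zero_mul])
  have ha0 : a ≠ 0 := by
    rintro rfl
    exact hl0 (by rw [← ha]; ring)
  have hb : (c / a) ^ 2 = m := by
    rw [div_pow, ha, ← hlm]
    field_simp
  have hb0 : c / a ≠ 0 := div_ne_zero hc ha0
  have hxs : ∀ i, (a⁻¹ * x' i) ^ 2 = x i ^ 2 := by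
    have h0 := (H 0 (by simp)).1
    have h2 := (H 2 (by simp)).1
    simp only [← ha] at h0 h2
    intro i
    rw [mul_pow, inv_pow, inv_mul_eq_iff_eq_mul₀ (pow_ne_zero 2 ha0)]
    fin_cases i
    · exact h0
    · simp [hx.1, hx'.1, h0, h2]; ring
    · exact h2
    · simp [hx.2, hx'.2, h0, h2]; ring
  have hys : ∀ i, ((c / a)⁻¹ * y' i) ^ 2 = y i ^ 2 := by
    have h0 := (H 0 (by simp)).2
    have h2 := (H 2 (by simp)).2
    simp only [← hb] at h0 h2
    intro i
    rw [mul_pow, inv_pow, inv_mul_eq_iff_eq_mul₀ (pow_ne_zero 2 hb0)]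
    fin_cases i
    · exact h0
    · simp only [Fin.mk_one, hy.1, hy'.1, h0, h2]; ring
    · exact h2
    · simp only [Fin.reduceFinMk, hy.2, hy'.2, h0, h2]; ring
  have hxy : ∀ i, (a⁻¹ * x' i) * ((c / a)⁻¹ * y' (swapIndex i)) = x i * y (swapIndex i) := by
    intro i
    rw [show a⁻¹ * x' i * ((c / a)⁻¹ * y' (swapIndex i)) = c⁻¹ * (x' i * y' (swapIndex i)) by
      field_simp, inv_mul_eq_iff_eq_mul₀ hc]
    fin_cases i
    · exact w3
    · exact w1
    · exact w0
    · exact w2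
  choose ε hε hε' using fun i => exists_unit_of_sq_eq (hxs i) (hys (swapIndex i)) (hxy i)
  refine ⟨ε, a, c / a, ha0, hb0, funext fun i => ?_, funext fun i => ?_⟩
  · rw [Pi.smul_apply, signL, ← hε, smul_eq_mul, mul_inv_cancel_left₀ ha0]
  · have hsw : swapIndex (swapIndex i) = i := by revert i; decide
    have := hε' (swapIndex i)
    rw [hsw] at this
    rw [Pi.smul_apply, signR, ← this, smul_eq_mul, mul_inv_cancel_left₀ hb0]

end WeberFibres

/-! ### Density of the locus without zero coordinates, and the degree of the Weber map. -/

section WeberGeneric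

variable {k : Type*} [Field k] {κ κ₁ κ₂ : k}

open Polynomial in
-- Modulo `u² = q`, every polynomial in `u` over `k[t]` reduces to one that is linear in `u`.
theorem exists_eval_eq_add_mul (H : MvPolynomial (Fin 4) k) (Y₀ Y₁ Y₂ q : k[X]) :
    ∃ A B : k[X], ∀ t u, u ^ 2 = q.eval t →
      MvPolynomial.eval ![Y₀.eval t, Y₁.eval t, Y₂.eval t, u] H = A.eval t + u * B.eval t := by
  induction H using MvPolynomial.induction_on with
  | C c => exact ⟨C c, 0, fun t u _ => by simp⟩
  | add p p' h h' =>
    obtain ⟨A, B, h⟩ := h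
    obtain ⟨A', B', h'⟩ := h'
    refine ⟨A + A', B + B', fun t u hu => ?_⟩
    rw [map_add, h t u hu, h' t u hu, eval_add, eval_add]
    ring
  | mul_X p l h =>
    obtain ⟨A, B, h⟩ := h
    fin_cases l
    · refine ⟨A * Y₀, B * Y₀, fun t u hu => ?_⟩
      rw [map_mul, h t u hu]
      simp
      ring
    · refine ⟨A * Y₁, B * Y₁, fun t u hu => ?_⟩
      rw [map_mul, h t u hu]
      simp
      ring
    · refine ⟨A * Y₂, B * Y₂, fun t u hu => ?_⟩
      rw [map_mul, h t u hu]
      simp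
      ring
    · refine ⟨B * q, A, fun t u hu => ?_⟩
      rw [map_mul, h t u hu]
      simp [← hu]
      ring

open Polynomial in
-- The conic `v₁² = v₀² - v₂²` is parametrized by `(a² + b² : a² - b² : 2ab)`. Moving one of the
-- parameters linearly, while the other is a nonzero constant, gives a curve through `v`. The last
-- two clauses ensure that no coordinate vanishes identically along it.
theorem exists_parametrization [IsAlgClosed k] (hk : (2 : k) ≠ 0) {v : Fin 4 → k}
    (hv : OnCone κ v) (hv0 : v ≠ 0) : ∃ α β : k[X], v 0 = α.eval 0 ^ 2 + β.eval 0 ^ 2 ∧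
      v 1 = α.eval 0 ^ 2 - β.eval 0 ^ 2 ∧ v 2 = 2 * α.eval 0 * β.eval 0 ∧
      (∃ t, α.eval t ≠ 0 ∧ β.eval t ≠ 0) ∧
      ∃ t, (α.eval t = 0 ∧ β.eval t ≠ 0) ∨ (α.eval t ≠ 0 ∧ β.eval t = 0) := by
  obtain ⟨a, b, ha, hb, hab⟩ := exists_mul_of_sq_eq_mul (X := (v 0 + v 1) / 2)
    (Z := (v 0 - v 1) / 2) (w := v 2 / 2) (by field_simp; linear_combination hv.1)
  have h0 : v 0 = a ^ 2 + b ^ 2 := by rw [ha, hb]; field_simp; ring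
  have h1 : v 1 = a ^ 2 - b ^ 2 := by rw [ha, hb]; field_simp; ring
  have h2 : v 2 = 2 * a * b := by rw [mul_assoc, hab]; field_simp
  by_cases ha0 : a = 0
  · have hb0 : b ≠ 0 := by
      rintro rfl
      rcases hv.coord_ne_zero hv0 with h | h
      · exact h (by rw [h0, ha0]; ring)
      · exact h (by rw [h2]; ring)
    exact ⟨C a + X, C b, by simp [h0], by simp [h1], by simp [h2], ⟨1, by simp [ha0, hb0]⟩,
      ⟨0, Or.inl (by simp [ha0, hb0])⟩⟩
  · exact ⟨C a, C b + X, by simp [h0], by simp [h1], by simp [h2], ⟨1 - b, by simp [ha0]⟩,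
      ⟨-b, Or.inr (by simp [ha0])⟩⟩

open Polynomial in
/-- A polynomial that does not vanish at some point of the cone does not vanish at some point of
the cone without zero coordinates. -/
theorem OnCone.exists_coord_ne_zero [IsAlgClosed k] (hk : (2 : k) ≠ 0) {v : Fin 4 → k}
    (hv : OnCone κ v) (hv0 : v ≠ 0) {H : MvPolynomial (Fin 4) k} (hH : MvPolynomial.eval v H ≠ 0) :
    ∃ v', OnCone κ v' ∧ (∀ i, v' i ≠ 0) ∧ MvPolynomial.eval v' H ≠ 0 := by
  obtain ⟨α, β, h0, h1, h2, ⟨t₁, hα₁, hβ₁⟩, t₂, ht₂⟩ := exists_parametrization hk hv hv0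
  by_contra! hcon
  set Y₀ := α ^ 2 + β ^ 2 with hY₀
  set Y₁ := α ^ 2 - β ^ 2 with hY₁
  set Y₂ := C 2 * α * β with hY₂
  set q := Y₀ ^ 2 - C κ * Y₂ ^ 2 with hq
  obtain ⟨A, B, hAB⟩ := exists_eval_eq_add_mul H Y₀ Y₁ Y₂ q
  have ne : ∀ (P : k[X]) t, P.eval t ≠ 0 → P ≠ 0 := by
    rintro P t h rfl
    simp at h
  have hG : Y₀ * Y₁ * Y₂ * q ≠ 0 := by
    refine mul_ne_zero (mul_ne_zero (mul_ne_zero (ne _ t₂ ?_) (ne _ t₂ ?_)) (ne _ t₁ ?_))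
      (ne _ t₂ ?_)
    · rcases ht₂ with ⟨h, h'⟩ | ⟨h, h'⟩ <;> simp [hY₀, h, h']
    · rcases ht₂ with ⟨h, h'⟩ | ⟨h, h'⟩ <;> simp [hY₁, h, h']
    · simp [hY₂, hα₁, hβ₁, hk]
    · rcases ht₂ with ⟨h, h'⟩ | ⟨h, h'⟩ <;> simp [hq, hY₀, hY₂, h, h']
  -- Over such `t` lie two points of the cone, with last coordinates `u` and `-u`, and neither has a
  -- zero coordinate. The vanishing of `A + u B` and `A - u B` separates `A` from `B` because `2 u ≠
  -- 0`.
  have hzero : ∀ t, (Y₀ * Y₁ * Y₂ * q).eval t ≠ 0 → A.eval t = 0 ∧ B.eval t = 0 := by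
    intro t ht
    simp only [eval_mul, mul_ne_zero_iff] at ht
    obtain ⟨⟨⟨n0, n1⟩, n2⟩, nq⟩ := ht
    obtain ⟨u, hu⟩ := IsAlgClosed.exists_pow_nat_eq (q.eval t) (n := 2) (by norm_num)
    have hu0 : u ≠ 0 := by
      rintro rfl
      exact nq (by rw [← hu]; ring)
    have key : ∀ u, u ^ 2 = q.eval t → u ≠ 0 → A.eval t + u * B.eval t = 0 := by
      intro u hu hu0
      rw [← hAB t u hu]
      refine hcon _ ⟨?_, ?_⟩ ?_
      · simp [hY₀, hY₁, hY₂]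
        ring
      · simp [hu, hq]
      · intro i
        fin_cases i
        exacts [n0, n1, n2, hu0]
    have e₁ := key u hu hu0
    have e₂ := key (-u) (by rw [neg_sq, hu]) (neg_ne_zero.2 hu0)
    have hA : A.eval t = 0 := (mul_eq_zero.1 (by linear_combination e₁ + e₂ :
      (2 : k) * A.eval t = 0)).resolve_left hk
    refine ⟨hA, ?_⟩
    rw [hA, zero_add] at e₁
    exact (mul_eq_zero.1 e₁).resolve_left hu0
  have hA : A = 0 := by
    refine (mul_eq_zero.1 (?_ : A * (Y₀ * Y₁ * Y₂ * q) = 0)).resolve_right hG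
    refine Polynomial.funext fun t => ?_
    by_cases ht : (Y₀ * Y₁ * Y₂ * q).eval t = 0
    · rw [eval_mul, ht]; simp
    · rw [eval_mul, (hzero t ht).1]; simp
  have hB : B = 0 := by
    refine (mul_eq_zero.1 (?_ : B * (Y₀ * Y₁ * Y₂ * q) = 0)).resolve_right hG
    refine Polynomial.funext fun t => ?_
    by_cases ht : (Y₀ * Y₁ * Y₂ * q).eval t = 0
    · rw [eval_mul, ht]; simp
    · rw [eval_mul, (hzero t ht).2]; simp
  apply hH
  have hvv : v = ![Y₀.eval 0, Y₁.eval 0, Y₂.eval 0, v 3] := by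
    funext i
    fin_cases i
    · simp [hY₀, h0]
    · simp [hY₁, h1]
    · simp [hY₂, h2]
    · rfl
  rw [hvv, hAB 0 (v 3), hA, hB]
  · simp
  · rw [hv.2, h0, h2]
    simp [hq, hY₀, hY₂]

/-- With one point fixed, `P` of the Weber vector is a polynomial in the other, so the points can be
moved one after the other. -/
theorem exists_weberVector_coord_ne_zero [IsAlgClosed k] (hk : (2 : k) ≠ 0) {x y : Fin 4 → k}
    (hx : OnCone κ₁ x) (hy : OnCone κ₂ y) (hx0 : x ≠ 0) (hy0 : y ≠ 0)
    {P : MvPolynomial (Fin 4) k} (hP : MvPolynomial.eval (weberVector x y) P ≠ 0) :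
    ∃ x' y', OnCone κ₁ x' ∧ OnCone κ₂ y' ∧ (∀ i, x' i ≠ 0) ∧ (∀ i, y' i ≠ 0) ∧
      MvPolynomial.eval (weberVector x' y') P ≠ 0 := by
  have e₁ : ∀ x y : Fin 4 → k, MvPolynomial.eval x (MvPolynomial.aeval
      ![MvPolynomial.X 2 * MvPolynomial.C (y 3), MvPolynomial.X 1 * MvPolynomial.C (y 1),
        MvPolynomial.X 3 * MvPolynomial.C (y 2), MvPolynomial.X 0 * MvPolynomial.C (y 0)] P) =
      MvPolynomial.eval (weberVector x y) P := by
    intro x y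
    rw [MvPolynomial.eval_aeval_eq]
    congr 2
    funext l
    fin_cases l <;> simp [weberVector]
  have e₂ : ∀ x y : Fin 4 → k, MvPolynomial.eval y (MvPolynomial.aeval
      ![MvPolynomial.C (x 2) * MvPolynomial.X 3, MvPolynomial.C (x 1) * MvPolynomial.X 1,
        MvPolynomial.C (x 3) * MvPolynomial.X 2, MvPolynomial.C (x 0) * MvPolynomial.X 0] P) =
      MvPolynomial.eval (weberVector x y) P := by
    intro x y
    rw [MvPolynomial.eval_aeval_eq]
    congr 2
    funext l
    fin_cases l <;> simp [weberVector]
  rw [← e₁] at hP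
  obtain ⟨x', hx', hx0', hP'⟩ := hx.exists_coord_ne_zero hk hx0 hP
  rw [e₁, ← e₂] at hP'
  obtain ⟨y', hy', hy0', hP''⟩ := hy.exists_coord_ne_zero hk hy0 hP'
  rw [e₂] at hP''
  exact ⟨x', y', hx', hy', hx0', hy0', hP''⟩

/-- The change of signs by `ε` on a pair of points. -/
noncomputable def signPair (ε : Fin 4 → ℤˣ) (p : spaceCurve κ₁ × spaceCurve κ₂) :
    spaceCurve κ₁ × spaceCurve κ₂ :=
  (conePoint (signL ε p.1.1.rep) (OnCone.signL p.1.2 ε) (signL_ne_zero ε p.1.1.rep_nonzero),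
    conePoint (signR ε p.2.1.rep) (OnCone.signR p.2.2 ε) (signR_ne_zero ε p.2.1.rep_nonzero))

theorem weberMap_signPair (h₁ : κ₁ ≠ 0) (h₂ : κ₂ ≠ 0) (ε : Fin 4 → ℤˣ)
    (p : spaceCurve κ₁ × spaceCurve κ₂) :
    weberMap h₁ h₂ (signPair ε p) = weberMap h₁ h₂ p := by
  rw [signPair, weberMap_conePoint, weberMap]
  simp only [weberVector_sign]

theorem weberMap_eq_iff [IsAlgClosed k] (h₁ : κ₁ ≠ 0) (h₂ : κ₂ ≠ 0) (hs : κ₁ + κ₂ ≠ 1)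
    (p q : spaceCurve κ₁ × spaceCurve κ₂) : weberMap h₁ h₂ q = weberMap h₁ h₂ p ↔
      ∃ ε : Fin 4 → ℤˣ, q = signPair ε p := by
  constructor
  · intro h
    obtain ⟨c, hc, h⟩ := Projectivization.exists_smul_of_mk_eq_mk h
    obtain ⟨ε, a, b, ha, hb, h, h'⟩ := exists_sign_of_weberVector_eq hs p.1.2 p.2.2 q.1.2 q.2.2
      p.1.1.rep_nonzero p.2.1.rep_nonzero hc h.symm
    refine ⟨ε, Prod.ext (Subtype.ext ?_) (Subtype.ext ?_)⟩
    · rw [← q.1.1.mk_rep]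
      exact Projectivization.mk_eq_mk_of_smul _ _ a h.symm
    · rw [← q.2.1.mk_rep]
      exact Projectivization.mk_eq_mk_of_smul _ _ b h'.symm
  · rintro ⟨ε, rfl⟩
    exact weberMap_signPair h₁ h₂ ε p

theorem ncard_weberMap_fibre [IsAlgClosed k] (hk : (2 : k) ≠ 0) (h₁ : κ₁ ≠ 0) (h₂ : κ₂ ≠ 0)
    (hs : κ₁ + κ₂ ≠ 1) (p : spaceCurve κ₁ × spaceCurve κ₂)
    (hp : ∀ i, weberVector p.1.1.rep p.2.1.rep i ≠ 0) :
    (weberMap h₁ h₂ ⁻¹' {weberMap h₁ h₂ p}).ncard = 8 := by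
  have hx : ∀ i, p.1.1.rep i ≠ 0 := by
    intro i
    fin_cases i
    exacts [left_ne_zero_of_mul (hp 3), left_ne_zero_of_mul (hp 1), left_ne_zero_of_mul (hp 0),
      left_ne_zero_of_mul (hp 2)]
  have hset : weberMap h₁ h₂ ⁻¹' {weberMap h₁ h₂ p} =
      (fun ε : Fin 3 → ℤˣ => signPair (Fin.cons 1 ε) p) '' Set.univ := by
    ext q
    rw [Set.mem_preimage, Set.mem_singleton_iff, weberMap_eq_iff h₁ h₂ hs]
    constructor
    · rintro ⟨ε, rfl⟩
      -- A common sign acts trivially on both projective points, so the sign at index `0` can be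
      -- normalized to `1`. Three free signs remain.
      have hsign : ∀ i, (((Fin.cons 1 fun j => ε 0 * ε j.succ : Fin 4 → ℤˣ) i : ℤ) : k) =
          ((ε 0 : ℤ) : k) * ((ε i : ℤ) : k) := by
        intro i
        refine Fin.cases ?_ (fun j => ?_) i
        · simpa [sq] using (unit_cast_sq (k := k) (ε 0)).symm
        · simp
      refine ⟨fun j => ε 0 * ε j.succ, trivial, Prod.ext (Subtype.ext ?_) (Subtype.ext ?_)⟩
      · refine Projectivization.mk_eq_mk_of_smul _ _ ((ε 0 : ℤ) : k) (funext fun i => ?_)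
        simp only [Pi.smul_apply, signL, smul_eq_mul, hsign, mul_assoc]
      · refine Projectivization.mk_eq_mk_of_smul _ _ ((ε 0 : ℤ) : k) (funext fun i => ?_)
        simp only [Pi.smul_apply, signR, smul_eq_mul, hsign, mul_assoc]
    · rintro ⟨ε, -, rfl⟩
      exact ⟨_, rfl⟩
  have hinj : Function.Injective fun ε : Fin 3 → ℤˣ => signPair (Fin.cons 1 ε) p := by
    intro ε ε' h
    obtain ⟨c, hc, h⟩ := Projectivization.exists_smul_of_mk_eq_mk
      (congrArg (fun q : spaceCurve κ₁ × spaceCurve κ₂ => q.1.1) h)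
    -- Both sign vectors are `1` at index `0`, and the coordinate there is nonzero.
    have hc1 : c = 1 := by
      have := congrFun h 0
      simpa [signL, hx 0] using this
    funext j
    have := congrFun h j.succ
    simp only [hc1, one_smul, signL, Fin.cons_succ] at this
    have := mul_right_cancel₀ (hx _) this
    have h11 : (1 : k) ≠ -1 := fun h => hk (by linear_combination h)
    rcases Int.units_eq_one_or (ε j) with h | h <;> rcases Int.units_eq_one_or (ε' j) with h' | h' <;>
      simp [h, h', h11, h11.symm] at this ⊢
  rw [hset, Set.ncard_image_of_injective _ hinj, Set.ncard_univ, Nat.card_eq_fintype_card]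
  simp

theorem isGenericallyToOneOnto_weberMap [IsAlgClosed k] (hk : (2 : k) ≠ 0) (h₁ : κ₁ ≠ 0)
    (h₂ : κ₂ ≠ 0) (hs : κ₁ + κ₂ ≠ 1) {Z : Set (ℙ k (Fin 4 → k))}
    (hZ : Set.range (weberMap h₁ h₂) = Z) : IsGenericallyToOneOnto 8 (weberMap h₁ h₂) Z := by
  subst hZ
  have hU : (MvPolynomial.X 0 * MvPolynomial.X 1 * MvPolynomial.X 2 * MvPolynomial.X 3 :
      MvPolynomial (Fin 4) k).IsHomogeneous 4 :=
    (((MvPolynomial.isHomogeneous_X _ _).mul (MvPolynomial.isHomogeneous_X _ _)).mul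
      (MvPolynomial.isHomogeneous_X _ _)).mul (MvPolynomial.isHomogeneous_X _ _)
  refine ⟨rfl, _, isOpen_zariski_of_homogeneous hU, ?_, ?_⟩
  · rintro _ ⟨p, rfl⟩
    refine (@mem_closure_iff _ (projectiveSpace k 4).top _ _).2 fun O hO hpO => ?_
    obtain ⟨d, P, hP, hpP, hPO⟩ := hO _ hpO
    rw [weberMap, eval_rep_mk_ne_zero_iff hP] at hpP
    obtain ⟨x, y, hx, hy, hx0, hy0, hxy⟩ := exists_weberVector_coord_ne_zero hk p.1.2 p.2.2
      p.1.1.rep_nonzero p.2.1.rep_nonzero hpP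
    have hx0' : x ≠ 0 := fun h => hx0 0 (by simp [h])
    have hy0' : y ≠ 0 := fun h => hy0 0 (by simp [h])
    have hw := weberMap_conePoint h₁ h₂ hx hy hx0' hy0'
    refine ⟨weberMap h₁ h₂ (conePoint x hx hx0', conePoint y hy hy0'), hPO _ ?_, ?_, ⟨_, rfl⟩⟩
    · rwa [hw, eval_rep_mk_ne_zero_iff hP]
    · change MvPolynomial.eval (weberMap h₁ h₂ _).rep _ ≠ 0
      rw [hw, eval_rep_mk_ne_zero_iff hU]
      simp [weberVector, hx0, hy0]
  · rintro _ ⟨hz, p, rfl⟩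
    replace hz : MvPolynomial.eval (weberMap h₁ h₂ p).rep _ ≠ 0 := hz
    rw [weberMap, eval_rep_mk_ne_zero_iff hU] at hz
    simp only [map_mul, MvPolynomial.eval_X, mul_ne_zero_iff] at hz
    refine ncard_weberMap_fibre hk h₁ h₂ hs p fun i => ?_
    fin_cases i
    exacts [hz.1.1.1, hz.1.1.2, hz.1.2, hz.2]

end WeberGeneric

/-! ### The Weber map as a quotient by the group of sign changes. -/

section WeberQuotient

variable {k : Type*} [Field k] {κ₁ κ₂ : k}

/-- The characters of the group of sign changes. -/
def signChar (k : Type*) [Field k] (c : Fin 4 → ZMod 2) (ε : Fin 4 → ℤˣ) : k :=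
  ∏ i, ((ε i : ℤ) : k) ^ (c i).val

theorem sum_signChar_mul (c c' : Fin 4 → ZMod 2) :
    ∑ ε, signChar k c ε * signChar k c' ε = if c = c' then 2 ^ 4 else 0 := by
  have h1 : ∀ a b : ZMod 2, ∑ e : ℤˣ, ((e : ℤ) : k) ^ a.val * ((e : ℤ) : k) ^ b.val =
      if a = b then 2 else 0 := by
    intro a b
    rw [UnitsInt.univ, Finset.sum_pair (by decide)]
    have h01 : ∀ a : ZMod 2, a = 0 ∨ a = 1 := by decide
    rcases h01 a with rfl | rfl <;> rcases h01 b with rfl | rfl <;>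
      simp [ZMod.val_one] <;> norm_num
  simp only [signChar, ← Finset.prod_mul_distrib]
  have := Finset.prod_univ_sum (fun _ : Fin 4 => (Finset.univ : Finset ℤˣ))
    fun i e => ((e : ℤ) : k) ^ (c i).val * ((e : ℤ) : k) ^ (c' i).val
  rw [Fintype.piFinset_univ] at this
  rw [← this]
  simp only [h1]
  split_ifs with h
  · simp [h]
  · obtain ⟨i, hi⟩ := Function.ne_iff.1 h
    exact Finset.prod_eq_zero (Finset.mem_univ i) (if_neg hi)

/-- Orthogonality of characters: multiplying by the character `c` and summing over the group
isolates `2⁴ * u c`. -/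
theorem eq_zero_of_sum_signChar_eq_zero (hk : (2 : k) ≠ 0) (u : (Fin 4 → ZMod 2) → k)
    (h : ∀ ε, ∑ c, signChar k c ε * u c = 0) (c : Fin 4 → ZMod 2) : u c = 0 := by
  have h' : ∑ ε, signChar k c ε * ∑ c', signChar k c' ε * u c' = 0 := by simp [h]
  simp only [Finset.mul_sum] at h'
  rw [Finset.sum_comm] at h'
  simp only [← mul_assoc, ← Finset.sum_mul, sum_signChar_mul] at h'
  simpa [hk] using h'

/-- The bihomogeneous forms of bidegree `(n, n)` on which the group of sign changes acts through
the character `c`. -/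
def signForm (k : Type*) [Field k] (n : ℕ) (c : Fin 4 → ZMod 2) :
    Submodule k ((Fin 4 → k) × (Fin 4 → k) → k) :=
  Submodule.span k {h | ∃ α β : Fin 4 → ℕ, ∑ i, α i = n ∧ ∑ j, β j = n ∧
    (∀ i, ((α i + β (swapIndex i) : ℕ) : ZMod 2) = c i) ∧
    h = fun v => (∏ i, v.1 i ^ α i) * ∏ j, v.2 j ^ β j}

theorem signForm_apply_sign {n : ℕ} {c : Fin 4 → ZMod 2} {φ : (Fin 4 → k) × (Fin 4 → k) → k}
    (hφ : φ ∈ signForm k n c) (ε : Fin 4 → ℤˣ) (x y : Fin 4 → k) :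
    φ (signL ε x, signR ε y) = signChar k c ε * φ (x, y) := by
  induction hφ using Submodule.span_induction with
  | mem _ h =>
    obtain ⟨α, β, -, -, hc, rfl⟩ := h
    have key : ∀ i, ((ε i : ℤ) : k) ^ α i * ((ε i : ℤ) : k) ^ β (swapIndex i) =
        ((ε i : ℤ) : k) ^ (c i).val := by
      intro i
      rw [← pow_add, ← hc i, ZMod.val_natCast]
      exact_mod_cast congrArg (fun e : ℤˣ => ((e : ℤ) : k)) (Int.units_pow_eq_pow_mod_two (ε i) _)
    simp only [signChar, ← key, Fin.prod_univ_four, signL, signR, mul_pow, swapIndex,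
      Matrix.cons_val]
    ring
  | zero => simp
  | add _ _ _ _ h h' => simp only [Pi.add_apply, h, h', mul_add]
  | smul r _ _ h => simp only [Pi.smul_apply, smul_eq_mul, h]; ring

/-- Every monomial is an eigenvector; its character is given by the parities of the paired
exponents. -/
theorem exists_signForm_decomposition {n : ℕ} {φ : (Fin 4 → k) × (Fin 4 → k) → k}
    (hφ : φ ∈ biForm k 4 4 n n) : ∃ ψ : (Fin 4 → ZMod 2) → (Fin 4 → k) × (Fin 4 → k) → k,
      (∀ c, ψ c ∈ signForm k n c) ∧ φ = ∑ c, ψ c := by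
  induction hφ using Submodule.span_induction with
  | mem φ h =>
    obtain ⟨α, β, hα, hβ, rfl⟩ := h
    set c : Fin 4 → ZMod 2 := fun i => ((α i + β (swapIndex i) : ℕ) : ZMod 2) with hc
    refine ⟨fun c' => if c' = c then fun v => (∏ i, v.1 i ^ α i) * ∏ j, v.2 j ^ β j else 0,
      fun c' => ?_, by simp⟩
    dsimp only
    split_ifs with h
    · exact Submodule.subset_span ⟨α, β, hα, hβ, fun i => by rw [h], rfl⟩
    · exact zero_mem _
  | zero => exact ⟨0, fun _ => zero_mem _, by simp⟩
  | add _ _ _ _ h h' =>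
    obtain ⟨ψ, hψ, rfl⟩ := h
    obtain ⟨ψ', hψ', rfl⟩ := h'
    exact ⟨ψ + ψ', fun c => add_mem (hψ c) (hψ' c), by simp [Finset.sum_add_distrib]⟩
  | smul r _ _ h =>
    obtain ⟨ψ, hψ, rfl⟩ := h
    exact ⟨r • ψ, fun c => Submodule.smul_mem _ _ (hψ c), by simp [Finset.smul_sum]⟩

/-- `φ` agrees on the product of the cones with a form of degree `n` in the Weber vector. -/
def IsWeberForm (κ₁ κ₂ : k) (n : ℕ) (φ : (Fin 4 → k) × (Fin 4 → k) → k) : Prop :=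
  ∃ P : MvPolynomial (Fin 4) k, P.IsHomogeneous n ∧ ∀ x y, OnCone κ₁ x → OnCone κ₂ y →
    φ (x, y) = MvPolynomial.eval (weberVector x y) P

theorem IsWeberForm.mul {n m : ℕ} {φ ψ : (Fin 4 → k) × (Fin 4 → k) → k}
    (hφ : IsWeberForm κ₁ κ₂ n φ) (hψ : IsWeberForm κ₁ κ₂ m ψ) :
    IsWeberForm κ₁ κ₂ (n + m) (φ * ψ) := by
  obtain ⟨P, hP, h⟩ := hφ
  obtain ⟨Q, hQ, h'⟩ := hψ
  exact ⟨P * Q, hP.mul hQ, fun x y hx hy => by simp [h x y hx hy, h' x y hx hy]⟩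

theorem IsWeberForm.pow {n : ℕ} {φ : (Fin 4 → k) × (Fin 4 → k) → k}
    (hφ : IsWeberForm κ₁ κ₂ n φ) (m : ℕ) : IsWeberForm κ₁ κ₂ (n * m) (φ ^ m) := by
  obtain ⟨P, hP, h⟩ := hφ
  exact ⟨P ^ m, hP.pow m, fun x y hx hy => by simp [h x y hx hy]⟩

theorem isWeberForm_mul_swapIndex (i : Fin 4) :
    IsWeberForm κ₁ κ₂ 1 fun v => v.1 i * v.2 (swapIndex i) := by
  refine ⟨MvPolynomial.X ((![3, 1, 0, 2] : Fin 4 → Fin 4) i), MvPolynomial.isHomogeneous_X _ _,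
    fun x y _ _ => ?_⟩
  rw [MvPolynomial.eval_X]
  fin_cases i <;> rfl

theorem OnCone.exists_sq_eq (κ : k) (i : Fin 4) :
    ∃ a b : k, ∀ v, OnCone κ v → v i ^ 2 = a * v 0 ^ 2 + b * v 2 ^ 2 := by
  fin_cases i
  · exact ⟨1, 0, fun v _ => by simp⟩
  · exact ⟨1, -1, fun v hv => hv.1.trans (by ring)⟩
  · exact ⟨0, 1, fun v _ => by simp⟩
  · exact ⟨1, -κ, fun v hv => hv.2.trans (by ring)⟩

/-- On the cones all squares are combinations of those at indices `0` and `2`. The four products of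
these are `w₃²`, `w₂² + κ₁ D`, `w₀² + κ₂ D` and `D`, where `D` is a quadratic form in `w` because `1
- κ₁ - κ₂` is invertible. -/
theorem isWeberForm_sq_mul_sq (hs : κ₁ + κ₂ ≠ 1) (i j : Fin 4) :
    IsWeberForm κ₁ κ₂ 2 fun v => v.1 i ^ 2 * v.2 j ^ 2 := by
  have hs' : 1 - κ₁ - κ₂ ≠ 0 := fun h => hs (by linear_combination -h)
  obtain ⟨a, b, hab⟩ := OnCone.exists_sq_eq κ₁ i
  obtain ⟨a', b', hab'⟩ := OnCone.exists_sq_eq κ₂ j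
  set S : Fin 4 → MvPolynomial (Fin 4) k := fun i => MvPolynomial.X i ^ 2
  have hS : ∀ i, (S i).IsHomogeneous 2 := fun i => MvPolynomial.isHomogeneous_X_pow _ _
  set D : MvPolynomial (Fin 4) k := MvPolynomial.C (1 - κ₁ - κ₂)⁻¹ * (S 0 + S 1 + S 2 - S 3)
  have hD : D.IsHomogeneous 2 := ((((hS 0).add (hS 1)).add (hS 2)).sub (hS 3)).C_mul _
  refine ⟨MvPolynomial.C (a * a') * S 3 + MvPolynomial.C (a * b') * (S 2 + MvPolynomial.C κ₁ * D) +
    MvPolynomial.C (b * a') * (S 0 + MvPolynomial.C κ₂ * D) + MvPolynomial.C (b * b') * D,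
    ((((hS 3).C_mul _).add (((hS 2).add (hD.C_mul _)).C_mul _)).add
      (((hS 0).add (hD.C_mul _)).C_mul _)).add (hD.C_mul _), fun x y hx hy => ?_⟩
  have hE := (weberEquation_weberVector hx hy).1
  have hDe : MvPolynomial.eval (weberVector x y) D = x 2 ^ 2 * y 2 ^ 2 := by
    simp only [D, S, map_mul, map_add, map_sub, map_pow, MvPolynomial.eval_C, MvPolynomial.eval_X]
    rw [← hE, inv_mul_cancel_left₀ hs']
  simp only [map_mul, map_add, MvPolynomial.eval_C, hDe]
  simp only [S, map_pow, MvPolynomial.eval_X, weberVector, Matrix.cons_val, mul_pow, hx.2, hy.2,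
    hab x hx, hab' y hy]
  ring

theorem isWeberForm_prod_sq (hs : κ₁ + κ₂ ≠ 1) (n : ℕ) : ∀ α β : Fin 4 → ℕ, ∑ i, α i = n →
    ∑ j, β j = n → IsWeberForm κ₁ κ₂ (2 * n)
      fun v => (∏ i, (v.1 i ^ 2) ^ α i) * ∏ j, (v.2 j ^ 2) ^ β j := by
  induction n with
  | zero =>
    intro α β hα hβ
    rw [Finset.sum_eq_zero_iff] at hα hβ
    exact ⟨1, MvPolynomial.isHomogeneous_one _ _, fun x y _ _ => by simp [hα, hβ]⟩
  | succ n ih =>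
    have pred : ∀ α : Fin 4 → ℕ, ∑ i, α i = n + 1 → ∃ (i : Fin 4) (α' : Fin 4 → ℕ), α = α' + Pi.single i 1 ∧
        ∑ i, α' i = n := by
      intro α hα
      obtain ⟨i, hi⟩ : ∃ i, α i ≠ 0 := by
        by_contra! h
        simp [h] at hα
      have h : α = (α - Pi.single i 1) + Pi.single i 1 := by
        funext j
        by_cases hj : j = i
        · subst hj
          simp
          omega
        · simp [hj]
      refine ⟨i, α - Pi.single i 1, h, ?_⟩
      rw [h] at hα
      simpa [Finset.sum_add_distrib] using hα
    intro α β hα hβ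
    obtain ⟨i, α, rfl, hα'⟩ := pred α hα
    obtain ⟨j, β, rfl, hβ'⟩ := pred β hβ
    have hmul : ∀ (i : Fin 4) (α : Fin 4 → ℕ) (x : Fin 4 → k),
        ∏ l, (x l ^ 2) ^ (α + Pi.single i 1 : Fin 4 → ℕ) l = (∏ l, (x l ^ 2) ^ α l) * x i ^ 2 := by
      intro i α x
      simp only [Pi.add_apply, pow_add, Finset.prod_mul_distrib]
      congr 1
      rw [Finset.prod_eq_single i (fun l _ hl => by simp [hl]) (by simp)]
      simp
    convert (ih α β hα' hβ').mul (isWeberForm_sq_mul_sq hs i j) using 1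
    · ring
    · funext v
      simp only [hmul, Pi.mul_apply]
      ring

theorem isWeberForm_monomial (hs : κ₁ + κ₂ ≠ 1) {n : ℕ} {α β : Fin 4 → ℕ} (hα : ∑ i, α i = n)
    (hβ : ∑ j, β j = n) (h : ∀ i, Even (α i + β (swapIndex i))) :
    IsWeberForm κ₁ κ₂ n fun v => (∏ i, v.1 i ^ α i) * ∏ j, v.2 j ^ β j := by
  have hsw : ∀ i, swapIndex (swapIndex i) = i := by decide
  have hβ' : ∀ i, β i % 2 = α (swapIndex i) % 2 := by
    intro i
    have := h (swapIndex i)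
    rw [hsw, Nat.even_iff] at this
    omega
  have h0 := hβ' 0
  have h1 := hβ' 1
  have h2 := hβ' 2
  have h3 := hβ' 3
  simp only [swapIndex, Matrix.cons_val] at h0 h1 h2 h3
  rw [Fin.sum_univ_four] at hα hβ
  -- Paired exponents have the same parity. One Weber coordinate `x i * y (swapIndex i)` is split
  -- off for every odd pair, and what remains is a monomial in squares with equally many from both
  -- sides.
  have hsq := isWeberForm_prod_sq hs (α 0 / 2 + α 1 / 2 + α 2 / 2 + α 3 / 2) (fun i => α i / 2)
    (fun i => β i / 2) (Fin.sum_univ_four _) ((Fin.sum_univ_four _).trans (by omega))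
  have hr := fun i => (isWeberForm_mul_swapIndex (κ₁ := κ₁) (κ₂ := κ₂) i).pow (α i % 2)
  have hall := hsq.mul ((((hr 0).mul (hr 1)).mul (hr 2)).mul (hr 3))
  have pw : ∀ (z : k) (m : ℕ), z ^ m = (z ^ 2) ^ (m / 2) * z ^ (m % 2) := by
    intro z m
    rw [← pow_mul, ← pow_add, Nat.div_add_mod]
  convert hall using 1
  · omega
  · funext v
    simp only [Fin.prod_univ_four, Pi.mul_apply, Pi.pow_apply, swapIndex, Matrix.cons_val]
    rw [pw (v.1 0) (α 0), pw (v.1 1) (α 1), pw (v.1 2) (α 2), pw (v.1 3) (α 3), pw (v.2 0) (β 0),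
      pw (v.2 1) (β 1), pw (v.2 2) (β 2), pw (v.2 3) (β 3), h0, h1, h2, h3]
    ring

/-- The product of two forms with the same character is invariant, hence a form in the Weber
vector. -/
theorem isWeberForm_mul_of_signForm (hs : κ₁ + κ₂ ≠ 1) {n : ℕ} {c : Fin 4 → ZMod 2}
    {φ ψ : (Fin 4 → k) × (Fin 4 → k) → k} (hφ : φ ∈ signForm k n c) (hψ : ψ ∈ signForm k n c) :
    IsWeberForm κ₁ κ₂ (n + n) (φ * ψ) := by
  have h := Submodule.mul_mem_mul hφ hψ
  rw [signForm, Submodule.span_mul_span] at h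
  generalize φ * ψ = χ at h
  induction h using Submodule.span_induction with
  | mem _ h =>
    obtain ⟨_, ⟨α, β, hα, hβ, hc, rfl⟩, _, ⟨α', β', hα', hβ', hc', rfl⟩, rfl⟩ := h
    have := isWeberForm_monomial (κ₁ := κ₁) (κ₂ := κ₂) hs (n := n + n) (α := α + α') (β := β + β')
      (by simp [Finset.sum_add_distrib, hα, hα']) (by simp [Finset.sum_add_distrib, hβ, hβ'])
      (fun i => by
        have e : (((α + α') i + (β + β') (swapIndex i) : ℕ) : ZMod 2) = 0 := by
          have : ∀ z : ZMod 2, z + z = 0 := by decide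
          rw [← this (c i)]
          nth_rewrite 1 [← hc i]
          rw [← hc' i]
          push_cast [Pi.add_apply]
          ring
        exact (ZMod.natCast_eq_zero_iff_even).1 e)
    convert this using 1
    funext v
    simp only [Pi.mul_apply, Pi.add_apply, pow_add, Finset.prod_mul_distrib]
    ring
  | zero => exact ⟨0, MvPolynomial.isHomogeneous_zero _ _ _, fun x y _ _ => by simp⟩
  | add _ _ _ _ h h' =>
    obtain ⟨P, hP, h⟩ := h
    obtain ⟨Q, hQ, h'⟩ := h'
    exact ⟨P + Q, hP.add hQ, fun x y hx hy => by simp [h x y hx hy, h' x y hx hy]⟩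
  | smul r _ _ h =>
    obtain ⟨P, hP, h⟩ := h
    exact ⟨MvPolynomial.C r * P, hP.C_mul r, fun x y hx hy => by simp [h x y hx hy]⟩

/-- The chosen representatives of the sign-changed points differ from the sign-changed
representatives by scalars. The resulting factor `r` is the same for all forms of bidegree `(n, n)`,
so linear relations among their values carry over. -/
theorem exists_eval_reps_signPair (n : ℕ) (ε : Fin 4 → ℤˣ) (p : spaceCurve κ₁ × spaceCurve κ₂) :
    ∃ r : k, r ≠ 0 ∧ ∀ {φ : (Fin 4 → k) × (Fin 4 → k) → k}, φ ∈ biForm k 4 4 n n →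
      φ (reps Subtype.val Subtype.val (signPair ε p)) =
        r * φ (signL ε p.1.1.rep, signR ε p.2.1.rep) := by
  obtain ⟨c, hc, h⟩ := Projectivization.exists_rep_mk (signL ε p.1.1.rep)
    (signL_ne_zero ε p.1.1.rep_nonzero)
  obtain ⟨d, hd, h'⟩ := Projectivization.exists_rep_mk (signR ε p.2.1.rep)
    (signR_ne_zero ε p.2.1.rep_nonzero)
  refine ⟨c ^ n * d ^ n, mul_ne_zero (pow_ne_zero _ hc) (pow_ne_zero _ hd), fun hφ => ?_⟩
  rw [← biForm_apply_smul hφ c d (signL ε p.1.1.rep, signR ε p.2.1.rep), reps, signPair, conePoint,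
    conePoint, h, h']

/-- The Weber map is the quotient map by the group of sign changes. -/
theorem isQuotientMap_weberMap (hk : (2 : k) ≠ 0) (h₁ : κ₁ ≠ 0) (h₂ : κ₂ ≠ 0) (hs : κ₁ + κ₂ ≠ 1)
    {Z : Set (ℙ k (Fin 4 → k))} (hZ : Set.range (weberMap h₁ h₂) = Z)
    (F : spaceCurve κ₁ × spaceCurve κ₂ → Z) (hF : ∀ p, (F p : ℙ k (Fin 4 → k)) = weberMap h₁ h₂ p) :
    FunctionStructure.IsQuotientMap ((projectiveSubvariety (spaceCurve κ₁)).prod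
      (projectiveSubvariety (spaceCurve κ₂))) (projectiveSubvariety Z) F := by
  have hsurj : Function.Surjective F := by
    rintro ⟨z, hz⟩
    rw [← hZ] at hz
    obtain ⟨p, rfl⟩ := hz
    exact ⟨p, Subtype.ext (hF p)⟩
  have hsign : ∀ ε p, F (signPair ε p) = F p := fun ε p =>
    Subtype.ext (by rw [hF, hF, weberMap_signPair])
  refine ⟨hsurj, fun U hU => ?_, fun f p hf => ?_⟩
  · refine FunctionStructure.isOpen_induced_iff.2 fun x hx => ?_
    obtain ⟨p, rfl⟩ := hsurj x
    obtain ⟨n, D, hD, hpD, hDU⟩ := FunctionStructure.isOpen_prod_iff.1 hU p hx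
    obtain ⟨ψ, hψ, rfl⟩ := exists_signForm_decomposition hD
    rw [Finset.sum_apply] at hpD
    obtain ⟨c, -, hc⟩ := Finset.exists_ne_zero_of_sum_ne_zero hpD
    -- The square of an eigenform is invariant, so the locus `ψ c ≠ 0` is the preimage of `P ≠ 0`.
    -- It lies over `U`: outside the saturated set `F ⁻¹' U` the form `D` vanishes on whole orbits,
    -- which makes all its components vanish.
    obtain ⟨P, hP, hPψ⟩ := isWeberForm_mul_of_signForm (κ₁ := κ₁) (κ₂ := κ₂) hs (hψ c) (hψ c)
    have hPF : ∀ q, MvPolynomial.eval (F q).1.rep P ≠ 0 ↔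
        ψ c (reps Subtype.val Subtype.val q) ≠ 0 := by
      intro q
      rw [hF, weberMap, eval_rep_mk_ne_zero_iff hP, ← hPψ _ _ q.1.2 q.2.2]
      exact mul_self_ne_zero
    refine ⟨_, P, hP, (hPF p).2 hc, fun y hy => ?_⟩
    obtain ⟨q, rfl⟩ := hsurj y
    have hq := (hPF q).1 hy
    by_contra hqU
    refine hq (eq_zero_of_sum_signChar_eq_zero hk
      (fun c => ψ c (reps Subtype.val Subtype.val q)) (fun ε => ?_) c)
    obtain ⟨r, hr, hrφ⟩ := exists_eval_reps_signPair n ε q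
    have h0 : (∑ c, ψ c) (reps Subtype.val Subtype.val (signPair ε q)) = 0 := by
      by_contra h
      have := hDU _ h
      rw [Set.mem_preimage, hsign] at this
      exact hqU this
    rw [hrφ hD] at h0
    have h0' := (mul_eq_zero.1 h0).resolve_left hr
    rw [Finset.sum_apply] at h0'
    rw [← h0']
    exact Finset.sum_congr rfl fun c _ => (signForm_apply_sign (hψ c) ε _ _).symm
  · obtain ⟨n, N, D, hN, hD, hpD, hND⟩ := FunctionStructure.regularAt_prod_iff.1 hf
    have hD₂ := biForm_mul hD hD
    have hN₂ := biForm_mul hN hD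
    -- The additional factor `D` makes the identity true where `D` vanishes as well, so it may be
    -- applied to all points of an orbit and compared character by character.
    have hall : ∀ q, f (F q) * (D * D) (reps Subtype.val Subtype.val q) =
        (N * D) (reps Subtype.val Subtype.val q) := by
      intro q
      by_cases hq : D (reps Subtype.val Subtype.val q) = 0
      · simp [hq]
      · simp only [Pi.mul_apply, hND q hq]
        field_simp
    have hpD₂ : (D * D) (reps Subtype.val Subtype.val p) ≠ 0 := mul_ne_zero hpD hpD
    obtain ⟨ψ, hψ, eψ⟩ := exists_signForm_decomposition hD₂
    obtain ⟨η, hη, eη⟩ := exists_signForm_decomposition hN₂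
    have hc : ∀ q c, f (F q) * ψ c (reps Subtype.val Subtype.val q) =
        η c (reps Subtype.val Subtype.val q) := by
      intro q c
      refine sub_eq_zero.1 (eq_zero_of_sum_signChar_eq_zero hk (fun c =>
        f (F q) * ψ c (reps Subtype.val Subtype.val q) - η c (reps Subtype.val Subtype.val q))
        (fun ε => ?_) c)
      obtain ⟨r, hr, hrφ⟩ := exists_eval_reps_signPair (n + n) ε q
      have h := hall (signPair ε q)
      rw [hsign, hrφ hD₂, hrφ hN₂, eψ, eη, Finset.sum_apply, Finset.sum_apply] at h
      refine mul_left_cancel₀ hr ?_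
      have e : ∀ c, signChar k c ε * (f (F q) * ψ c (reps Subtype.val Subtype.val q) -
          η c (reps Subtype.val Subtype.val q)) =
          f (F q) * ψ c (signL ε q.1.1.rep, signR ε q.2.1.rep) -
            η c (signL ε q.1.1.rep, signR ε q.2.1.rep) := by
        intro c
        rw [signForm_apply_sign (hψ c), signForm_apply_sign (hη c)]
        simp only [reps]
        ring
      simp only [e, Finset.sum_sub_distrib, ← Finset.mul_sum]
      linear_combination h
    rw [eψ, Finset.sum_apply] at hpD₂
    obtain ⟨c, -, hpc⟩ := Finset.exists_ne_zero_of_sum_ne_zero hpD₂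
    obtain ⟨P, hP, hPψ⟩ := isWeberForm_mul_of_signForm (κ₁ := κ₁) (κ₂ := κ₂) hs (hψ c) (hψ c)
    -- From `f * ψ c = η c` follows `f = (ψ c * η c) / (ψ c)²`, a quotient of two invariant forms of
    -- the same degree.
    obtain ⟨Q, hQ, hQη⟩ := isWeberForm_mul_of_signForm (κ₁ := κ₁) (κ₂ := κ₂) hs (hψ c) (hη c)
    have hPF : ∀ q, MvPolynomial.eval (F q).1.rep P ≠ 0 ↔
        ψ c (reps Subtype.val Subtype.val q) ≠ 0 := by
      intro q
      rw [hF, weberMap, eval_rep_mk_ne_zero_iff hP, ← hPψ _ _ q.1.2 q.2.2]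
      exact mul_self_ne_zero
    refine FunctionStructure.regularAt_induced_iff.2 ⟨_, Q, P, hQ, hP, (hPF p).2 hpc,
      fun y hy => ?_⟩
    obtain ⟨q, rfl⟩ := hsurj y
    have hq : ψ c (q.1.1.rep, q.2.1.rep) ≠ 0 := (hPF q).1 hy
    have hcq : f (F q) * ψ c (q.1.1.rep, q.2.1.rep) = η c (q.1.1.rep, q.2.1.rep) := hc q c
    rw [hF, weberMap, eval_rep_mk_div hQ hP, ← hPψ _ _ q.1.2 q.2.2, ← hQη _ _ q.1.2 q.2.2]
    simp only [Pi.mul_apply, ← hcq]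
    field_simp

end WeberQuotient

/-! ### The quartic model of a Weierstrass curve. -/

namespace WeierstrassCurve

variable {k : Type*} [Field k] {W : WeierstrassCurve k} {e : Fin 3 → k}

/-- The abscissas `e i` of the three points of order two. -/
structure HasTwoTorsion (W : WeierstrassCurve k) (e : Fin 3 → k) : Prop where
  injective : Function.Injective e
  b₂ : W.b₂ = -4 * (e 0 + e 1 + e 2)
  b₄ : W.b₄ = 2 * (e 0 * e 1 + e 0 * e 2 + e 1 * e 2)
  b₆ : W.b₆ = -4 * (e 0 * e 1 * e 2)

/-- The odd function `2y + a₁x + a₃`. -/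
def eta (W : WeierstrassCurve k) (x y : k) : k := 2 * y + W.a₁ * x + W.a₃

theorem HasTwoTorsion.eta_sq (h : W.HasTwoTorsion e) {x y : k} (hxy : W.toAffine.Equation x y) :
    W.eta x y ^ 2 = 4 * ((x - e 0) * (x - e 1) * (x - e 2)) := by
  have h₂ := h.b₂
  have h₄ := h.b₄
  have h₆ := h.b₆
  rw [Affine.equation_iff] at hxy
  rw [WeierstrassCurve.b₂] at h₂
  rw [WeierstrassCurve.b₄] at h₄
  rw [WeierstrassCurve.b₆] at h₆
  rw [eta]
  linear_combination 4 * hxy + x ^ 2 * h₂ + 2 * x * h₄ + h₆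

theorem HasTwoTorsion.equation (hk : (2 : k) ≠ 0) (h : W.HasTwoTorsion e) {x η : k}
    (hη : η ^ 2 = 4 * ((x - e 0) * (x - e 1) * (x - e 2))) :
    ∃ y, W.toAffine.Equation x y ∧ W.eta x y = η := by
  have h₂ := h.b₂
  have h₄ := h.b₄
  have h₆ := h.b₆
  rw [WeierstrassCurve.b₂] at h₂
  rw [WeierstrassCurve.b₄] at h₄
  rw [WeierstrassCurve.b₆] at h₆
  refine ⟨(η - W.a₁ * x - W.a₃) / 2, ?_, by rw [eta]; field_simp; ring⟩
  rw [Affine.equation_iff]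
  have h4 : (4 : k) ≠ 0 := by
    rw [show (4 : k) = 2 * 2 by norm_num]
    exact mul_ne_zero hk hk
  refine mul_left_cancel₀ h4 ?_
  have : (4 : k) * (((η - W.a₁ * x - W.a₃) / 2) ^ 2 + W.a₁ * x * ((η - W.a₁ * x - W.a₃) / 2) +
      W.a₃ * ((η - W.a₁ * x - W.a₃) / 2)) = η ^ 2 - (W.a₁ * x + W.a₃) ^ 2 := by
    field_simp
    ring
  rw [this]
  linear_combination hη - x ^ 2 * h₂ - 2 * x * h₄ - h₆

theorem HasTwoTorsion.sub_ne_zero (h : W.HasTwoTorsion e) :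
    e 0 - e 1 ≠ 0 ∧ e 1 - e 2 ≠ 0 ∧ e 2 - e 0 ≠ 0 := by
  refine ⟨?_, ?_, ?_⟩ <;> rw [_root_.sub_ne_zero] <;> exact h.injective.ne (by decide)

/-- The quadratic polynomials `(x - e i)² - ∏ (e i - e j)`. -/
def quad (e : Fin 3 → k) (i : Fin 3) (x : k) : k :=
  x ^ 2 - 2 * e i * x +
    (2 * e i * (e 0 + e 1 + e 2 - e i) - (e 0 * e 1 + e 0 * e 2 + e 1 * e 2))

/-- The affine cone over the quartic curve `zᵢ² - zⱼ² = (eⱼ - eᵢ) z₀²`. -/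
def OnQuartic (e : Fin 3 → k) (z : Fin 4 → k) : Prop :=
  z 1 ^ 2 - z 2 ^ 2 = (e 1 - e 0) * z 0 ^ 2 ∧ z 1 ^ 2 - z 3 ^ 2 = (e 2 - e 0) * z 0 ^ 2

/-- The quartic curve `zᵢ² - zⱼ² = (eⱼ - eᵢ) z₀²`. -/
def quartic (e : Fin 3 → k) : Set (ℙ k (Fin 4 → k)) := {p | OnQuartic e p.rep}

theorem OnQuartic.smul {z : Fin 4 → k} (h : OnQuartic e z) (c : k) : OnQuartic e (c • z) := by
  obtain ⟨h1, h2⟩ := h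
  constructor <;> simp only [Pi.smul_apply, smul_eq_mul]
  · linear_combination c ^ 2 * h1
  · linear_combination c ^ 2 * h2

theorem mk_mem_quartic_iff {z : Fin 4 → k} (hz : z ≠ 0) :
    Projectivization.mk k z hz ∈ quartic e ↔ OnQuartic e z := by
  obtain ⟨c, hc, h⟩ := Projectivization.exists_rep_mk z hz
  change OnQuartic e _ ↔ _
  rw [h]
  refine ⟨fun h' => ?_, fun h' => h'.smul c⟩
  simpa [smul_smul, hc] using h'.smul c⁻¹

/-- The linear form on the quartic curve that is proportional to `1`. -/
def lin₀ (e : Fin 3 → k) (z : Fin 4 → k) : k :=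
  (e 1 - e 2) * z 1 + (e 2 - e 0) * z 2 + (e 0 - e 1) * z 3

/-- The linear form on the quartic curve that is proportional to the abscissa. -/
def lin₁ (e : Fin 3 → k) (z : Fin 4 → k) : k :=
  (e 1 - e 2) * e 0 * z 1 + (e 2 - e 0) * e 1 * z 2 + (e 0 - e 1) * e 2 * z 3

/-- The linear form on the quartic curve that is proportional to the square of the abscissa. -/
def lin₂ (e : Fin 3 → k) (z : Fin 4 → k) : k :=
  (e 1 - e 2) * (e 0 * e 1 + e 0 * e 2 - e 1 * e 2) * z 1 +
    (e 2 - e 0) * (e 0 * e 1 + e 1 * e 2 - e 0 * e 2) * z 2 +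
    (e 0 - e 1) * (e 0 * e 2 + e 1 * e 2 - e 0 * e 1) * z 3

/-- Twice the Vandermonde determinant of `e`. -/
def vand (e : Fin 3 → k) : k := 2 * ((e 0 - e 1) * (e 1 - e 2) * (e 2 - e 0))

theorem HasTwoTorsion.vand_ne_zero (hk : (2 : k) ≠ 0) (h : W.HasTwoTorsion e) : vand e ≠ 0 := by
  obtain ⟨h1, h2, h3⟩ := h.sub_ne_zero
  exact mul_ne_zero hk (mul_ne_zero (mul_ne_zero h1 h2) h3)

/-- The homogeneous coordinates of the image of a point in the quartic curve. -/
def quarticVec (W : WeierstrassCurve k) (e : Fin 3 → k) : W.toAffine.Point → Fin 4 → k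
  | .zero => ![0, 1, 1, 1]
  | .some x y _ => ![W.eta x y, quad e 0 x, quad e 1 x, quad e 2 x]

section Identities

variable (e) (η x : k)

theorem lin₀_quad : lin₀ e ![η, quad e 0 x, quad e 1 x, quad e 2 x] = vand e := by
  simp only [lin₀, quad, vand, Matrix.cons_val]
  ring

theorem lin₁_quad : lin₁ e ![η, quad e 0 x, quad e 1 x, quad e 2 x] = vand e * x := by
  simp only [lin₁, quad, vand, Matrix.cons_val]
  ring

theorem lin₂_quad : lin₂ e ![η, quad e 0 x, quad e 1 x, quad e 2 x] = vand e * x ^ 2 := by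
  simp only [lin₂, quad, vand, Matrix.cons_val]
  ring

theorem lin₀_one : lin₀ e ![0, 1, 1, 1] = 0 := by
  simp only [lin₀, Matrix.cons_val]
  ring

theorem lin₁_one : lin₁ e ![0, 1, 1, 1] = 0 := by
  simp only [lin₁, Matrix.cons_val]
  ring

theorem lin₂_one : lin₂ e ![0, 1, 1, 1] = vand e := by
  simp only [lin₂, vand, Matrix.cons_val]
  ring

/-- The three polynomials `quad e i` form a basis of the polynomials of degree at most two in `x`.
The forms `lin₀, lin₁, lin₂` invert this change of basis up to the factor `vand e`. -/
theorem vand_mul (z : Fin 4 → k) (i : Fin 3) : vand e * z i.succ = lin₂ e z - 2 * e i * lin₁ e z +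
    (2 * e i * (e 0 + e 1 + e 2 - e i) - (e 0 * e 1 + e 0 * e 2 + e 1 * e 2)) * lin₀ e z := by
  fin_cases i <;> simp [vand, lin₀, lin₁, lin₂] <;> ring

end Identities

theorem lin_smul (z : Fin 4 → k) (c : k) : lin₀ e (c • z) = c * lin₀ e z ∧
    lin₁ e (c • z) = c * lin₁ e z ∧ lin₂ e (c • z) = c * lin₂ e z := by
  refine ⟨?_, ?_, ?_⟩ <;> simp only [lin₀, lin₁, lin₂, Pi.smul_apply, smul_eq_mul] <;> ring

theorem OnQuartic.lin_mul {z : Fin 4 → k} (h : OnQuartic e z) :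
    lin₁ e z ^ 2 = lin₀ e z * lin₂ e z := by
  obtain ⟨h1, h2⟩ := h
  simp only [lin₀, lin₁, lin₂]
  linear_combination (e 0 - e 1) * (e 1 - e 2) * (e 2 - e 0) *
    ((e 2 - e 0) * h1 - (e 1 - e 0) * h2)

/-- The homogenized cubic equation. -/
def cubicForm (e : Fin 3 → k) (z : Fin 4 → k) : k :=
  lin₁ e z * lin₂ e z - (e 0 + e 1 + e 2) * lin₁ e z ^ 2 +
    (e 0 * e 1 + e 0 * e 2 + e 1 * e 2) * (lin₁ e z * lin₀ e z) - e 0 * e 1 * e 2 * lin₀ e z ^ 2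

/-- With `x³` read as `lin₁ * lin₂` and `x²` as `lin₁²`, the mixed terms in `z 1, z 2, z 3` cancel.
The multipliers are the coefficients of `z 2 ^ 2` and `z 3 ^ 2` in four times the cubic form. -/
theorem OnQuartic.cubicForm_eq {z : Fin 4 → k} (h : OnQuartic e z) :
    (vand e * z 0) ^ 2 = 4 * cubicForm e z := by
  obtain ⟨h1, h2⟩ := h
  simp only [cubicForm, lin₀, lin₁, lin₂, vand]
  linear_combination (4 * (e 2 - e 0) ^ 2 * (e 1 * (e 0 * e 1 + e 1 * e 2 - e 0 * e 2) -
      (e 0 + e 1 + e 2) * e 1 ^ 2 + (e 0 * e 1 + e 0 * e 2 + e 1 * e 2) * e 1 - e 0 * e 1 * e 2)) * h1 +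
    (4 * (e 0 - e 1) ^ 2 * (e 2 * (e 0 * e 2 + e 1 * e 2 - e 0 * e 1) -
      (e 0 + e 1 + e 2) * e 2 ^ 2 + (e 0 * e 1 + e 0 * e 2 + e 1 * e 2) * e 2 - e 0 * e 1 * e 2)) * h2

theorem HasTwoTorsion.quarticVec_ne_zero (hk : (2 : k) ≠ 0) (h : W.HasTwoTorsion e)
    (P : W.toAffine.Point) : quarticVec W e P ≠ 0 := by
  rcases P with _ | ⟨x, y, hxy⟩
  · intro h0
    simpa [quarticVec] using congrFun h0 1
  · intro h0
    refine h.vand_ne_zero hk ?_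
    rw [← lin₀_quad e (W.eta x y) x]
    change lin₀ e (quarticVec W e (.some x y hxy)) = 0
    simp [h0, lin₀]

/-- By the duplication formula `(quad e i x / η)²` is `x(2P) - e i`, so differences of these squares
are constants. -/
theorem HasTwoTorsion.onQuartic (h : W.HasTwoTorsion e)
    (P : W.toAffine.Point) : OnQuartic e (quarticVec W e P) := by
  rcases P with _ | ⟨x, y, hxy⟩
  · simp [OnQuartic, quarticVec]
  · have hη := h.eta_sq hxy.1
    constructor <;> simp only [quarticVec, quad, Matrix.cons_val, hη] <;> ring

/-- The embedding of a Weierstrass curve as a quartic curve. -/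
def toQuartic (hk : (2 : k) ≠ 0) (h : W.HasTwoTorsion e) (P : W.toAffine.Point) : quartic e :=
  ⟨Projectivization.mk k (quarticVec W e P) (h.quarticVec_ne_zero hk P),
    (mk_mem_quartic_iff _).2 (h.onQuartic P)⟩

theorem toQuartic_injective (hk : (2 : k) ≠ 0) (h : W.HasTwoTorsion e) :
    Function.Injective (toQuartic hk h) := by
  intro P Q hPQ
  obtain ⟨c, hc, hPQ⟩ := Projectivization.exists_smul_of_mk_eq_mk (congrArg Subtype.val hPQ)
  have hV := h.vand_ne_zero hk
  have e₀ : lin₀ e (quarticVec W e P) = c * lin₀ e (quarticVec W e Q) := by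
    rw [← (lin_smul _ _).1, hPQ]
  have e₁ : lin₁ e (quarticVec W e P) = c * lin₁ e (quarticVec W e Q) := by
    rw [← (lin_smul _ _).2.1, hPQ]
  rcases P with _ | ⟨x, y, hxy⟩ <;> rcases Q with _ | ⟨x', y', hxy'⟩
  · rfl
  · simp only [quarticVec, lin₀_quad, lin₀_one] at e₀
    exact absurd e₀.symm (mul_ne_zero hc hV)
  · simp only [quarticVec, lin₀_quad, lin₀_one, mul_zero] at e₀
    exact absurd e₀ hV
  · simp only [quarticVec, lin₀_quad, lin₁_quad] at e₀ e₁
    have hc1 : c = 1 := by simpa [hV] using e₀.symm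
    subst hc1
    have hx : x = x' := by simpa [hV] using e₁
    subst hx
    have hη : W.eta x y' = W.eta x y := by simpa [quarticVec] using congrFun hPQ 0
    have : y = y' := by
      simp only [eta] at hη
      exact mul_left_cancel₀ hk (by linear_combination -hη)
    subst this
    rfl

theorem toQuartic_surjective [W.IsElliptic] (hk : (2 : k) ≠ 0) (h : W.HasTwoTorsion e) :
    Function.Surjective (toQuartic hk h) := by
  rintro ⟨p, hp⟩
  have hV := h.vand_ne_zero hk
  have hz : OnQuartic e p.rep := hp
  have hz0 := p.rep_nonzero
  set z := p.rep with hzp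
  have h1 := hz.lin_mul
  have h2 := hz.cubicForm_eq
  suffices ∃ P c, c • quarticVec W e P = z by
    obtain ⟨P, c, hc⟩ := this
    refine ⟨P, Subtype.ext ?_⟩
    rw [toQuartic]
    simp only
    rw [← p.mk_rep]
    exact (Projectivization.mk_eq_mk_of_smul _ _ c hc).symm
  -- The ratio `lin₁ / lin₀` is the abscissa. Where `lin₀` vanishes, the relations force `lin₁ = 0`
  -- and `z 0 = 0`, which leaves only the image of the point at infinity.
  by_cases h0 : lin₀ e z = 0
  · have hl1 : lin₁ e z = 0 := by simpa [h0] using h1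
    have hz0 : z 0 = 0 := by simpa [cubicForm, h0, hl1, hV] using h2
    have hi : ∀ i : Fin 3, z i.succ = lin₂ e z / vand e := by
      intro i
      rw [eq_div_iff hV, mul_comm, vand_mul, h0, hl1]
      ring
    refine ⟨.zero, lin₂ e z / vand e, funext fun i => ?_⟩
    fin_cases i
    · simp [quarticVec, hz0]
    · simpa [quarticVec] using (hi 0).symm
    · simpa [quarticVec] using (hi 1).symm
    · simpa [quarticVec] using (hi 2).symm
  · set x := lin₁ e z / lin₀ e z with hx
    have hx1 : lin₁ e z = lin₀ e z * x := by rw [hx]; field_simp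
    have hx2 : lin₂ e z = lin₀ e z * x ^ 2 := by
      refine mul_left_cancel₀ h0 ?_
      rw [← h1, hx1]
      ring
    obtain ⟨y, hxy, hη⟩ := h.equation hk (x := x) (η := vand e * z 0 / lin₀ e z) (by
      rw [div_pow, h2, cubicForm, hx1, hx2]
      field_simp
      ring)
    refine ⟨.some x y (Affine.equation_iff_nonsingular.1 hxy), lin₀ e z / vand e,
      funext fun i => ?_⟩
    refine Fin.cases ?_ (fun i => ?_) i
    · simp only [quarticVec, hη, Pi.smul_apply, smul_eq_mul, Matrix.cons_val]
      field_simp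
    · refine mul_left_cancel₀ hV ?_
      rw [vand_mul e z, hx1, hx2]
      have : quarticVec W e (.some x y (Affine.equation_iff_nonsingular.1 hxy)) i.succ =
          quad e i x := by
        fin_cases i <;> rfl
      rw [Pi.smul_apply, this, quad, smul_eq_mul]
      field_simp

end WeierstrassCurve

/-! ### The quartic model is an isomorphism of varieties. -/

namespace WeierstrassCurve

variable {k : Type*} [Field k] {W : WeierstrassCurve k} {e : Fin 3 → k}

open MvPolynomial in
theorem isMorphism_toQuartic (hk : (2 : k) ≠ 0) (h : W.HasTwoTorsion e) :
    FunctionStructure.IsMorphism W.variety (projectiveSubvariety (quartic e)) (toQuartic hk h) := by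
  have h4 : (4 : k) ≠ 0 := by
    rw [show (4 : k) = 2 * 2 by norm_num]
    exact mul_ne_zero hk hk
  set H : MvPolynomial (Fin 3) k := C 2 * X 1 + C W.a₁ * X 0 + C W.a₃ * X 2
  have hH : H.IsHomogeneous 1 := ((isHomogeneous_C_mul_X _ _).add (isHomogeneous_C_mul_X _ _)).add
    (isHomogeneous_C_mul_X _ _)
  set s := fun i : Fin 3 => 2 * e i * (e 0 + e 1 + e 2 - e i) - (e 0 * e 1 + e 0 * e 2 + e 1 * e 2)
  have hXX : ∀ i j : Fin 3, (X i * X j : MvPolynomial (Fin 3) k).IsHomogeneous 2 :=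
    fun i j => (isHomogeneous_X _ _).mul (isHomogeneous_X _ _)
  set q := fun i : Fin 3 => (X 0 * X 0 + C (-2 * e i) * (X 0 * X 2) + C (s i) * (X 2 * X 2) :
    MvPolynomial (Fin 3) k)
  have hq : ∀ i, (q i).IsHomogeneous 2 := fun i =>
    ((hXX 0 0).add ((hXX 0 2).C_mul _)).add ((hXX 2 2).C_mul _)
  -- On the curve `r i` equals `4 x * quad e i x`: the term `4x³` is replaced by means of the cubic
  -- equation, which lowers the degree to two. At infinity only the square `H * H` survives, so
  -- these forms serve as a chart there.
  set r := fun i : Fin 3 => (H * H + C (4 * (e 0 + e 1 + e 2 - 2 * e i)) * (X 0 * X 0) +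
    C (4 * (s i - (e 0 * e 1 + e 0 * e 2 + e 1 * e 2))) * (X 0 * X 2) +
    C (4 * (e 0 * e 1 * e 2)) * (X 2 * X 2) : MvPolynomial (Fin 3) k)
  have hr : ∀ i, (r i).IsHomogeneous 2 := fun i =>
    (((hH.mul hH).add ((hXX 0 0).C_mul _)).add ((hXX 0 2).C_mul _)).add ((hXX 2 2).C_mul _)
  refine FunctionStructure.isMorphism_of_forms fun P => ?_
  have fin : ∀ G : Fin 4 → MvPolynomial (Fin 3) k, (∀ l, (G l).IsHomogeneous 2) →
      (∀ Q, ∃ c : k, (Q = P → c ≠ 0) ∧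
        (fun l => eval (W.toPlane Q).rep (G l)) = c • quarticVec W e Q) →
      ∃ (d : ℕ) (G : Fin 4 → MvPolynomial (Fin 3) k), (∀ l, (G l).IsHomogeneous d) ∧
        (fun l => eval (W.toPlane P).rep (G l)) ≠ 0 ∧
        ∀ Q, ∀ hQ : (fun l => eval (W.toPlane Q).rep (G l)) ≠ 0,
          (toQuartic hk h Q).1 = Projectivization.mk k _ hQ := by
    intro G hG hGQ
    refine ⟨2, G, hG, ?_, fun Q hQ => ?_⟩
    · obtain ⟨c, hc, hcG⟩ := hGQ P
      rw [hcG]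
      exact smul_ne_zero (hc rfl) (h.quarticVec_ne_zero hk P)
    · obtain ⟨c, -, hcG⟩ := hGQ Q
      exact (Projectivization.mk_eq_mk_of_smul _ _ c hcG.symm).symm
  rcases P with _ | ⟨x₀, y₀, hxy₀⟩
  · refine fin ![C 4 * (X 0 * H), r 0, r 1, r 2] ?_ ?_
    · intro l
      fin_cases l
      exacts [((isHomogeneous_X _ _).mul hH).C_mul _, hr 0, hr 1, hr 2]
    · rintro (_ | ⟨x, y, hxy⟩)
      · obtain ⟨c, hc, hcv⟩ := Projectivization.exists_rep_mk (k := k) ![0, 1, 0]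
          (fun h => by simpa using congrFun h 1)
        refine ⟨4 * c ^ 2, fun _ => mul_ne_zero h4 (pow_ne_zero 2 hc), _root_.funext fun l => ?_⟩
        simp only [toPlane, hcv, quarticVec]
        fin_cases l <;> simp [H, r] <;> ring
      · obtain ⟨c, hc, hcv⟩ := Projectivization.exists_rep_mk (k := k) ![x, y, 1]
          (fun h => by simpa using congrFun h 2)
        have hη := h.eta_sq hxy.1
        rw [eta] at hη
        have key : ∀ i, eval (c • ![x, y, 1]) (r i) = 4 * c ^ 2 * x * quad e i x := by
          intro i
          simp only [r, H, s, quad, map_add, map_mul, eval_C, eval_X, Pi.smul_apply, Matrix.cons_val,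
            smul_eq_mul]
          linear_combination c ^ 2 * hη
        refine ⟨4 * c ^ 2 * x, nofun, _root_.funext fun l => ?_⟩
        simp only [toPlane, hcv, quarticVec]
        fin_cases l
        · simp [H, eta]
          ring
        · exact key 0
        · exact key 1
        · exact key 2
  · refine fin ![H * X 2, q 0, q 1, q 2] ?_ ?_
    · intro l
      fin_cases l
      exacts [hH.mul (isHomogeneous_X _ _), hq 0, hq 1, hq 2]
    · rintro (_ | ⟨x, y, hxy⟩)
      · obtain ⟨c, hc, hcv⟩ := Projectivization.exists_rep_mk (k := k) ![0, 1, 0]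
          (fun h => by simpa using congrFun h 1)
        refine ⟨0, nofun, _root_.funext fun l => ?_⟩
        simp only [toPlane, hcv, quarticVec]
        fin_cases l <;> simp [H, q]
      · obtain ⟨c, hc, hcv⟩ := Projectivization.exists_rep_mk (k := k) ![x, y, 1]
          (fun h => by simpa using congrFun h 2)
        have key : ∀ i, eval (c • ![x, y, 1]) (q i) = c ^ 2 * quad e i x := by
          intro i
          simp only [q, s, quad, map_add, map_mul, eval_C, eval_X, Pi.smul_apply, Matrix.cons_val,
            smul_eq_mul]
          ring
        refine ⟨c ^ 2, fun _ => pow_ne_zero 2 hc, _root_.funext fun l => ?_⟩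
        simp only [toPlane, hcv, quarticVec]
        fin_cases l
        · simp [H, eta]
          ring
        · exact key 0
        · exact key 1
        · exact key 2

/-- A Weierstrass curve is isomorphic to a quartic curve. -/
noncomputable def quarticEquiv [W.IsElliptic] (hk : (2 : k) ≠ 0) (h : W.HasTwoTorsion e) :
    W.toAffine.Point ≃ quartic e :=
  Equiv.ofBijective (toQuartic hk h) ⟨toQuartic_injective hk h, toQuartic_surjective hk h⟩

open MvPolynomial in
theorem isIsomorphism_quarticEquiv [W.IsElliptic] (hk : (2 : k) ≠ 0) (h : W.HasTwoTorsion e) :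
    FunctionStructure.IsIsomorphism W.variety (projectiveSubvariety (quartic e))
      (quarticEquiv hk h) := by
  refine ⟨isMorphism_toQuartic hk h, ?_⟩
  have hV := h.vand_ne_zero hk
  have h4 : (4 : k) ≠ 0 := by
    rw [show (4 : k) = 2 * 2 by norm_num]
    exact mul_ne_zero hk hk
  set L : (Fin 3 → k) → MvPolynomial (Fin 4) k := fun a => C (a 0) * X 1 + C (a 1) * X 2 + C (a 2) * X 3
  have hL : ∀ a, (L a).IsHomogeneous 1 := fun a => ((isHomogeneous_C_mul_X _ _).add
    (isHomogeneous_C_mul_X _ _)).add (isHomogeneous_C_mul_X _ _)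
  set L₀ := L ![e 1 - e 2, e 2 - e 0, e 0 - e 1]
  set L₁ := L ![(e 1 - e 2) * e 0, (e 2 - e 0) * e 1, (e 0 - e 1) * e 2]
  set L₂ := L ![(e 1 - e 2) * (e 0 * e 1 + e 0 * e 2 - e 1 * e 2),
    (e 2 - e 0) * (e 0 * e 1 + e 1 * e 2 - e 0 * e 2),
    (e 0 - e 1) * (e 0 * e 2 + e 1 * e 2 - e 0 * e 1)]
  have eL₀ : ∀ z, eval z L₀ = lin₀ e z := fun z => by simp [L₀, L, lin₀]
  have eL₁ : ∀ z, eval z L₁ = lin₁ e z := fun z => by simp [L₁, L, lin₁]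
  have eL₂ : ∀ z, eval z L₂ = lin₂ e z := fun z => by simp [L₂, L, lin₂]
  set planeVec : W.toAffine.Point → Fin 3 → k := fun P => match P with
    | .zero => ![0, 1, 0]
    | .some x y _ => ![x, y, 1] with hpv
  have plane_ne : ∀ P, planeVec P ≠ 0 := by
    rintro (_ | ⟨x, y, hxy⟩) h0
    · simpa [planeVec] using congrFun h0 1
    · simpa [planeVec] using congrFun h0 2
  have plane_eq : ∀ P, W.toPlane P = Projectivization.mk k (planeVec P) (plane_ne P) := by
    rintro (_ | ⟨x, y, hxy⟩) <;> rfl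
  have zero₀ : ∀ c : k, lin₀ e (c • quarticVec W e .zero) = 0 := fun c => by
    rw [(lin_smul _ _).1, quarticVec, lin₀_one, mul_zero]
  have zero₁ : ∀ c : k, lin₁ e (c • quarticVec W e .zero) = 0 := fun c => by
    rw [(lin_smul _ _).2.1, quarticVec, lin₁_one, mul_zero]
  have zero₂ : ∀ c : k, lin₂ e (c • quarticVec W e .zero) = c * vand e := fun c => by
    rw [(lin_smul _ _).2.2, quarticVec, lin₂_one]
  have some₀ : ∀ (c x y : k) hxy, lin₀ e (c • quarticVec W e (.some x y hxy)) = c * vand e :=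
    fun c x y hxy => by rw [(lin_smul _ _).1, quarticVec, lin₀_quad]
  have some₁ : ∀ (c x y : k) hxy, lin₁ e (c • quarticVec W e (.some x y hxy)) = c * (vand e * x) :=
    fun c x y hxy => by rw [(lin_smul _ _).2.1, quarticVec, lin₁_quad]
  have some₂ : ∀ (c x y : k) hxy,
      lin₂ e (c • quarticVec W e (.some x y hxy)) = c * (vand e * x ^ 2) :=
    fun c x y hxy => by rw [(lin_smul _ _).2.2, quarticVec, lin₂_quad]
  have zeroX : quarticVec W e .zero 0 = 0 := rfl
  have someX : ∀ (x y : k) hxy, quarticVec W e (.some x y hxy) 0 = W.eta x y := fun _ _ _ => rfl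
  refine FunctionStructure.isMorphism_of_forms fun z => ?_
  obtain ⟨P, rfl⟩ := (quarticEquiv hk h).surjective z
  have fin : ∀ (d : ℕ) (G : Fin 3 → MvPolynomial (Fin 4) k), (∀ l, (G l).IsHomogeneous d) →
      (∀ Q, ∀ c : k, c ≠ 0 → ∃ c' : k, (Q = P → c' ≠ 0) ∧
        (fun l => eval (c • quarticVec W e Q) (G l)) = c' • planeVec Q) →
      ∃ (d : ℕ) (G : Fin 3 → MvPolynomial (Fin 4) k), (∀ l, (G l).IsHomogeneous d) ∧
        (fun l => eval (quarticEquiv hk h P).1.rep (G l)) ≠ 0 ∧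
        ∀ z : quartic e, ∀ hz : (fun l => eval z.1.rep (G l)) ≠ 0,
          W.toPlane ((quarticEquiv hk h).symm z) = Projectivization.mk k _ hz := by
    intro d G hG hGQ
    refine ⟨d, G, hG, ?_, fun z hz => ?_⟩
    · obtain ⟨c, hc, hcv⟩ := Projectivization.exists_rep_mk (quarticVec W e P)
        (h.quarticVec_ne_zero hk P)
      obtain ⟨c', hc', hcG⟩ := hGQ P c hc
      change (fun l => eval (Projectivization.mk k (quarticVec W e P) _).rep (G l)) ≠ 0
      rw [hcv, hcG]
      exact smul_ne_zero (hc' rfl) (plane_ne P)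
    · obtain ⟨Q, rfl⟩ := (quarticEquiv hk h).surjective z
      obtain ⟨c, hc, hcv⟩ := Projectivization.exists_rep_mk (quarticVec W e Q)
        (h.quarticVec_ne_zero hk Q)
      obtain ⟨c', -, hcG⟩ := hGQ Q c hc
      rw [Equiv.symm_apply_apply, plane_eq]
      refine (Projectivization.mk_eq_mk_of_smul _ _ c' ?_).symm
      rw [← hcG, ← hcv]
      rfl
  rcases P with _ | ⟨x₀, y₀, hxy₀⟩
  -- The chart at infinity is `(x : y : 1)` multiplied by `2 x η`. In the middle entry `2 y x η = x
  -- η² - x η (a₁ x + a₃)`, and `x η²` is expressed through the cubic as a quadratic form in `L₀,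
  -- L₁, L₂`.
  · refine fin 2 ![C (2 * vand e) * (L₂ * X 0),
        C 4 * (L₂ * L₂) + C (-4 * (e 0 + e 1 + e 2)) * (L₁ * L₂) +
          C (4 * (e 0 * e 1 + e 0 * e 2 + e 1 * e 2)) * (L₁ * L₁) +
          C (-4 * (e 0 * e 1 * e 2)) * (L₀ * L₁) + C (-W.a₁ * vand e) * (L₂ * X 0) +
          C (-W.a₃ * vand e) * (L₁ * X 0), C (2 * vand e) * (L₁ * X 0)] ?_ ?_
    · have hX := isHomogeneous_X (R := k) (σ := Fin 4) 0
      intro l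
      fin_cases l
      · exact ((hL _).mul hX).C_mul _
      · exact ((((((hL _).mul (hL _)).C_mul _).add (((hL _).mul (hL _)).C_mul _)).add
          (((hL _).mul (hL _)).C_mul _)).add (((hL _).mul (hL _)).C_mul _)).add
          (((hL _).mul hX).C_mul _) |>.add (((hL _).mul hX).C_mul _)
      · exact ((hL _).mul hX).C_mul _
    · rintro (_ | ⟨x, y, hxy⟩) c hc
      · refine ⟨4 * (c * vand e) ^ 2, fun _ => mul_ne_zero h4 (pow_ne_zero 2 (mul_ne_zero hc hV)),
          _root_.funext fun l => ?_⟩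
        fin_cases l <;> simp only [Fin.zero_eta, Fin.mk_one, Fin.reduceFinMk, Matrix.cons_val, map_add, map_mul,
          eval_C, eval_X, eL₀, eL₁, eL₂, Pi.smul_apply, smul_eq_mul, planeVec, zero₀, zero₁, zero₂, zeroX] <;>
          ring
      · have hη := h.eta_sq hxy.1
        have hη' : W.eta x y = 2 * y + W.a₁ * x + W.a₃ := rfl
        refine ⟨2 * c ^ 2 * vand e ^ 2 * x * W.eta x y, nofun, _root_.funext fun l => ?_⟩
        fin_cases l <;> simp only [Fin.zero_eta, Fin.mk_one, Fin.reduceFinMk, Matrix.cons_val, map_add, map_mul,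
          eval_C, eval_X, eL₀, eL₁, eL₂, Pi.smul_apply, smul_eq_mul, planeVec, some₀, some₁, some₂, someX]
        · ring
        · linear_combination (-c ^ 2 * vand e ^ 2 * x) * hη +
            (c ^ 2 * vand e ^ 2 * x * W.eta x y) * hη'
        · ring
  · refine fin 1 ![C 2 * L₁, C (vand e) * X 0 + C (-W.a₁) * L₁ + C (-W.a₃) * L₀, C 2 * L₀] ?_ ?_
    · have hX := isHomogeneous_X (R := k) (σ := Fin 4) 0
      intro l
      fin_cases l
      exacts [(hL _).C_mul _, ((hX.C_mul _).add ((hL _).C_mul _)).add ((hL _).C_mul _),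
        (hL _).C_mul _]
    · rintro (_ | ⟨x, y, hxy⟩) c hc
      · refine ⟨0, nofun, _root_.funext fun l => ?_⟩
        fin_cases l <;> simp only [Fin.zero_eta, Fin.mk_one, Fin.reduceFinMk, Matrix.cons_val, map_add, map_mul,
          eval_C, eval_X, eL₀, eL₁, Pi.smul_apply, smul_eq_mul, planeVec, zero₀, zero₁, zeroX] <;>
          ring
      · refine ⟨2 * c * vand e, fun _ => mul_ne_zero (mul_ne_zero hk hc) hV,
          _root_.funext fun l => ?_⟩
        fin_cases l <;> simp only [Fin.zero_eta, Fin.mk_one, Fin.reduceFinMk, Matrix.cons_val, map_add, map_mul,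
          eval_C, eval_X, eL₀, eL₁, Pi.smul_apply, smul_eq_mul, planeVec, some₀, some₁, someX] <;>
          (try rw [eta]) <;> ring

end WeierstrassCurve

/-! ### Two-torsion and its action on the quartic model. -/

namespace WeierstrassCurve

variable {k : Type*} [Field k] {W : WeierstrassCurve k} {e : Fin 3 → k}
  {T : Fin 3 → W.toAffine.Point}

/-- The points `T i` are the three points of order two, and `e i` are their abscissas. -/
structure IsTwoTorsionFrame (W : WeierstrassCurve k) (e : Fin 3 → k)
    (T : Fin 3 → W.toAffine.Point) : Prop extends W.HasTwoTorsion e where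
  eq_some : ∀ i, ∃ y h, T i = .some (e i) y h ∧ W.eta (e i) y = 0

theorem eta_negY (x y : k) : W.eta x (W.toAffine.negY x y) = -W.eta x y := by
  simp only [eta, Affine.negY]
  ring

theorem quarticVec_neg (P : W.toAffine.Point) :
    quarticVec W e (-P) = signL ![-1, 1, 1, 1] (quarticVec W e P) := by
  rcases P with _ | ⟨x, y, hxy⟩
  · funext l
    change quarticVec W e .zero l = _
    fin_cases l <;> simp [quarticVec, signL]
  · funext l
    rw [Affine.Point.neg_some]
    fin_cases l
    · simpa [quarticVec, signL] using eta_negY x y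
    all_goals simp [quarticVec, signL]

/-- The derivative of `(x - e 0) (x - e 1) (x - e 2)` at `e i`. -/
def cubicDeriv (e : Fin 3 → k) (i : Fin 3) : k :=
  3 * e i ^ 2 - 2 * e i * (e 0 + e 1 + e 2) + (e 0 * e 1 + e 0 * e 2 + e 1 * e 2)

theorem HasTwoTorsion.cubicDeriv_ne_zero (h : W.HasTwoTorsion e) (i : Fin 3) :
    cubicDeriv e i ≠ 0 := by
  obtain ⟨h1, h2, h3⟩ := h.sub_ne_zero
  fin_cases i
  · convert neg_ne_zero.2 (mul_ne_zero h1 h3) using 1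
    simp [cubicDeriv]
    ring
  · convert neg_ne_zero.2 (mul_ne_zero h1 h2) using 1
    simp [cubicDeriv]
    ring
  · convert neg_ne_zero.2 (mul_ne_zero h2 h3) using 1
    simp [cubicDeriv]
    ring

theorem quad_self (i j : Fin 3) :
    quad e j (e i) = (if j = i then -1 else 1) * cubicDeriv e i := by
  fin_cases i <;> fin_cases j <;> simp [quad, cubicDeriv] <;> ring

/-- Adding `T i` induces the involution `u ↦ cubicDeriv e i / u` of `u = x - e i`. The roots of
`quad e j` are the abscissas of the halves of `T j`; they are fixed for `j = i` and interchanged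
otherwise. -/
theorem quad_translate (i j : Fin 3) {u : k} (hu : u ≠ 0) :
    quad e j (e i + cubicDeriv e i / u) =
      (if j = i then -1 else 1) * (cubicDeriv e i / u ^ 2) * quad e j (e i + u) := by
  fin_cases i <;> fin_cases j <;> simp [quad, cubicDeriv] <;> field_simp <;> ring

theorem cubic_translate (i : Fin 3) (u : k) :
    (e i + u - e 0) * (e i + u - e 1) * (e i + u - e 2) =
      u ^ 3 + (3 * e i - (e 0 + e 1 + e 2)) * u ^ 2 + cubicDeriv e i * u := by
  fin_cases i <;> simp [cubicDeriv] <;> ring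

/-- The translation by `T i` changes the signs of the coordinates `0` and `i + 1`. -/
def translateSign : Option (Fin 3) → Fin 4 → ℤˣ
  | none => 1
  | some i => fun j => if j = 0 ∨ j = i.succ then -1 else 1

theorem translateSign_succ (i j : Fin 3) :
    (((translateSign (some i) j.succ : ℤˣ) : ℤ) : k) = if j = i then -1 else 1 := by
  simp only [translateSign, Fin.succ_ne_zero, false_or, Fin.succ_inj]
  split_ifs <;> simp

theorem quarticVec_succ (x y : k) (hxy : W.toAffine.Nonsingular x y) (j : Fin 3) :
    quarticVec W e (.some x y hxy) j.succ = quad e j x := by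
  fin_cases j <;> rfl

/-- A numbering of the points of order dividing two. -/
def torsionPoint (T : Fin 3 → W.toAffine.Point) : Option (Fin 3) → W.toAffine.Point
  | none => 0
  | some i => T i

theorem IsTwoTorsionFrame.eq_of_eta_eq_zero (hk : (2 : k) ≠ 0) (h : W.IsTwoTorsionFrame e T)
    {i : Fin 3} {y : k} {hy : W.toAffine.Nonsingular (e i) y} (hη : W.eta (e i) y = 0) :
    Affine.Point.some (e i) y hy = T i := by
  obtain ⟨y', hy', hT, hη'⟩ := h.eq_some i
  rw [hT]
  have : y = y' := by
    simp only [eta] at hη hη'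
    exact mul_left_cancel₀ hk (by linear_combination hη - hη')
  subst this
  rfl

theorem exists_isTwoTorsionFrame [IsAlgClosed k] (hk : (2 : k) ≠ 0) (W : WeierstrassCurve k)
    [W.IsElliptic] : ∃ e T, W.IsTwoTorsionFrame e T := by
  have h4 : (4 : k) ≠ 0 := by
    rw [show (4 : k) = 2 * 2 by norm_num]
    exact mul_ne_zero hk hk
  have ha : W.twoTorsionPolynomial.a ≠ 0 := h4
  obtain ⟨x, y, z, hroots⟩ := (Cubic.splits_iff_roots_eq_three (φ := RingHom.id k) ha).1
    (IsAlgClosed.splits _)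
  have hdisc : W.twoTorsionPolynomial.discr ≠ 0 :=
    W.twoTorsionPolynomial_discr_ne_zero (isUnit_iff_ne_zero.2 hk) W.isUnit_Δ
  obtain ⟨hxy, hxz, hyz⟩ := (Cubic.discr_ne_zero_iff_roots_ne ha hroots).1 hdisc
  have hb := Cubic.b_eq_three_roots ha hroots
  have hc := Cubic.c_eq_three_roots ha hroots
  have hd := Cubic.d_eq_three_roots ha hroots
  simp only [twoTorsionPolynomial, RingHom.id_apply] at hb hc hd
  have h : W.HasTwoTorsion ![x, y, z] := by
    refine ⟨?_, ?_, ?_, ?_⟩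
    · intro i j hij
      fin_cases i <;> fin_cases j <;> simp_all
    · simp only [Matrix.cons_val]
      linear_combination hb
    · refine mul_left_cancel₀ hk ?_
      simp only [Matrix.cons_val]
      linear_combination hc
    · simp only [Matrix.cons_val]
      linear_combination hd
  have hp : ∀ i, ∃ w, W.toAffine.Equation (![x, y, z] i) w ∧ W.eta (![x, y, z] i) w = 0 := by
    intro i
    refine h.equation hk ?_
    fin_cases i <;> simp
  choose w hw hη using hp
  exact ⟨_, fun i => .some _ (w i) (Affine.equation_iff_nonsingular.1 (hw i)), h,
    fun i => ⟨w i, _, rfl, hη i⟩⟩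

variable [DecidableEq k]

theorem IsTwoTorsionFrame.add_self (h : W.IsTwoTorsionFrame e T) (i : Fin 3) : T i + T i = 0 := by
  obtain ⟨y, hy, hT, hη⟩ := h.eq_some i
  rw [hT]
  refine Affine.Point.add_self_of_Y_eq ?_
  simp only [Affine.negY]
  simp only [eta] at hη
  linear_combination hη

theorem IsTwoTorsionFrame.quarticVec_add (hk : (2 : k) ≠ 0) (h : W.IsTwoTorsionFrame e T)
    (P : W.toAffine.Point) (s : Option (Fin 3)) : ∃ c : k, c ≠ 0 ∧
      quarticVec W e (P + torsionPoint T s) = c • signL (translateSign s) (quarticVec W e P) := by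
  rcases s with _ | i
  · refine ⟨1, one_ne_zero, ?_⟩
    rw [torsionPoint, add_zero, one_smul]
    funext l
    simp [signL, translateSign]
  have hM := h.cubicDeriv_ne_zero i
  obtain ⟨yT, hyT, hT, hηT⟩ := h.eq_some i
  rcases P with _ | ⟨x, y, hxy⟩
  · refine ⟨cubicDeriv e i, hM, ?_⟩
    have : (Affine.Point.zero + torsionPoint T (some i) : W.toAffine.Point) =
        .some (e i) yT hyT := (zero_add _).trans hT
    rw [this]
    refine funext fun l => Fin.cases ?_ (fun j => ?_) l
    · simpa [quarticVec, signL] using hηT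
    · have h1 : quarticVec W e .zero j.succ = 1 := by fin_cases j <;> rfl
      rw [quarticVec_succ, quad_self, Pi.smul_apply, signL, translateSign_succ, h1, smul_eq_mul]
      ring
  · by_cases hx : x = e i
    · subst hx
      have hη : W.eta (e i) y = 0 := by
        have := h.eta_sq hxy.1
        have h0 : (e i - e 0) * (e i - e 1) * (e i - e 2) = 0 := by
          simpa using cubic_translate (e := e) i 0
        rw [h0, mul_zero] at this
        exact pow_eq_zero_iff (two_ne_zero) |>.1 this
      rw [h.eq_of_eta_eq_zero hk hη, torsionPoint, h.add_self]
      refine ⟨(cubicDeriv e i)⁻¹, inv_ne_zero hM, ?_⟩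
      rw [hT]
      change quarticVec W e .zero = _
      refine funext fun l => Fin.cases ?_ (fun j => ?_) l
      · simp [quarticVec, signL, hηT]
      · have h1 : quarticVec W e .zero j.succ = 1 := by fin_cases j <;> rfl
        rw [Pi.smul_apply, signL, translateSign_succ, quarticVec_succ, quad_self, h1, smul_eq_mul]
        split_ifs <;> field_simp
    · set u := x - e i with hu
      have hu0 : u ≠ 0 := sub_ne_zero.2 hx
      have hxu : x = e i + u := by rw [hu]; ring
      have hη := h.eta_sq hxy.1
      rw [torsionPoint, hT, Affine.Point.add_of_X_ne hx]
      set ℓ := W.toAffine.slope x (e i) y yT with hℓ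
      -- Since `eta` vanishes at `T i`, the slope of the chord depends only on `η` and `u`. Squaring
      -- this relation and inserting the cubic gives the abscissa of the sum.
      have hℓu : 2 * (u * ℓ) = W.eta x y - W.a₁ * u := by
        rw [hℓ, Affine.slope_of_X_ne hx, ← hu, mul_div_cancel₀ _ hu0]
        simp only [eta] at hηT ⊢
        linear_combination -hηT + W.a₁ * hu
      have h4 : (4 : k) ≠ 0 := by
        rw [show (4 : k) = 2 * 2 by norm_num]
        exact mul_ne_zero hk hk
      have hX : W.toAffine.addX x (e i) ℓ = e i + cubicDeriv e i / u := by
        have hb := h.b₂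
        rw [WeierstrassCurve.b₂] at hb
        rw [hxu, cubic_translate] at hη
        rw [← hxu] at hη
        refine mul_left_cancel₀ (mul_ne_zero h4 (pow_ne_zero 2 hu0)) ?_
        have : 4 * u ^ 2 * (e i + cubicDeriv e i / u) = 4 * u ^ 2 * e i + 4 * (u * cubicDeriv e i) := by
          field_simp
        rw [this, Affine.addX]
        linear_combination (2 * (u * ℓ) + W.eta x y + W.a₁ * u) * hℓu + hη - u ^ 2 * hb -
          4 * u ^ 2 * hxu
      have hY : W.eta (W.toAffine.addX x (e i) ℓ) (W.toAffine.addY x (e i) y ℓ) =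
          -(cubicDeriv e i / u ^ 2) * W.eta x y := by
        rw [Affine.addY, eta_negY, Affine.negAddY, hX]
        refine mul_left_cancel₀ hu0 ?_
        have : u * (-(cubicDeriv e i / u ^ 2) * W.eta x y) = -(cubicDeriv e i / u) * W.eta x y := by
          field_simp
        rw [this]
        simp only [eta] at hℓu ⊢
        linear_combination (-(e i + cubicDeriv e i / u - x)) * hℓu +
          (-(2 * y + W.a₁ * x + W.a₃)) * hxu
      refine ⟨cubicDeriv e i / u ^ 2, div_ne_zero hM (pow_ne_zero 2 hu0), ?_⟩
      refine funext fun l => Fin.cases ?_ (fun j => ?_) l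
      · rw [Pi.smul_apply, signL]
        change W.eta _ _ = _
        rw [hY]
        simp [translateSign, quarticVec]
      · rw [quarticVec_succ, Pi.smul_apply, signL, translateSign_succ, quarticVec_succ, hX,
          quad_translate i j hu0, ← hxu, smul_eq_mul]
        ring

theorem eta_eq_zero_of_add_self {x y : k} {hxy : W.toAffine.Nonsingular x y}
    (h : Affine.Point.some x y hxy + Affine.Point.some x y hxy = 0) : W.eta x y = 0 := by
  have := eq_neg_of_add_eq_zero_left h
  rw [Affine.Point.neg_some, Affine.Point.some.injEq] at this
  have := this.2
  simp only [Affine.negY] at this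
  simp only [eta]
  linear_combination this

theorem IsTwoTorsionFrame.exists_of_add_self (hk : (2 : k) ≠ 0) (h : W.IsTwoTorsionFrame e T)
    {P : W.toAffine.Point} (hP : P + P = 0) : ∃ s, P = torsionPoint T s := by
  rcases P with _ | ⟨x, y, hxy⟩
  · exact ⟨none, rfl⟩
  · have hη := eta_eq_zero_of_add_self hP
    have := h.eta_sq hxy.1
    have h4 : (4 : k) ≠ 0 := by
      rw [show (4 : k) = 2 * 2 by norm_num]
      exact mul_ne_zero hk hk
    rw [hη, eq_comm] at this
    simp only [ne_eq, OfNat.ofNat_ne_zero, not_false_eq_true, zero_pow, mul_eq_zero, h4,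
      sub_eq_zero, false_or] at this
    have hi : ∃ i, x = e i := by
      rcases this with (h | h) | h
      exacts [⟨0, h⟩, ⟨1, h⟩, ⟨2, h⟩]
    obtain ⟨i, rfl⟩ := hi
    exact ⟨some i, h.eq_of_eta_eq_zero hk hη⟩

/-- The abscissas are three distinct roots of `4x³ + b₂x² + 2b₄x + b₆`. Divided differences of the
three equations yield Vieta's formulas, hence the coefficients. -/
theorem exists_isTwoTorsionFrame_of_injective (hk : (2 : k) ≠ 0)
    (hT : Function.Injective T) (h0 : ∀ i, T i ≠ 0) (h2 : ∀ i, T i + T i = 0) :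
    ∃ e, W.IsTwoTorsionFrame e T := by
  have hsome : ∀ i, ∃ x y h, T i = .some x y h ∧ W.eta x y = 0 := by
    intro i
    rcases hTi : T i with _ | ⟨x, y, hxy⟩
    · exact absurd hTi (h0 i)
    · refine ⟨x, y, hxy, rfl, eta_eq_zero_of_add_self (hxy := hxy) ?_⟩
      rw [← hTi, h2]
  choose e y h hTe hη using hsome
  have he : Function.Injective e := by
    intro i j hij
    refine hT ?_
    have hηi := hη i
    have hηj := hη j
    simp only [eta] at hηi hηj
    have hy : y i = y j := mul_left_cancel₀ hk (by linear_combination hηi - hηj - W.a₁ * hij)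
    rw [hTe, hTe, Affine.Point.some.injEq]
    exact ⟨hij, hy⟩
  have hcub : ∀ i, 4 * e i ^ 3 + W.b₂ * e i ^ 2 + 2 * W.b₄ * e i + W.b₆ = 0 := by
    intro i
    have h1 := (Affine.equation_iff _ _).1 (h i).1
    have h2 := hη i
    simp only [eta] at h2
    simp only [WeierstrassCurve.b₂, WeierstrassCurve.b₄, WeierstrassCurve.b₆]
    linear_combination (2 * y i + W.a₁ * e i + W.a₃) * h2 - 4 * h1
  have n01 : e 0 - e 1 ≠ 0 := sub_ne_zero.2 (he.ne (by decide))
  have n02 : e 0 - e 2 ≠ 0 := sub_ne_zero.2 (he.ne (by decide))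
  have n12 : e 1 - e 2 ≠ 0 := sub_ne_zero.2 (he.ne (by decide))
  have c0 := hcub 0
  have c1 := hcub 1
  have c2 := hcub 2
  have d01 : 4 * (e 0 ^ 2 + e 0 * e 1 + e 1 ^ 2) + W.b₂ * (e 0 + e 1) + 2 * W.b₄ = 0 := by
    refine (mul_eq_zero.1 (?_ : (e 0 - e 1) * _ = 0)).resolve_left n01
    linear_combination c0 - c1
  have d02 : 4 * (e 0 ^ 2 + e 0 * e 2 + e 2 ^ 2) + W.b₂ * (e 0 + e 2) + 2 * W.b₄ = 0 := by
    refine (mul_eq_zero.1 (?_ : (e 0 - e 2) * _ = 0)).resolve_left n02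
    linear_combination c0 - c2
  have hb₂ : 4 * (e 0 + e 1 + e 2) + W.b₂ = 0 := by
    refine (mul_eq_zero.1 (?_ : (e 1 - e 2) * _ = 0)).resolve_left n12
    linear_combination d01 - d02
  have hb₄ : W.b₄ = 2 * (e 0 * e 1 + e 0 * e 2 + e 1 * e 2) :=
    mul_left_cancel₀ hk (by linear_combination d01 - (e 0 + e 1) * hb₂)
  refine ⟨e, ⟨he, by linear_combination hb₂, hb₄, ?_⟩, fun i => ⟨y i, h i, hTe i, hη i⟩⟩
  linear_combination c0 - e 0 ^ 2 * hb₂ - 2 * e 0 * hb₄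

end WeierstrassCurve

/-! ### Monomial coordinate changes and sign changes. -/

section Monomial

variable {k : Type*} [Field k] {n : ℕ}

/-- The coordinate change `(x i) ↦ (d i * x (σ i))`. -/
def monomialEquiv (σ : Equiv.Perm (Fin n)) (d : Fin n → kˣ) : (Fin n → k) ≃ₗ[k] (Fin n → k) where
  toFun x i := d i * x (σ i)
  invFun x i := ((d (σ.symm i))⁻¹ : kˣ) * x (σ.symm i)
  map_add' x y := by
    funext i
    simp [mul_add]
  map_smul' c x := by
    funext i
    simp only [Pi.smul_apply, smul_eq_mul, RingHom.id_apply]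
    ring
  left_inv x := by
    funext i
    simp
  right_inv x := by
    funext i
    simp

theorem monomialEquiv_apply (σ : Equiv.Perm (Fin n)) (d : Fin n → kˣ) (x : Fin n → k) (i : Fin n) :
    monomialEquiv σ d x i = d i * x (σ i) := rfl

theorem signL_smul (ε : Fin 4 → ℤˣ) (c : k) (x : Fin 4 → k) : signL ε (c • x) = c • signL ε x := by
  funext i
  simp only [signL, Pi.smul_apply, smul_eq_mul]
  ring

theorem signL_mul (ε δ : Fin 4 → ℤˣ) (x : Fin 4 → k) :
    signL (ε * δ) x = signL ε (signL δ x) := by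
  funext i
  simp only [signL, Pi.mul_apply, Units.val_mul, Int.cast_mul]
  ring

theorem signL_monomialEquiv (σ : Equiv.Perm (Fin 4)) (d : Fin 4 → kˣ) (ε : Fin 4 → ℤˣ)
    (x : Fin 4 → k) :
    signL ε (monomialEquiv σ d x) = monomialEquiv σ d (signL (ε ∘ σ.symm) x) := by
  funext i
  simp only [signL, monomialEquiv_apply, Function.comp_apply, Equiv.symm_apply_apply]
  ring

/-- The permutation of coordinates that identifies quartics with space curves, on the left. -/
def permL : Equiv.Perm (Fin 4) := ⟨![1, 2, 0, 3], ![2, 0, 1, 3], by decide, by decide⟩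

/-- The permutation of coordinates that identifies quartics with space curves, on the right. -/
def permR : Equiv.Perm (Fin 4) := ⟨![1, 2, 3, 0], ![3, 0, 1, 2], by decide, by decide⟩

theorem swapIndex_permR_symm : swapIndex ∘ permR.symm = permL.symm := by
  funext i
  revert i
  decide

/-- The two permutations differ by `swapIndex`, so every Weber coordinate is a constant times a
product of coordinates with the same index, in which a simultaneous sign cancels. -/
theorem weberVector_monomialEquiv_sign (d d' : Fin 4 → kˣ) (ε : Fin 4 → ℤˣ) (x y : Fin 4 → k) :
    weberVector (monomialEquiv permL d (signL ε x)) (monomialEquiv permR d' (signL ε y)) =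
      weberVector (monomialEquiv permL d x) (monomialEquiv permR d' y) := by
  have hl : monomialEquiv permL d (signL ε x) = signL (ε ∘ permL) (monomialEquiv permL d x) := by
    rw [signL_monomialEquiv]
    congr 2
    funext i
    simp
  have hr : monomialEquiv permR d' (signL ε y) =
      signR (ε ∘ permL) (monomialEquiv permR d' y) := by
    change _ = signL ((ε ∘ permL) ∘ swapIndex) _
    rw [signL_monomialEquiv, Function.comp_assoc, swapIndex_permR_symm]
    congr 2
    funext i
    simp
  rw [hl, hr, weberVector_sign]

/-- Up to a common sign, sign changes are composed of a translation and possibly the inversion. -/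
theorem exists_translateSign_eq (ε : Fin 4 → ℤˣ) : ∃ (δ : ℤˣ) (ν : Fin 4 → ℤˣ)
    (s : Option (Fin 3)), (ν = 1 ∨ ν = ![-1, 1, 1, 1]) ∧
      ε = (fun _ => δ) * (ν * WeierstrassCurve.translateSign s) := by
  revert ε
  decide

end Monomial

/-! ### Weierstrass curves as space curves. -/

namespace WeierstrassCurve

variable {k : Type*} [Field k] {W : WeierstrassCurve k} {e : Fin 3 → k}
  {T : Fin 3 → W.toAffine.Point}

theorem HasTwoTorsion.eq_of_quarticVec (hk : (2 : k) ≠ 0) (h : W.HasTwoTorsion e)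
    {P Q : W.toAffine.Point} {c : k} (hPQ : quarticVec W e P = c • quarticVec W e Q) : P = Q :=
  toQuartic_injective hk h (Subtype.ext (Projectivization.mk_eq_mk_of_smul _ _ c hPQ.symm))

theorem exists_isIsomorphism_of_monomialEquiv [W.IsElliptic] (hk : (2 : k) ≠ 0)
    (h : W.HasTwoTorsion e) {Z : Set (ℙ k (Fin 4 → k))} (σ : Equiv.Perm (Fin 4)) (d : Fin 4 → kˣ)
    (hZ : ∀ z (hz : z ≠ 0), OnQuartic e z ↔
      Projectivization.mk k (monomialEquiv σ d z) (by simpa using hz) ∈ Z) :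
    ∃ ψ : W.toAffine.Point ≃ Z,
      FunctionStructure.IsIsomorphism W.variety (projectiveSubvariety Z) ψ ∧
      ∀ P, (ψ P : ℙ k (Fin 4 → k)) = Projectivization.mk k (monomialEquiv σ d (quarticVec W e P))
        (by simpa using h.quarticVec_ne_zero hk P) := by
  obtain ⟨m, hm, hm'⟩ := FunctionStructure.exists_isIsomorphism_of_linearEquiv
    (Z := quartic e) (Z' := Z) (monomialEquiv σ d)
    fun z hz => (mk_mem_quartic_iff hz).trans (hZ z hz)
  exact ⟨(quarticEquiv hk h).trans m, (isIsomorphism_quarticEquiv hk h).trans hm,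
    fun P => hm' _ (h.quarticVec_ne_zero hk P) _⟩

/-- The coordinates `(z₁ : z₂ : r z₀ : z₃)` with `r² = e 1 - e 0` turn the diagonal quadrics into
the equations of the space curve. -/
theorem HasTwoTorsion.exists_spaceCurve_left [IsAlgClosed k] [W.IsElliptic] (hk : (2 : k) ≠ 0)
    (h : W.HasTwoTorsion e) : ∃ (κ : k) (d : Fin 4 → kˣ) (ψ : W.toAffine.Point ≃ spaceCurve κ),
      κ * (e 1 - e 0) = e 2 - e 0 ∧
      FunctionStructure.IsIsomorphism W.variety (projectiveSubvariety (spaceCurve κ)) ψ ∧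
      ∀ P, (ψ P : ℙ k (Fin 4 → k)) =
        Projectivization.mk k (monomialEquiv permL d (quarticVec W e P))
          (by simpa using h.quarticVec_ne_zero hk P) := by
  have n10 : e 1 - e 0 ≠ 0 := _root_.sub_ne_zero.2 (h.injective.ne (by decide))
  obtain ⟨r, hr⟩ := IsAlgClosed.exists_pow_nat_eq (e 1 - e 0) two_pos
  have hr0 : r ≠ 0 := by
    rintro rfl
    exact n10 (by simpa using hr.symm)
  have hκ : (e 2 - e 0) / (e 1 - e 0) * (e 1 - e 0) = e 2 - e 0 := div_mul_cancel₀ _ n10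
  obtain ⟨ψ, hψ, hψ'⟩ := exists_isIsomorphism_of_monomialEquiv hk h
    (Z := spaceCurve ((e 2 - e 0) / (e 1 - e 0))) permL ![1, 1, Units.mk0 r hr0, 1] (by
      intro z hz
      rw [mk_mem_spaceCurve_iff]
      simp only [OnQuartic, OnCone, monomialEquiv_apply, permL, Equiv.coe_fn_mk, Matrix.cons_val,
        Units.val_one, Units.val_mk0]
      constructor
      · rintro ⟨h1, h2⟩
        constructor
        · linear_combination -h1 + z 0 ^ 2 * hr
        · linear_combination -h2 + z 0 ^ 2 * hκ +
            (e 2 - e 0) / (e 1 - e 0) * z 0 ^ 2 * hr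
      · rintro ⟨h1, h2⟩
        constructor
        · linear_combination -h1 + z 0 ^ 2 * hr
        · linear_combination -h2 + z 0 ^ 2 * hκ +
            (e 2 - e 0) / (e 1 - e 0) * z 0 ^ 2 * hr)
  exact ⟨_, _, ψ, hκ, hψ, hψ'⟩

/-- Here `z₃` takes the place that `z₀` has on the left, so the coordinates are `(a z₁ : b z₂ : z₃ :
r z₀)`. Comparing coefficients gives `a² = κ`, `b² = κ - 1` and `r² = κ (e 2 - e 0)`; this `κ` is
one minus the parameter on the left. -/
theorem HasTwoTorsion.exists_spaceCurve_right [IsAlgClosed k] [W.IsElliptic] (hk : (2 : k) ≠ 0)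
    (h : W.HasTwoTorsion e) : ∃ (κ : k) (d : Fin 4 → kˣ) (ψ : W.toAffine.Point ≃ spaceCurve κ),
      κ * (e 1 - e 0) = e 1 - e 2 ∧
      FunctionStructure.IsIsomorphism W.variety (projectiveSubvariety (spaceCurve κ)) ψ ∧
      ∀ P, (ψ P : ℙ k (Fin 4 → k)) =
        Projectivization.mk k (monomialEquiv permR d (quarticVec W e P))
          (by simpa using h.quarticVec_ne_zero hk P) := by
  have n10 : e 1 - e 0 ≠ 0 := _root_.sub_ne_zero.2 (h.injective.ne (by decide))
  have n20 : e 2 - e 0 ≠ 0 := _root_.sub_ne_zero.2 (h.injective.ne (by decide))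
  have n12 : e 1 - e 2 ≠ 0 := _root_.sub_ne_zero.2 (h.injective.ne (by decide))
  obtain ⟨κ, hκ⟩ : ∃ κ, κ * (e 1 - e 0) = e 1 - e 2 := ⟨_, div_mul_cancel₀ _ n10⟩
  have sqrt : ∀ x : k, x ≠ 0 → ∃ r : kˣ, (r : k) ^ 2 = x := by
    intro x hx
    obtain ⟨r, hr⟩ := IsAlgClosed.exists_pow_nat_eq x two_pos
    refine ⟨Units.mk0 r ?_, hr⟩
    rintro rfl
    exact hx (by simpa using hr.symm)
  have hκ0 : κ ≠ 0 := by
    rintro rfl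
    exact n12 (by simpa using hκ.symm)
  have hκ1 : κ - 1 ≠ 0 := fun h1 => n20 (by linear_combination hκ - (e 1 - e 0) * h1)
  obtain ⟨a, ha⟩ := sqrt κ hκ0
  obtain ⟨b, hb⟩ := sqrt (κ - 1) hκ1
  obtain ⟨r, hr⟩ := sqrt (κ * (e 2 - e 0)) (mul_ne_zero hκ0 n20)
  obtain ⟨ψ, hψ, hψ'⟩ := exists_isIsomorphism_of_monomialEquiv hk h
    (Z := spaceCurve κ) permR ![a, b, 1, r] (by
      intro z hz
      rw [mk_mem_spaceCurve_iff]
      simp only [OnQuartic, OnCone, monomialEquiv_apply, permR, Equiv.coe_fn_mk, Matrix.cons_val,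
        Units.val_one, mul_pow, ha, hb, hr]
      constructor
      · rintro ⟨h1, h2⟩
        constructor
        · linear_combination -κ * h1 + h1 - h2 - z 0 ^ 2 * hκ
        · linear_combination -κ * h2
      · rintro ⟨h1, h2⟩
        have h3 : z 1 ^ 2 - z 3 ^ 2 = (e 2 - e 0) * z 0 ^ 2 :=
          mul_left_cancel₀ hκ0 (by linear_combination -h2)
        refine ⟨mul_left_cancel₀ hκ1 ?_, h3⟩
        linear_combination -h1 - h3 - z 0 ^ 2 * hκ)
  exact ⟨_, _, ψ, hκ, hψ, hψ'⟩

end WeierstrassCurve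

/-! ### Sign changes, two-torsion and the points of the Kummer surface. -/

section Kummer

open WeierstrassCurve

variable {k : Type*} [Field k] {W₁ W₂ : WeierstrassCurve k} {e f : Fin 3 → k}
  {T₁ : Fin 3 → W₁.toAffine.Point} {T₂ : Fin 3 → W₂.toAffine.Point}

variable {κ₁ κ₂ : k} {d d' : Fin 4 → kˣ}

theorem weberMap_eq_of_sign (hk : (2 : k) ≠ 0) (h₁ : W₁.HasTwoTorsion e) (h₂ : W₂.HasTwoTorsion f)
    (hκ₁ : κ₁ ≠ 0) (hκ₂ : κ₂ ≠ 0)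
    {ψ₁ : W₁.toAffine.Point → spaceCurve κ₁} {ψ₂ : W₂.toAffine.Point → spaceCurve κ₂}
    (hψ₁ : ∀ P, (ψ₁ P : ℙ k (Fin 4 → k)) =
      Projectivization.mk k (monomialEquiv permL d (quarticVec W₁ e P))
        (by simpa using h₁.quarticVec_ne_zero hk P))
    (hψ₂ : ∀ P, (ψ₂ P : ℙ k (Fin 4 → k)) =
      Projectivization.mk k (monomialEquiv permR d' (quarticVec W₂ f P))
        (by simpa using h₂.quarticVec_ne_zero hk P))
    {P P' : W₁.toAffine.Point} {Q Q' : W₂.toAffine.Point} {c c' : k} (ε : Fin 4 → ℤˣ)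
    (hP : quarticVec W₁ e P' = c • signL ε (quarticVec W₁ e P))
    (hQ : quarticVec W₂ f Q' = c' • signL ε (quarticVec W₂ f Q)) :
    weberMap hκ₁ hκ₂ (ψ₁ P', ψ₂ Q') = weberMap hκ₁ hκ₂ (ψ₁ P, ψ₂ Q) := by
  have cone₁ : ∀ P, OnCone κ₁ (monomialEquiv permL d (quarticVec W₁ e P)) := fun P =>
    (mk_mem_spaceCurve_iff _).1 (hψ₁ P ▸ (ψ₁ P).2)
  have cone₂ : ∀ P, OnCone κ₂ (monomialEquiv permR d' (quarticVec W₂ f P)) := fun P =>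
    (mk_mem_spaceCurve_iff _).1 (hψ₂ P ▸ (ψ₂ P).2)
  have eq₁ : ∀ P, ψ₁ P = conePoint _ (cone₁ P) (by simpa using h₁.quarticVec_ne_zero hk P) :=
    fun P => Subtype.ext (hψ₁ P)
  have eq₂ : ∀ P, ψ₂ P = conePoint _ (cone₂ P) (by simpa using h₂.quarticVec_ne_zero hk P) :=
    fun P => Subtype.ext (hψ₂ P)
  rw [eq₁, eq₁, eq₂, eq₂, weberMap_conePoint, weberMap_conePoint]
  refine Projectivization.mk_eq_mk_of_smul _ _ (c * c') ?_
  rw [hP, hQ, map_smul, map_smul, weberVector_smul, weberVector_monomialEquiv_sign]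

theorem exists_sign_of_weberMap_eq [IsAlgClosed k] (hk : (2 : k) ≠ 0) (h₁ : W₁.HasTwoTorsion e)
    (h₂ : W₂.HasTwoTorsion f) (hκ₁ : κ₁ ≠ 0) (hκ₂ : κ₂ ≠ 0) (hs : κ₁ + κ₂ ≠ 1)
    {ψ₁ : W₁.toAffine.Point → spaceCurve κ₁} {ψ₂ : W₂.toAffine.Point → spaceCurve κ₂}
    (hψ₁ : ∀ P, (ψ₁ P : ℙ k (Fin 4 → k)) =
      Projectivization.mk k (monomialEquiv permL d (quarticVec W₁ e P))
        (by simpa using h₁.quarticVec_ne_zero hk P))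
    (hψ₂ : ∀ P, (ψ₂ P : ℙ k (Fin 4 → k)) =
      Projectivization.mk k (monomialEquiv permR d' (quarticVec W₂ f P))
        (by simpa using h₂.quarticVec_ne_zero hk P))
    {P P' : W₁.toAffine.Point} {Q Q' : W₂.toAffine.Point}
    (h : weberMap hκ₁ hκ₂ (ψ₁ P', ψ₂ Q') = weberMap hκ₁ hκ₂ (ψ₁ P, ψ₂ Q)) :
    ∃ (ε : Fin 4 → ℤˣ) (c c' : k), quarticVec W₁ e P' = c • signL ε (quarticVec W₁ e P) ∧
      quarticVec W₂ f Q' = c' • signL ε (quarticVec W₂ f Q) := by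
  have main : ∀ (σ : Equiv.Perm (Fin 4)) (d : Fin 4 → kˣ) (ε : Fin 4 → ℤˣ) (v v' : Fin 4 → k)
      (x x' : ℙ k (Fin 4 → k)) (hv hv'), x = Projectivization.mk k (monomialEquiv σ d v) hv →
      x' = Projectivization.mk k (monomialEquiv σ d v') hv' →
      x' = Projectivization.mk k (signL ε x.rep) (signL_ne_zero ε x.rep_nonzero) →
      ∃ c : k, v' = c • signL (ε ∘ σ.symm) v := by
    intro σ d ε v v' x x' hv hv' hx hx' h
    obtain ⟨c, -, hc⟩ := Projectivization.exists_smul_of_mk_eq_mk (hx'.symm.trans h)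
    obtain ⟨b, -, hb⟩ := Projectivization.exists_rep_mk _ hv
    refine ⟨c * b, (monomialEquiv σ d).injective ?_⟩
    rw [← hc, hx, hb, signL_smul, signL_monomialEquiv, map_smul, smul_smul]
  obtain ⟨ε, hε⟩ := (weberMap_eq_iff hκ₁ hκ₂ hs _ _).1 h
  obtain ⟨c, hc⟩ := main _ _ ε _ _ _ _ _ _ (hψ₁ P) (hψ₁ P')
    (congrArg (fun p => (p.1 : ℙ k (Fin 4 → k))) hε)
  -- On the second space curve the signs are permuted by `swapIndex`; transported to the quartics,
  -- the two sign vectors become equal.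
  obtain ⟨c', hc'⟩ := main _ _ (ε ∘ swapIndex) _ _ _ _ _ _ (hψ₂ Q) (hψ₂ Q')
    (congrArg (fun p => (p.2 : ℙ k (Fin 4 → k))) hε)
  rw [Function.comp_assoc, swapIndex_permR_symm] at hc'
  exact ⟨_, c, c', hc, hc'⟩

variable [DecidableEq k]

theorem mem_twoTorsion_iff {W : WeierstrassCurve k} {P : W.toAffine.Point} :
    P ∈ TwoTorsion W ↔ P + P = 0 := by
  rw [← two_zsmul]
  exact Submodule.mem_torsionBy_iff _ _

theorem WeierstrassCurve.IsTwoTorsionFrame.torsionPoint_mem (h₁ : W₁.IsTwoTorsionFrame e T₁)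
    (s : Option (Fin 3)) : torsionPoint T₁ s ∈ TwoTorsion W₁ := by
  rw [mem_twoTorsion_iff]
  rcases s with _ | i
  · exact add_zero _
  · exact h₁.add_self i

/-- A numbering of the nonzero two-torsion points of `W₁` induces one on `W₂`. -/
theorem exists_isTwoTorsionFrame_of_equiv (hk : (2 : k) ≠ 0) (h₁ : W₁.IsTwoTorsionFrame e T₁)
    (φ : TwoTorsion W₁ ≃+ TwoTorsion W₂) : ∃ f T₂, W₂.IsTwoTorsionFrame f T₂ ∧
      ∀ s, (φ ⟨torsionPoint T₁ s, h₁.torsionPoint_mem s⟩ : W₂.toAffine.Point) =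
        torsionPoint T₂ s := by
  have hφ : ∀ i, T₁ i ∈ TwoTorsion W₁ := fun i => h₁.torsionPoint_mem (some i)
  have hne : ∀ i, T₁ i ≠ 0 := by
    intro i h0
    obtain ⟨y, hy, hT, -⟩ := h₁.eq_some i
    rw [hT] at h0
    exact Affine.Point.some_ne_zero hy h0
  have hinj : Function.Injective T₁ := by
    intro i j hij
    obtain ⟨y, hy, hT, -⟩ := h₁.eq_some i
    obtain ⟨y', hy', hT', -⟩ := h₁.eq_some j
    rw [hT, hT', Affine.Point.some.injEq] at hij
    exact h₁.injective hij.1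
  obtain ⟨f, hf⟩ := exists_isTwoTorsionFrame_of_injective (W := W₂)
    (T := fun i => (φ ⟨T₁ i, hφ i⟩ : W₂.toAffine.Point)) hk
    (fun i j hij => hinj (congrArg Subtype.val (φ.injective (Subtype.ext hij))))
    (fun i h0 => hne i (congrArg Subtype.val
      ((map_eq_zero_iff φ φ.injective).1 (Subtype.ext h0 : φ ⟨T₁ i, hφ i⟩ = 0))))
    (fun i => mem_twoTorsion_iff.1 (φ ⟨T₁ i, hφ i⟩).2)
  refine ⟨f, _, hf, ?_⟩
  rintro (_ | i)
  · exact congrArg Subtype.val (map_zero φ)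
  · rfl

theorem toKummer_surjective (φ : TwoTorsion W₁ ≃+ TwoTorsion W₂) :
    Function.Surjective (toKummer φ) :=
  Quotient.mk_surjective.comp (QuotientAddGroup.mk_surjective)

theorem isMorphism_toKummer (φ : TwoTorsion W₁ ≃+ TwoTorsion W₂) :
    FunctionStructure.IsMorphism (W₁.variety.prod W₂.variety) (kummerSurface φ) (toKummer φ) :=
  FunctionStructure.IsMorphism.comp (FunctionStructure.isMorphism_quotient _ (gluedSurface φ))
    (FunctionStructure.isMorphism_quotient _ _)

theorem toKummer_eq_iff (hk : (2 : k) ≠ 0) (h₁ : W₁.IsTwoTorsionFrame e T₁)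
    (φ : TwoTorsion W₁ ≃+ TwoTorsion W₂)
    (hφ : ∀ s, (φ ⟨torsionPoint T₁ s, h₁.torsionPoint_mem s⟩ : W₂.toAffine.Point) =
      torsionPoint T₂ s) (p q : W₁.toAffine.Point × W₂.toAffine.Point) :
    toKummer φ p = toKummer φ q ↔
      ∃ s, q = p + (torsionPoint T₁ s, torsionPoint T₂ s) ∨
        q = -p + (torsionPoint T₁ s, torsionPoint T₂ s) := by
  have hmem : ∀ r, r ∈ torsionGraph φ ↔ ∃ s, (torsionPoint T₁ s, torsionPoint T₂ s) = r := by
    intro r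
    constructor
    · rintro ⟨⟨x, hx⟩, rfl⟩
      obtain ⟨s, rfl⟩ := h₁.exists_of_add_self hk (mem_twoTorsion_iff.1 hx)
      exact ⟨s, Prod.ext rfl (hφ s).symm⟩
    · rintro ⟨s, rfl⟩
      exact ⟨⟨_, h₁.torsionPoint_mem s⟩, Prod.ext rfl (hφ s)⟩
  have hmk : ∀ p q : W₁.toAffine.Point × W₂.toAffine.Point,
      (QuotientAddGroup.mk (s := torsionGraph φ) q = QuotientAddGroup.mk (s := torsionGraph φ) p) ↔
        ∃ s, q = p + (torsionPoint T₁ s, torsionPoint T₂ s) := by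
    intro p q
    rw [eq_comm, QuotientAddGroup.eq, hmem]
    refine exists_congr fun s => ?_
    rw [eq_neg_add_iff_add_eq, eq_comm]
  rw [toKummer, toKummer, Quotient.eq, exists_or, ← hmk, ← hmk, QuotientAddGroup.mk_neg]
  rfl

theorem WeierstrassCurve.IsTwoTorsionFrame.eq_add_of_sign (hk : (2 : k) ≠ 0)
    (h₁ : W₁.IsTwoTorsionFrame e T₁) {P P' : W₁.toAffine.Point} {c : k} {δ : ℤˣ}
    {s : Option (Fin 3)} (hP : quarticVec W₁ e P' =
      c • signL ((fun _ => δ) * translateSign s) (quarticVec W₁ e P)) :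
    P' = P + torsionPoint T₁ s := by
  obtain ⟨b, hb, h⟩ := h₁.quarticVec_add hk P s
  refine h₁.eq_of_quarticVec hk (c := c * ((δ : ℤ) : k) * b⁻¹) ?_
  have : signL (fun _ => δ) (signL (translateSign s) (quarticVec W₁ e P)) =
      ((δ : ℤ) : k) • signL (translateSign s) (quarticVec W₁ e P) := rfl
  rw [h, hP, signL_mul, this, smul_smul, smul_smul, inv_mul_cancel_right₀ hb]

/-- The differences of `e` and `f` are proportional, so rescaling `z 0` carries one quartic to the
other. Two-torsion points have `z 0 = 0` and are told apart by the signs of the other coordinates,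
which the rescaling preserves. -/
theorem isInducedByIsomorphism_of_add_eq_one [IsAlgClosed k] [W₁.IsElliptic] [W₂.IsElliptic]
    (hk : (2 : k) ≠ 0) (h₁ : W₁.IsTwoTorsionFrame e T₁) (h₂ : W₂.IsTwoTorsionFrame f T₂)
    (φ : TwoTorsion W₁ ≃+ TwoTorsion W₂)
    (hφ : ∀ s, (φ ⟨torsionPoint T₁ s, h₁.torsionPoint_mem s⟩ : W₂.toAffine.Point) =
      torsionPoint T₂ s)
    (h : (e 2 - e 0) * (f 1 - f 0) = (e 1 - e 0) * (f 2 - f 0)) : IsInducedByIsomorphism φ := by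
  have n : e 1 - e 0 ≠ 0 := sub_ne_zero.2 (h₁.injective.ne (by decide))
  have m : f 1 - f 0 ≠ 0 := sub_ne_zero.2 (h₂.injective.ne (by decide))
  obtain ⟨r, hr⟩ := IsAlgClosed.exists_pow_nat_eq ((e 1 - e 0) / (f 1 - f 0)) two_pos
  have hr0 : r ≠ 0 := by
    rintro rfl
    exact div_ne_zero n m (by simpa using hr.symm)
  have hr1 : (f 1 - f 0) * r ^ 2 = e 1 - e 0 := by rw [hr, mul_div_cancel₀ _ m]
  have hr2 : (f 2 - f 0) * r ^ 2 = e 2 - e 0 :=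
    mul_left_cancel₀ m (by linear_combination (f 2 - f 0) * hr1 - h)
  obtain ⟨ψ, hψ, hψ'⟩ := exists_isIsomorphism_of_monomialEquiv hk h₁.toHasTwoTorsion
    (Z := quartic f) 1 ![Units.mk0 r hr0, 1, 1, 1] (by
      intro z hz
      rw [mk_mem_quartic_iff]
      simp only [OnQuartic, monomialEquiv_apply, Equiv.Perm.coe_one, id_eq, Matrix.cons_val,
        Units.val_one, Units.val_mk0, one_mul, mul_pow, ← mul_assoc, hr1, hr2])
  refine ⟨ψ.trans (quarticEquiv hk h₂.toHasTwoTorsion).symm,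
    hψ.trans (isIsomorphism_quarticEquiv hk h₂.toHasTwoTorsion).symm, ?_⟩
  rintro ⟨x, hx⟩
  obtain ⟨s, rfl⟩ := h₁.exists_of_add_self hk (mem_twoTorsion_iff.1 hx)
  rw [hφ, Equiv.trans_apply, Equiv.symm_apply_eq]
  refine Subtype.ext ((hψ' _).trans ?_)
  obtain ⟨b, hb, h₁s⟩ := h₁.quarticVec_add hk 0 s
  obtain ⟨c, hc, h₂s⟩ := h₂.quarticVec_add hk 0 s
  rw [zero_add] at h₁s h₂s
  refine Projectivization.mk_eq_mk_of_smul _ _ (b * c⁻¹) ?_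
  rw [h₁s, h₂s, map_smul, smul_smul, inv_mul_cancel_right₀ hc]
  congr 1
  funext l
  rw [monomialEquiv_apply]
  change signL (translateSign s) ![0, 1, 1, 1] l = _ * signL (translateSign s) ![0, 1, 1, 1] l
  fin_cases l <;> simp [signL]

end Kummer

/-! ### The Weber map on the Kummer surface. -/

section Kummer

open WeierstrassCurve

variable {k : Type*} [Field k] [DecidableEq k] {W₁ W₂ : WeierstrassCurve k}
  {e f : Fin 3 → k} {T₁ : Fin 3 → W₁.toAffine.Point} {T₂ : Fin 3 → W₂.toAffine.Point}
  {κ₁ κ₂ : k} {d d' : Fin 4 → kˣ}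

theorem weberMap_eq_of_toKummer_eq (hk : (2 : k) ≠ 0) (h₁ : W₁.IsTwoTorsionFrame e T₁)
    (h₂ : W₂.IsTwoTorsionFrame f T₂) (φ : TwoTorsion W₁ ≃+ TwoTorsion W₂)
    (hφ : ∀ s, (φ ⟨torsionPoint T₁ s, h₁.torsionPoint_mem s⟩ : W₂.toAffine.Point) =
      torsionPoint T₂ s) (hκ₁ : κ₁ ≠ 0) (hκ₂ : κ₂ ≠ 0)
    {ψ₁ : W₁.toAffine.Point → spaceCurve κ₁} {ψ₂ : W₂.toAffine.Point → spaceCurve κ₂}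
    (hψ₁ : ∀ P, (ψ₁ P : ℙ k (Fin 4 → k)) =
      Projectivization.mk k (monomialEquiv permL d (quarticVec W₁ e P))
        (by simpa using h₁.quarticVec_ne_zero hk P))
    (hψ₂ : ∀ P, (ψ₂ P : ℙ k (Fin 4 → k)) =
      Projectivization.mk k (monomialEquiv permR d' (quarticVec W₂ f P))
        (by simpa using h₂.quarticVec_ne_zero hk P))
    {p q : W₁.toAffine.Point × W₂.toAffine.Point} (h : toKummer φ p = toKummer φ q) :
    weberMap hκ₁ hκ₂ (Prod.map ψ₁ ψ₂ p) = weberMap hκ₁ hκ₂ (Prod.map ψ₁ ψ₂ q) := by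
  have hadd : ∀ (p : W₁.toAffine.Point × W₂.toAffine.Point) s, weberMap hκ₁ hκ₂
      (Prod.map ψ₁ ψ₂ (p + (torsionPoint T₁ s, torsionPoint T₂ s))) =
      weberMap hκ₁ hκ₂ (Prod.map ψ₁ ψ₂ p) := by
    intro p s
    obtain ⟨c, -, hc⟩ := h₁.quarticVec_add hk p.1 s
    obtain ⟨c', -, hc'⟩ := h₂.quarticVec_add hk p.2 s
    exact weberMap_eq_of_sign hk h₁.toHasTwoTorsion h₂.toHasTwoTorsion hκ₁ hκ₂ hψ₁ hψ₂ _ hc hc'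
  have hneg : ∀ p : W₁.toAffine.Point × W₂.toAffine.Point, weberMap hκ₁ hκ₂
      (Prod.map ψ₁ ψ₂ (-p)) = weberMap hκ₁ hκ₂ (Prod.map ψ₁ ψ₂ p) := by
    intro p
    refine weberMap_eq_of_sign hk h₁.toHasTwoTorsion h₂.toHasTwoTorsion hκ₁ hκ₂ hψ₁ hψ₂
      (c := 1) (c' := 1) ![-1, 1, 1, 1] ?_ ?_ <;> rw [one_smul] <;> exact quarticVec_neg _
  obtain ⟨s, rfl | rfl⟩ := (toKummer_eq_iff hk h₁ φ hφ p q).1 h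
  · exact (hadd p s).symm
  · rw [hadd, hneg]

theorem toKummer_eq_of_weberMap_eq [IsAlgClosed k] (hk : (2 : k) ≠ 0) (h₁ : W₁.IsTwoTorsionFrame e T₁)
    (h₂ : W₂.IsTwoTorsionFrame f T₂) (φ : TwoTorsion W₁ ≃+ TwoTorsion W₂)
    (hφ : ∀ s, (φ ⟨torsionPoint T₁ s, h₁.torsionPoint_mem s⟩ : W₂.toAffine.Point) =
      torsionPoint T₂ s) (hκ₁ : κ₁ ≠ 0) (hκ₂ : κ₂ ≠ 0) (hs : κ₁ + κ₂ ≠ 1)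
    {ψ₁ : W₁.toAffine.Point → spaceCurve κ₁} {ψ₂ : W₂.toAffine.Point → spaceCurve κ₂}
    (hψ₁ : ∀ P, (ψ₁ P : ℙ k (Fin 4 → k)) =
      Projectivization.mk k (monomialEquiv permL d (quarticVec W₁ e P))
        (by simpa using h₁.quarticVec_ne_zero hk P))
    (hψ₂ : ∀ P, (ψ₂ P : ℙ k (Fin 4 → k)) =
      Projectivization.mk k (monomialEquiv permR d' (quarticVec W₂ f P))
        (by simpa using h₂.quarticVec_ne_zero hk P))
    {p q : W₁.toAffine.Point × W₂.toAffine.Point}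
    (h : weberMap hκ₁ hκ₂ (Prod.map ψ₁ ψ₂ p) = weberMap hκ₁ hκ₂ (Prod.map ψ₁ ψ₂ q)) :
    toKummer φ p = toKummer φ q := by
  obtain ⟨ε, c, c', hc, hc'⟩ := exists_sign_of_weberMap_eq hk h₁.toHasTwoTorsion
    h₂.toHasTwoTorsion hκ₁ hκ₂ hs hψ₁ hψ₂ h.symm
  -- The common sign `δ` is projectively invisible, `ν` is trivial or the inversion, and the same
  -- `s` gives corresponding two-torsion points on both curves.
  obtain ⟨δ, ν, s, hν, rfl⟩ := exists_translateSign_eq ε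
  refine (toKummer_eq_iff hk h₁ φ hφ p q).2 ⟨s, ?_⟩
  rcases hν with rfl | rfl
  · rw [one_mul] at hc hc'
    exact Or.inl (Prod.ext (h₁.eq_add_of_sign hk hc) (h₂.eq_add_of_sign hk hc'))
  · rw [mul_comm ![-1, 1, 1, 1], ← mul_assoc, signL_mul, ← quarticVec_neg] at hc hc'
    exact Or.inr (Prod.ext (h₁.eq_add_of_sign hk hc) (h₂.eq_add_of_sign hk hc'))

end Kummer

/-! ### The tetrahedroid as a Kummer surface. -/

theorem mainTheorem5 {k : Type*} [Field k] [IsAlgClosed k] [DecidableEq k] (hk : (2 : k) ≠ 0) :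
    (∀ (κ₁ κ₂ : k) (h₁ : κ₁ ≠ 0) (h₂ : κ₂ ≠ 0), κ₁ ≠ 1 → κ₂ ≠ 1 →
      ∀ a₀₁ a₀₃ a₁₂ i a₂₃ : k, a₀₁ ^ 2 = κ₂ - 1 → a₀₃ ^ 2 = κ₂ → a₁₂ ^ 2 = κ₁ - 1 →
        i ^ 2 = -1 → a₂₃ ^ 2 = κ₁ →
        FunctionStructure.IsMorphism
          ((projectiveSubvariety (spaceCurve κ₁)).prod (projectiveSubvariety (spaceCurve κ₂)))
          (projectiveSpace k 4) (weberMap h₁ h₂) ∧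
        Set.range (weberMap h₁ h₂) = tetrahedroid a₀₁ 1 a₀₃ a₁₂ i a₂₃ ∧
        (κ₁ + κ₂ ≠ 1 →
          IsGenericallyToOneOnto 8 (weberMap h₁ h₂) (tetrahedroid a₀₁ 1 a₀₃ a₁₂ i a₂₃))) ∧
    (∀ (W₁ W₂ : WeierstrassCurve k) [W₁.IsElliptic] [W₂.IsElliptic]
      (φ : TwoTorsion W₁ ≃+ TwoTorsion W₂),
      ∃ (κ₁ κ₂ : k) (h₁ : κ₁ ≠ 0) (h₂ : κ₂ ≠ 0) (ψ₁ : W₁.toAffine.Point ≃ spaceCurve κ₁)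
        (ψ₂ : W₂.toAffine.Point ≃ spaceCurve κ₂) (g : KummerSurface φ → ℙ k (Fin 4 → k)),
        κ₁ ≠ 1 ∧ κ₂ ≠ 1 ∧
        FunctionStructure.IsIsomorphism W₁.variety (projectiveSubvariety (spaceCurve κ₁)) ψ₁ ∧
        FunctionStructure.IsIsomorphism W₂.variety (projectiveSubvariety (spaceCurve κ₂)) ψ₂ ∧
        FunctionStructure.IsMorphism (kummerSurface φ) (projectiveSpace k 4) g ∧
        (∀ p q, g (toKummer φ (p, q)) = weberMap h₁ h₂ (ψ₁ p, ψ₂ q)) ∧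
        (¬ IsInducedByIsomorphism φ →
          κ₁ + κ₂ ≠ 1 ∧
          ∀ a₀₁ a₀₃ a₁₂ i a₂₃ : k, a₀₁ ^ 2 = κ₂ - 1 → a₀₃ ^ 2 = κ₂ → a₁₂ ^ 2 = κ₁ - 1 →
            i ^ 2 = -1 → a₂₃ ^ 2 = κ₁ →
            ∃ e : KummerSurface φ ≃ tetrahedroid a₀₁ 1 a₀₃ a₁₂ i a₂₃,
              (∀ P, (e P : ℙ k (Fin 4 → k)) = g P) ∧
              FunctionStructure.IsIsomorphism (kummerSurface φ)
                (projectiveSubvariety (tetrahedroid a₀₁ 1 a₀₃ a₁₂ i a₂₃)) e)) := by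
  refine ⟨fun κ₁ κ₂ h₁ h₂ _ _ a₀₁ a₀₃ a₁₂ i a₂₃ h₀₁ h₀₃ h₁₂ hi h₂₃ => ?_, fun W₁ W₂ _ _ φ => ?_⟩
  · have hZ := range_weberMap hk h₁ h₂ h₀₁ h₀₃ h₁₂ hi h₂₃
    exact ⟨isMorphism_weberMap h₁ h₂, hZ, fun hs => isGenericallyToOneOnto_weberMap hk h₁ h₂ hs hZ⟩
  obtain ⟨e, T₁, hT₁⟩ := WeierstrassCurve.exists_isTwoTorsionFrame hk W₁
  obtain ⟨f, T₂, hT₂, hφ⟩ := exists_isTwoTorsionFrame_of_equiv hk hT₁ φ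
  obtain ⟨κ₁, d, ψ₁, hκ₁, hψ₁, hψ₁'⟩ := hT₁.toHasTwoTorsion.exists_spaceCurve_left hk
  obtain ⟨κ₂, d', ψ₂, hκ₂, hψ₂, hψ₂'⟩ := hT₂.toHasTwoTorsion.exists_spaceCurve_right hk
  obtain ⟨-, e12, e20⟩ := hT₁.sub_ne_zero
  obtain ⟨-, f12, f20⟩ := hT₂.sub_ne_zero
  have h₁ : κ₁ ≠ 0 := fun h => e20 (by linear_combination -hκ₁ + (e 1 - e 0) * h)
  have h₂ : κ₂ ≠ 0 := fun h => f12 (by linear_combination -hκ₂ + (f 1 - f 0) * h)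
  have h₁' : κ₁ ≠ 1 := fun h => e12 (by linear_combination hκ₁ - (e 1 - e 0) * h)
  have h₂' : κ₂ ≠ 1 := fun h => f20 (by linear_combination hκ₂ - (f 1 - f 0) * h)
  have hF : FunctionStructure.IsMorphism (W₁.variety.prod W₂.variety)
      ((projectiveSubvariety (spaceCurve κ₁)).prod (projectiveSubvariety (spaceCurve κ₂)))
      (Prod.map ψ₁ ψ₂) := hψ₁.1.prodMap hψ₂.1
  have hlift := fun p => weberMap_eq_of_toKummer_eq hk hT₁ hT₂ φ hφ h₁ h₂ hψ₁' hψ₂'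
    (Function.surjInv_eq (toKummer_surjective φ) (toKummer φ p))
  -- The set-theoretic section is arbitrary; invariance of the Weber map makes the value independent
  -- of it.
  set g : KummerSurface φ → ℙ k (Fin 4 → k) := fun x =>
    weberMap h₁ h₂ (Prod.map ψ₁ ψ₂ (Function.surjInv (toKummer_surjective φ) x)) with hg
  have hgF : ∀ p, g (toKummer φ p) = weberMap h₁ h₂ (Prod.map ψ₁ ψ₂ p) := hlift
  have hgm : FunctionStructure.IsMorphism (kummerSurface φ) (projectiveSpace k 4) g := by
    refine FunctionStructure.IsMorphism.of_comp_quotient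
      (FunctionStructure.IsMorphism.of_comp_quotient ?_)
    convert FunctionStructure.IsMorphism.comp (isMorphism_weberMap h₁ h₂) hF using 1
    exact funext hgF
  refine ⟨κ₁, κ₂, h₁, h₂, ψ₁, ψ₂, g, h₁', h₂', hψ₁, hψ₂, hgm, fun p q => hgF (p, q), fun hφ' => ?_⟩
  -- Since `κ₂ = 1 - (f 2 - f 0) / (f 1 - f 0)`, the equality `κ₁ + κ₂ = 1` says that `e` and `f`
  -- have the same ratio of differences.
  have hs : κ₁ + κ₂ ≠ 1 := fun h => hφ' (isInducedByIsomorphism_of_add_eq_one hk hT₁ hT₂ φ hφ (by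
    linear_combination -(f 1 - f 0) * hκ₁ - (e 1 - e 0) * hκ₂ + (e 1 - e 0) * (f 1 - f 0) * h))
  refine ⟨hs, fun a₀₁ a₀₃ a₁₂ i a₂₃ h₀₁ h₀₃ h₁₂ hi h₂₃ => ?_⟩
  have hZ := range_weberMap hk h₁ h₂ h₀₁ h₀₃ h₁₂ hi h₂₃
  set Z := tetrahedroid a₀₁ 1 a₀₃ a₁₂ i a₂₃
  have hgZ : ∀ x, g x ∈ Z := fun x => hZ ▸ Set.mem_range_self _
  have hbij : Function.Bijective fun x => (⟨g x, hgZ x⟩ : Z) := by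
    constructor
    · intro x y hxy
      obtain ⟨p, rfl⟩ := toKummer_surjective φ x
      obtain ⟨q, rfl⟩ := toKummer_surjective φ y
      have := congrArg Subtype.val hxy
      simp only [hgF] at this
      exact toKummer_eq_of_weberMap_eq hk hT₁ hT₂ φ hφ h₁ h₂ hs hψ₁' hψ₂' this
    · rintro ⟨z, hz⟩
      rw [← hZ] at hz
      obtain ⟨⟨p, q⟩, rfl⟩ := hz
      refine ⟨toKummer φ (ψ₁.symm p, ψ₂.symm q), Subtype.ext ?_⟩
      simp [hgF]
  refine ⟨Equiv.ofBijective _ hbij, fun x => rfl,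
    FunctionStructure.IsMorphism.to_induced (i := Subtype.val) hgm, ?_⟩
  have hF' := fun p => (hZ ▸ Set.mem_range_self p : weberMap h₁ h₂ p ∈ Z)
  -- Regularity of the inverse is tested after composition with the Weber map, where it becomes
  -- `toKummer` composed with the inverses of `ψ₁` and `ψ₂`.
  refine (isQuotientMap_weberMap hk h₁ h₂ hs hZ (fun p => ⟨_, hF' p⟩) fun p => rfl).isMorphism ?_
  convert FunctionStructure.IsMorphism.comp (isMorphism_toKummer φ) (hψ₁.2.prodMap hψ₂.2) using 1
  funext p
  rw [Function.comp_apply, Equiv.symm_apply_eq]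
  refine Subtype.ext (Eq.trans ?_ (hgF _).symm)
  rw [Prod.map_map, Equiv.self_comp_symm, Equiv.self_comp_symm, Prod.map_id, id]
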